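/- Let $\mathrm M$ be a loopless matroid of rank $d$ on a finite set $E$; a flat is proper if it is not $E$. The Chow ring $\underline{\mathrm{CH}}(\mathrm M)$ is the quotient of $\mathbb Q[x_F : F \text{ a nonempty proper flat}]$ by the linear forms $\sum_{i\in F}x_F-\sum_{j\in F}x_F$ ($i\neq j$ in $E$) and the monomials $x_Fx_G$ with $F,G$ incomparable. The augmented Chow ring $\mathrm{CH}(\mathrm M)$ is the quotient of $\mathbb Q[y_i, x_F : i\in E,\ F \text{ a proper flat}]$ by the linear forms $y_i-\sum_{i\notin F}x_F$ ($i \in E$), the monomials $x_Fx_G$ with $F,G$ incomparable, and the monomials $y_ix_F$ with $i\notin F$. Both are graded with all variables in degree $1$. There is a unique linear map $\underline{\deg}:\underline{\mathrm{CH}}^{d-1}(\mathrm M)\to\mathbb Q$ with value $1$ on $\prod_{F\in\mathscr F}x_F$ for every complete flag $\mathscr F$ of nonempty proper flats, and a unique linear map $\deg:\mathrm{CH}^{d}(\mathrm M)\to\mathbb Q$ with value $1$ on $\prod_{i\in I}y_i\prod_{F\in\mathscr F}x_F$ for every independent set $I$ and every flag $\mathscr F$ of proper flats containing $I$ with $|I|+|\mathscr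 F|=d$. Extended by zero to the other degrees, they define the Poincaré pairings $(a,b)\mapsto\underline{\deg}(ab)$ and $(a,b)\mapsto\deg(ab)$. Let $\underline\alpha_{\mathrm M}=\sum_{i\in G}x_G\in\underline{\mathrm{CH}}^1(\mathrm M)$, where $i\in E$ is any fixed element (the class does not depend on $i$) and $G$ runs over the nonempty proper flats containing $i$, and let $\alpha_{\mathrm M}=\sum_Gx_G\in\mathrm{CH}^1(\mathrm M)$, over all proper flats $G$. (If $E=\varnothing$, then $\underline{\mathrm{CH}}(\mathrm M)=\mathbb Q$ and we put $\underline\alpha_{\mathrm M}=0$, $\underline{\deg}=0$.) Let $\underline{\mathrm H}_{\underline\alpha}(\mathrm M)$ and $\mathrm H_\alpha(\mathrm M)$ be the subalgebras generated by these elements, and let $\underline{\mathrm J}_{\underline\alpha}(\mathrm M)$ and $\mathrm J_\alpha(\mathrm M)$ be the graded subspaces obtained from them by replacing the piece of degree $d-1$, respectively of degree $d$, by $0$. For a proper flat $F$, let $\mathrm M^F$ be the localization (the restriction of $\mathrm M$ to $F$) and $\mathrm M_F$ the contraction of $\mathrm M$ by $F$, a matroid on $E\setminus F$. Let $\underline\psi^F:\underline{\mathrm{CH}}(\mathrm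 M_F)\otimes\underline{\mathrm{CH}}(\mathrm M^F)\to\underline{\mathrm{CH}}(\mathrm M)$ (for $F\ne\varnothing$) and $\psi^F:\underline{\mathrm{CH}}(\mathrm M_F)\otimes\mathrm{CH}(\mathrm M^F)\to\mathrm{CH}(\mathrm M)$ be the linear maps with $$\prod_{F'}x_{F'\setminus F}\otimes\prod_{F''}x_{F''}\longmapsto x_F\prod_{F'}x_{F'}\prod_{F''}x_{F''},$$ where $F'$ runs over any finite family of proper flats of $\mathrm M$ strictly containing $F$ and $F''$ over any finite family of proper flats of $\mathrm M$ strictly contained in $F$ (nonempty ones in the case of $\underline\psi^F$), repetitions being allowed. (1) Let $\underline{\mathscr C}$ be the set of proper flats of rank at least two. There is a decomposition of $\underline{\mathrm H}_{\underline\alpha}(\mathrm M)$-modules $$\underline{\mathrm{CH}}(\mathrm M)=\underline{\mathrm H}_{\underline\alpha}(\mathrm M)\oplus\bigoplus_{F\in\underline{\mathscr C}}\underline\psi^F\big(\underline{\mathrm{CH}}(\mathrm M_F)\otimes\underline{\mathrm J}_{\underline\alpha}(\mathrm M^F)\big),$$ in which the maps $\underline\psi^F$ are injective and all pairs of distinct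 summands are orthogonal for the Poincaré pairing of $\underline{\mathrm{CH}}(\mathrm M)$. (2) Let $\mathscr C$ be the set of nonempty proper flats. There is a decomposition of $\mathrm H_\alpha(\mathrm M)$-modules $$\mathrm{CH}(\mathrm M)=\mathrm H_\alpha(\mathrm M)\oplus\bigoplus_{F\in\mathscr C}\psi^F\big(\underline{\mathrm{CH}}(\mathrm M_F)\otimes\mathrm J_\alpha(\mathrm M^F)\big),$$ in which the maps $\psi^F$ are injective and all pairs of distinct summands are orthogonal for the Poincaré pairing of $\mathrm{CH}(\mathrm M)$. -/

import Mathlib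

namespace MatroidChow

open scoped Matroid

variable {α : Type*}

/-- The nonempty proper flats of a matroid. -/
abbrev NPFlat (M : Matroid α) : Type _ := {F : Set α // M.IsFlat F ∧ F.Nonempty ∧ F ≠ M.E}

/-- The proper flats of a matroid. -/
abbrev PFlat (M : Matroid α) : Type _ := {F : Set α // M.IsFlat F ∧ F ≠ M.E}

noncomputable instance instFintypeNPFlat [Finite α] (M : Matroid α) : Fintype (NPFlat M) :=
  Fintype.ofFinite _

noncomputable instance instFintypePFlat [Finite α] (M : Matroid α) : Fintype (PFlat M) :=
  Fintype.ofFinite _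

/-- A nonempty proper flat, regarded as a proper flat. -/
def NPFlat.toPFlat {M : Matroid α} (F : NPFlat M) : PFlat M := ⟨F.1, F.2.1, F.2.2.2⟩

/-- The rank of a matroid, as a natural number. -/
noncomputable def rk (M : Matroid α) : ℕ := M.eRank.toNat

/-! ### Flats of the localization `M ↾ F` and of the contraction `M ／ F` -/

theorem isFlat_restrict {M : Matroid α} {F G : Set α} (hF : M.IsFlat F)
    (hG : (M ↾ F).IsFlat G) : M.IsFlat G := by
  have hGF : G ⊆ F := hG.subset_ground
  rw [Matroid.isFlat_iff_closure_eq] at hG ⊢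
  rw [Matroid.restrict_closure_eq _ hGF hF.subset_ground,
    Set.inter_eq_left.2 ((M.closure_subset_closure hGF).trans hF.closure.subset)] at hG
  exact hG

theorem isFlat_restrict_of_subset {M : Matroid α} {F G : Set α} (hF : M.IsFlat F)
    (hG : M.IsFlat G) (hGF : G ⊆ F) : (M ↾ F).IsFlat G := by
  rw [Matroid.isFlat_iff_closure_eq] at hG ⊢
  rw [Matroid.restrict_closure_eq _ hGF hF.subset_ground, hG, Set.inter_eq_left.2 hGF]

theorem isFlat_contract {M : Matroid α} {F G : Set α} (hF : M.IsFlat F)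
    (hG : (M ／ F).IsFlat G) : M.IsFlat (G ∪ F) := by
  rw [Matroid.isFlat_iff_closure_eq] at hG ⊢
  rw [Matroid.contract_closure_eq] at hG
  have h : F ⊆ M.closure (G ∪ F) :=
    M.subset_closure_of_subset' Set.subset_union_right hF.subset_ground
  conv_rhs => rw [← hG]
  rw [Set.sdiff_union_of_subset h]

theorem isFlat_contract_of_subset {M : Matroid α} {F G : Set α}
    (hG : M.IsFlat G) (hFG : F ⊆ G) : (M ／ F).IsFlat (G \ F) := by
  rw [Matroid.isFlat_iff_closure_eq] at hG ⊢
  rw [Matroid.contract_closure_eq, Set.sdiff_union_of_subset hFG, hG]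

theorem disjoint_of_isFlat_contract {M : Matroid α} {F G : Set α}
    (hG : (M ／ F).IsFlat G) : Disjoint G F :=
  Set.disjoint_left.2 fun _ ha hb => (hG.subset_ground ha).2 hb

/-- `G ↦ G ∪ F`: proper flats of the contraction are proper flats of `M`. -/
theorem union_ne_ground {M : Matroid α} {F G : Set α} (hG : (M ／ F).IsFlat G)
    (hne : G ≠ (M ／ F).E) : G ∪ F ≠ M.E := by
  intro h
  refine hne ?_
  rw [Matroid.contract_ground, ← h, Set.union_sdiff_right,
    (disjoint_of_isFlat_contract hG).sdiff_eq_left]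

theorem ne_ground_of_restrict {M : Matroid α} {F G : Set α} (hF : M.IsFlat F)
    (hG : (M ↾ F).IsFlat G) (hne : G ≠ (M ↾ F).E) : G ≠ M.E := by
  intro h
  refine hne (Set.Subset.antisymm hG.subset_ground ?_)
  rw [h]
  exact hF.subset_ground

/-- The nonempty proper flat `G ∪ F` of `M` for a nonempty proper flat `G` of `M ／ F`. -/
def NPFlat.ofContract {M : Matroid α} (F : NPFlat M) (G : NPFlat (M ／ F.1)) : NPFlat M :=
  ⟨G.1 ∪ F.1, isFlat_contract F.2.1 G.2.1, G.2.2.1.inl, union_ne_ground G.2.1 G.2.2.2⟩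

/-- A nonempty proper flat of `M ↾ F`, regarded as a nonempty proper flat of `M`. -/
def NPFlat.ofRestrict {M : Matroid α} (F : NPFlat M) (G : NPFlat (M ↾ F.1)) : NPFlat M :=
  ⟨G.1, isFlat_restrict F.2.1 G.2.1, G.2.2.1, ne_ground_of_restrict F.2.1 G.2.1 G.2.2.2⟩

/-- The proper flat `G ∪ F` of `M` for a nonempty proper flat `G` of `M ／ F`. -/
def PFlat.ofContract {M : Matroid α} (F : PFlat M) (G : NPFlat (M ／ F.1)) : PFlat M :=
  ⟨G.1 ∪ F.1, isFlat_contract F.2.1 G.2.1, union_ne_ground G.2.1 G.2.2.2⟩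

/-- A proper flat of `M ↾ F`, regarded as a proper flat of `M`. -/
def PFlat.ofRestrict {M : Matroid α} (F : PFlat M) (G : PFlat (M ↾ F.1)) : PFlat M :=
  ⟨G.1, isFlat_restrict F.2.1 G.2.1, ne_ground_of_restrict F.2.1 G.2.1 G.2.2⟩

section Rings

variable [Finite α] (M : Matroid α)

/-! ### The Chow ring -/

open Classical in
/-- The linear form `∑_{i ∈ F} x_F` in the polynomial ring on the nonempty proper flats. -/
noncomputable def linForm (i : α) : MvPolynomial (NPFlat M) ℚ :=
  ∑ F : NPFlat M with i ∈ F.1, MvPolynomial.X F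

/-- The relations of the Chow ring. -/
noncomputable def chowIdeal : Ideal (MvPolynomial (NPFlat M) ℚ) :=
  Ideal.span {p | ∃ i ∈ M.E, ∃ j ∈ M.E, i ≠ j ∧ p = linForm M i - linForm M j} ⊔
  Ideal.span {p | ∃ F G : NPFlat M, ¬ F.1 ⊆ G.1 ∧ ¬ G.1 ⊆ F.1 ∧
    p = MvPolynomial.X F * MvPolynomial.X G}

/-- The Chow ring of `M`. -/
abbrev Chow : Type _ := MvPolynomial (NPFlat M) ℚ ⧸ chowIdeal M

/-- The generator `x_F` of the Chow ring. -/
noncomputable def Chow.x (F : NPFlat M) : Chow M :=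
  Ideal.Quotient.mk (chowIdeal M) (MvPolynomial.X F)

/-- The graded piece of degree `k` of the Chow ring. -/
noncomputable def Chow.gr (k : ℕ) : Submodule ℚ (Chow M) :=
  (MvPolynomial.homogeneousSubmodule (NPFlat M) ℚ k).map
    (Ideal.Quotient.mkₐ ℚ (chowIdeal M)).toLinearMap

open Classical in
/-- The element `∑_{i ∈ G} x_G` of the Chow ring, for a chosen element `i` of the ground set.
It does not depend on the choice (`Chow.alpha_eq`). It is `0` if the ground set is empty. -/
noncomputable def Chow.alpha : Chow M :=
  if h : M.E.Nonempty then ∑ G : NPFlat M with h.some ∈ G.1, Chow.x M G else 0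

/-- The subalgebra generated by `α`. -/
noncomputable def Chow.H : Subalgebra ℚ (Chow M) := Algebra.adjoin ℚ {Chow.alpha M}

/-- The graded subspace obtained from the subalgebra generated by `α` by replacing its piece of
degree `d - 1` by zero, where `d` is the rank of `M`. -/
noncomputable def Chow.J : Submodule ℚ (Chow M) :=
  ⨆ (k : ℕ) (_ : k + 1 ≠ rk M), Subalgebra.toSubmodule (Chow.H M) ⊓ Chow.gr M k

/-- `deg` is the degree map of the Chow ring: the linear functional on the piece of degree `d - 1`
(extended by zero to the other graded pieces) with value `1` on the monomial of every complete flag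
of nonempty proper flats. -/
structure Chow.IsDegreeMap (deg : Chow M →ₗ[ℚ] ℚ) : Prop where
  eq_zero : ∀ k : ℕ, k + 1 ≠ rk M → ∀ a ∈ Chow.gr M k, deg a = 0
  flag : ∀ S : Finset (NPFlat M), IsChain (· ≤ ·) (S : Set (NPFlat M)) → S.card + 1 = rk M →
    deg (∏ F ∈ S, Chow.x M F) = 1

/-! ### The augmented Chow ring -/

/-- The variable `y_i`. -/
noncomputable def yVar (i : M.E) : MvPolynomial (M.E ⊕ PFlat M) ℚ := MvPolynomial.X (Sum.inl i)

/-- The variable `x_F`. -/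
noncomputable def xVar (F : PFlat M) : MvPolynomial (M.E ⊕ PFlat M) ℚ := MvPolynomial.X (Sum.inr F)

open Classical in
/-- The relations of the augmented Chow ring. -/
noncomputable def augIdeal : Ideal (MvPolynomial (M.E ⊕ PFlat M) ℚ) :=
  Ideal.span {p | ∃ i : M.E, p = yVar M i - ∑ F : PFlat M with i.1 ∉ F.1, xVar M F} ⊔
  Ideal.span ({p | ∃ F G : PFlat M, ¬ F.1 ⊆ G.1 ∧ ¬ G.1 ⊆ F.1 ∧ p = xVar M F * xVar M G} ∪
    {p | ∃ (i : M.E) (F : PFlat M), i.1 ∉ F.1 ∧ p = yVar M i * xVar M F})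

/-- The augmented Chow ring of `M`. -/
abbrev AugChow : Type _ := MvPolynomial (M.E ⊕ PFlat M) ℚ ⧸ augIdeal M

/-- The generator `x_F` of the augmented Chow ring. -/
noncomputable def AugChow.x (F : PFlat M) : AugChow M := Ideal.Quotient.mk (augIdeal M) (xVar M F)

/-- The generator `y_i` of the augmented Chow ring. -/
noncomputable def AugChow.y (i : M.E) : AugChow M := Ideal.Quotient.mk (augIdeal M) (yVar M i)

/-- The graded piece of degree `k` of the augmented Chow ring. -/
noncomputable def AugChow.gr (k : ℕ) : Submodule ℚ (AugChow M) :=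
  (MvPolynomial.homogeneousSubmodule (M.E ⊕ PFlat M) ℚ k).map
    (Ideal.Quotient.mkₐ ℚ (augIdeal M)).toLinearMap

/-- The sum of all `x_G`, over the proper flats `G`. -/
noncomputable def AugChow.alpha : AugChow M := ∑ G : PFlat M, AugChow.x M G

/-- The subalgebra generated by `α`. -/
noncomputable def AugChow.H : Subalgebra ℚ (AugChow M) := Algebra.adjoin ℚ {AugChow.alpha M}

/-- The graded subspace obtained from the subalgebra generated by `α` by replacing its piece of
degree `d` by zero, where `d` is the rank of `M`. -/
noncomputable def AugChow.J : Submodule ℚ (AugChow M) :=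
  ⨆ (k : ℕ) (_ : k ≠ rk M), Subalgebra.toSubmodule (AugChow.H M) ⊓ AugChow.gr M k

/-- `deg` is the degree map of the augmented Chow ring: the linear functional on the piece of
degree `d` (extended by zero to the other graded pieces) with value `1` on the monomial of every
maximal compatible pair `I ≤ S`: an independent set `I` and a flag `S` of proper flats that all
contain `I`, with `d` members together. For `I = ∅` these are the complete flags of proper flats. -/
structure AugChow.IsDegreeMap (deg : AugChow M →ₗ[ℚ] ℚ) : Prop where
  eq_zero : ∀ k : ℕ, k ≠ rk M → ∀ a ∈ AugChow.gr M k, deg a = 0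
  flag : ∀ (I : Finset M.E) (S : Finset (PFlat M)), M.Indep (Subtype.val '' (I : Set M.E)) →
    IsChain (· ≤ ·) (S : Set (PFlat M)) → (∀ F ∈ S, ∀ i ∈ I, i.1 ∈ F.1) →
    I.card + S.card = rk M → deg ((∏ i ∈ I, AugChow.y M i) * ∏ F ∈ S, AugChow.x M F) = 1

/-! ### Relations -/

variable {M}

theorem Chow.x_mul_x {F G : NPFlat M} (h₁ : ¬ F.1 ⊆ G.1) (h₂ : ¬ G.1 ⊆ F.1) :
    Chow.x M F * Chow.x M G = 0 := by
  rw [Chow.x, Chow.x, ← map_mul, Ideal.Quotient.eq_zero_iff_mem]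
  exact Ideal.mem_sup_right (Ideal.subset_span ⟨F, G, h₁, h₂, rfl⟩)

open Classical in
theorem Chow.sum_eq_sum {i j : α} (hi : i ∈ M.E) (hj : j ∈ M.E) :
    ∑ G : NPFlat M with i ∈ G.1, Chow.x M G = ∑ G : NPFlat M with j ∈ G.1, Chow.x M G := by
  by_cases hij : i = j
  · rw [hij]
  · have h : Ideal.Quotient.mk (chowIdeal M) (linForm M i - linForm M j) = 0 := by
      rw [Ideal.Quotient.eq_zero_iff_mem]
      exact Ideal.mem_sup_left (Ideal.subset_span ⟨i, hi, j, hj, hij, rfl⟩)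
    rw [map_sub, sub_eq_zero, linForm, linForm, map_sum, map_sum] at h
    exact h

open Classical in
theorem Chow.alpha_eq {i : α} (hi : i ∈ M.E) :
    Chow.alpha M = ∑ G : NPFlat M with i ∈ G.1, Chow.x M G := by
  have h : M.E.Nonempty := ⟨i, hi⟩
  rw [Chow.alpha, dif_pos h]
  exact Chow.sum_eq_sum h.some_mem hi

theorem AugChow.x_mul_x {F G : PFlat M} (h₁ : ¬ F.1 ⊆ G.1) (h₂ : ¬ G.1 ⊆ F.1) :
    AugChow.x M F * AugChow.x M G = 0 := by
  rw [AugChow.x, AugChow.x, ← map_mul, Ideal.Quotient.eq_zero_iff_mem]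
  exact Ideal.mem_sup_right (Ideal.subset_span (Or.inl ⟨F, G, h₁, h₂, rfl⟩))

theorem AugChow.y_mul_x {i : M.E} {F : PFlat M} (h : i.1 ∉ F.1) :
    AugChow.y M i * AugChow.x M F = 0 := by
  rw [AugChow.y, AugChow.x, ← map_mul, Ideal.Quotient.eq_zero_iff_mem]
  exact Ideal.mem_sup_right (Ideal.subset_span (Or.inr ⟨i, F, h, rfl⟩))

open Classical in
theorem AugChow.y_eq (i : M.E) :
    AugChow.y M i = ∑ F : PFlat M with i.1 ∉ F.1, AugChow.x M F := by
  have h : Ideal.Quotient.mk (augIdeal M)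
      (yVar M i - ∑ F : PFlat M with i.1 ∉ F.1, xVar M F) = 0 := by
    rw [Ideal.Quotient.eq_zero_iff_mem]
    exact Ideal.mem_sup_left (Ideal.subset_span ⟨i, rfl⟩)
  rw [map_sub, sub_eq_zero, map_sum] at h
  exact h

/-! ### Relations after multiplication by `x_F` -/

open Classical in
theorem Chow.sum_ofContract (F : NPFlat M) {i : α} (hi : i ∈ M.E) (hiF : i ∉ F.1) :
    (∑ G : NPFlat (M ／ F.1) with i ∈ G.1, Chow.x M (F.ofContract G)) * Chow.x M F =
      Chow.alpha M * Chow.x M F := by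
  rw [Chow.alpha_eq hi, Finset.sum_mul, Finset.sum_mul]
  refine Finset.sum_of_injOn F.ofContract ?_ ?_ ?_ fun _ _ => rfl
  · intro G _ G' _ h
    have h' : G.1 ∪ F.1 = G'.1 ∪ F.1 := congrArg Subtype.val h
    refine Subtype.ext ?_
    rw [← (disjoint_of_isFlat_contract G.2.1).sdiff_eq_left,
      ← (disjoint_of_isFlat_contract G'.2.1).sdiff_eq_left, ← Set.union_sdiff_right, h',
      Set.union_sdiff_right]
  · intro G hG
    simp only [Finset.coe_filter, Finset.mem_univ, true_and, Set.mem_ofPred_eq] at hG ⊢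
    exact Or.inl hG
  · intro H hH hH'
    simp only [Finset.mem_filter, Finset.mem_univ, true_and] at hH
    refine Chow.x_mul_x (fun h => hiF (h hH)) fun h => hH' ?_
    refine ⟨⟨H.1 \ F.1, isFlat_contract_of_subset H.2.1 h, ⟨i, hH, hiF⟩, fun he => H.2.2.2 ?_⟩,
      ?_, Subtype.ext (Set.sdiff_union_of_subset h)⟩
    · rw [← Set.sdiff_union_of_subset h, he, Matroid.contract_ground,
        Set.sdiff_union_of_subset F.2.1.subset_ground]
    · simp only [Finset.coe_filter, Finset.mem_univ, true_and, Set.mem_ofPred_eq]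
      exact ⟨hH, hiF⟩

open Classical in
theorem Chow.sum_ofRestrict (F : NPFlat M) {i : α} (hiF : i ∈ F.1) :
    (∑ G : NPFlat (M ↾ F.1) with i ∈ G.1, Chow.x M (F.ofRestrict G)) * Chow.x M F =
      Chow.alpha M * Chow.x M F -
        (∑ G : NPFlat M with F.1 ⊆ G.1, Chow.x M G) * Chow.x M F := by
  rw [Chow.alpha_eq (F.2.1.subset_ground hiF), eq_sub_iff_add_eq, ← add_mul]
  have hsplit : ∑ G : NPFlat M with i ∈ G.1, Chow.x M G =
      ∑ G : NPFlat M with (i ∈ G.1 ∧ ¬ F.1 ⊆ G.1), Chow.x M G +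
        ∑ G : NPFlat M with F.1 ⊆ G.1, Chow.x M G := by
    rw [← Finset.sum_filter_add_sum_filter_not (Finset.univ.filter fun G : NPFlat M => i ∈ G.1)
      (fun G => ¬ F.1 ⊆ G.1), Finset.filter_filter, Finset.filter_filter]
    congr 1
    refine Finset.sum_congr (Finset.filter_congr fun G _ => ?_) fun _ _ => rfl
    simp only [not_not]
    exact ⟨fun h => h.2, fun h => ⟨h hiF, h⟩⟩
  rw [hsplit, add_mul, add_mul]
  congr 1
  rw [Finset.sum_mul, Finset.sum_mul]
  refine Finset.sum_of_injOn F.ofRestrict ?_ ?_ ?_ fun _ _ => rfl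
  · intro G _ G' _ h
    have h' : G.1 = G'.1 := congrArg (fun K : NPFlat M => K.1) h
    exact Subtype.ext h'
  · intro G hG
    simp only [Finset.coe_filter, Finset.mem_univ, true_and, Set.mem_ofPred_eq] at hG ⊢
    exact ⟨hG, fun h => G.2.2.2 (Set.Subset.antisymm G.2.1.subset_ground h)⟩
  · intro H hH hH'
    simp only [Finset.mem_filter, Finset.mem_univ, true_and] at hH
    refine Chow.x_mul_x (fun h => hH' ?_) hH.2
    refine ⟨⟨H.1, isFlat_restrict_of_subset F.2.1 H.2.1 h, H.2.2.1, fun he => hH.2 ?_⟩, ?_, rfl⟩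
    · rw [he, Matroid.restrict_ground_eq]
    · simp only [Finset.coe_filter, Finset.mem_univ, true_and, Set.mem_ofPred_eq]
      exact hH.1

open Classical in
theorem AugChow.sum_ofContract (F : PFlat M) {i : α} (hi : i ∈ M.E) (hiF : i ∉ F.1) :
    (∑ G : NPFlat (M ／ F.1) with i ∈ G.1, AugChow.x M (F.ofContract G)) * AugChow.x M F =
      AugChow.alpha M * AugChow.x M F := by
  have hsplit : AugChow.alpha M =
      ∑ G : PFlat M with i ∈ G.1, AugChow.x M G + AugChow.y M ⟨i, hi⟩ := by
    rw [AugChow.y_eq, AugChow.alpha]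
    exact (Finset.sum_filter_add_sum_filter_not _ _ _).symm
  rw [hsplit, add_mul, AugChow.y_mul_x (i := ⟨i, hi⟩) hiF, add_zero, Finset.sum_mul,
    Finset.sum_mul]
  refine Finset.sum_of_injOn F.ofContract ?_ ?_ ?_ fun _ _ => rfl
  · intro G _ G' _ h
    have h' : G.1 ∪ F.1 = G'.1 ∪ F.1 := congrArg Subtype.val h
    refine Subtype.ext ?_
    rw [← (disjoint_of_isFlat_contract G.2.1).sdiff_eq_left,
      ← (disjoint_of_isFlat_contract G'.2.1).sdiff_eq_left, ← Set.union_sdiff_right, h',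
      Set.union_sdiff_right]
  · intro G hG
    simp only [Finset.coe_filter, Finset.mem_univ, true_and, Set.mem_ofPred_eq] at hG ⊢
    exact Or.inl hG
  · intro H hH hH'
    simp only [Finset.mem_filter, Finset.mem_univ, true_and] at hH
    refine AugChow.x_mul_x (fun h => hiF (h hH)) fun h => hH' ?_
    refine ⟨⟨H.1 \ F.1, isFlat_contract_of_subset H.2.1 h, ⟨i, hH, hiF⟩, fun he => H.2.2 ?_⟩,
      ?_, Subtype.ext (Set.sdiff_union_of_subset h)⟩
    · rw [← Set.sdiff_union_of_subset h, he, Matroid.contract_ground,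
        Set.sdiff_union_of_subset F.2.1.subset_ground]
    · simp only [Finset.coe_filter, Finset.mem_univ, true_and, Set.mem_ofPred_eq]
      exact ⟨hH, hiF⟩

open Classical in
theorem AugChow.sum_ofRestrict (F : PFlat M) {i : α} (hi : i ∈ M.E) (hiF : i ∈ F.1) :
    (∑ G : PFlat (M ↾ F.1) with i ∉ G.1, AugChow.x M (F.ofRestrict G)) * AugChow.x M F =
      AugChow.y M ⟨i, hi⟩ * AugChow.x M F := by
  rw [AugChow.y_eq, Finset.sum_mul, Finset.sum_mul]
  refine Finset.sum_of_injOn F.ofRestrict ?_ ?_ ?_ fun _ _ => rfl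
  · intro G _ G' _ h
    have h' : G.1 = G'.1 := congrArg (fun K : PFlat M => K.1) h
    exact Subtype.ext h'
  · intro G hG
    simp only [Finset.coe_filter, Finset.mem_univ, true_and, Set.mem_ofPred_eq] at hG ⊢
    exact hG
  · intro H hH hH'
    simp only [Finset.mem_filter, Finset.mem_univ, true_and] at hH
    refine AugChow.x_mul_x (fun h => hH' ?_) fun h => hH (h hiF)
    refine ⟨⟨H.1, isFlat_restrict_of_subset F.2.1 H.2.1 h, fun he => hH ?_⟩, ?_, rfl⟩
    · rw [he]
      exact hiF
    · simp only [Finset.coe_filter, Finset.mem_univ, true_and, Set.mem_ofPred_eq]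
      exact hH

/-! ### The pushforward maps -/

/-- Multiplication by `x`, on the quotient of a ring by the annihilator of `x`. -/
noncomputable def mulQuot {A : Type*} [CommRing A] [Algebra ℚ A] (x : A) :
    (A ⧸ Ideal.torsionOf A A x) →ₗ[ℚ] A :=
  ((Ideal.torsionOf A A x).liftQ (LinearMap.toSpanSingleton A A x) le_rfl).restrictScalars ℚ

theorem mk_torsionOf_eq_zero {A : Type*} [CommRing A] {x a : A} (h : a * x = 0) :
    Ideal.Quotient.mk (Ideal.torsionOf A A x) a = 0 := by
  rw [Ideal.Quotient.eq_zero_iff_mem, Ideal.mem_torsionOf_iff]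
  exact h

/-- The algebra homomorphism `x_G ↦ x_{G ∪ F}` to the quotient by the annihilator of `x_F`. -/
noncomputable def Chow.contractHom (F : NPFlat M) :
    Chow (M ／ F.1) →ₐ[ℚ] Chow M ⧸ Ideal.torsionOf (Chow M) (Chow M) (Chow.x M F) :=
  Ideal.Quotient.liftₐ (chowIdeal (M ／ F.1))
    (MvPolynomial.aeval fun G => Ideal.Quotient.mk _ (Chow.x M (F.ofContract G))) <| by
    classical
    intro a ha
    rw [← RingHom.mem_ker]
    revert a
    change chowIdeal _ ≤ _
    refine sup_le (Ideal.span_le.2 ?_) (Ideal.span_le.2 ?_)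
    · rintro _ ⟨i, hi, j, hj, -, rfl⟩
      rw [SetLike.mem_coe, RingHom.mem_ker, map_sub, linForm, linForm, map_sum, map_sum]
      simp only [MvPolynomial.aeval_X]
      rw [← map_sum, ← map_sum, ← map_sub]
      refine mk_torsionOf_eq_zero ?_
      rw [sub_mul, Chow.sum_ofContract F hi.1 hi.2, Chow.sum_ofContract F hj.1 hj.2, sub_self]
    · rintro _ ⟨G, H, hGH, hHG, rfl⟩
      rw [SetLike.mem_coe, RingHom.mem_ker, map_mul, MvPolynomial.aeval_X, MvPolynomial.aeval_X,
        ← map_mul, Chow.x_mul_x, map_zero]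
      · exact fun h => hGH fun a ha => (h (Or.inl ha)).resolve_right
          (Set.disjoint_left.1 (disjoint_of_isFlat_contract G.2.1) ha)
      · exact fun h => hHG fun a ha => (h (Or.inl ha)).resolve_right
          (Set.disjoint_left.1 (disjoint_of_isFlat_contract H.2.1) ha)

/-- The algebra homomorphism `x_G ↦ x_G` to the quotient by the annihilator of `x_F`. -/
noncomputable def Chow.restrictHom (F : NPFlat M) :
    Chow (M ↾ F.1) →ₐ[ℚ] Chow M ⧸ Ideal.torsionOf (Chow M) (Chow M) (Chow.x M F) :=
  Ideal.Quotient.liftₐ (chowIdeal (M ↾ F.1))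
    (MvPolynomial.aeval fun G => Ideal.Quotient.mk _ (Chow.x M (F.ofRestrict G))) <| by
    classical
    intro a ha
    rw [← RingHom.mem_ker]
    revert a
    change chowIdeal _ ≤ _
    refine sup_le (Ideal.span_le.2 ?_) (Ideal.span_le.2 ?_)
    · rintro _ ⟨i, hi, j, hj, -, rfl⟩
      rw [SetLike.mem_coe, RingHom.mem_ker, map_sub, linForm, linForm, map_sum, map_sum]
      simp only [MvPolynomial.aeval_X]
      rw [← map_sum, ← map_sum, ← map_sub]
      refine mk_torsionOf_eq_zero ?_
      rw [sub_mul, Chow.sum_ofRestrict F hi, Chow.sum_ofRestrict F hj, sub_self]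
    · rintro _ ⟨G, H, hGH, hHG, rfl⟩
      rw [SetLike.mem_coe, RingHom.mem_ker, map_mul, MvPolynomial.aeval_X, MvPolynomial.aeval_X,
        ← map_mul, Chow.x_mul_x (F := F.ofRestrict G) (G := F.ofRestrict H) hGH hHG, map_zero]

/-- The algebra homomorphism `x_G ↦ x_{G ∪ F}` to the quotient by the annihilator of `x_F`. -/
noncomputable def AugChow.contractHom (F : PFlat M) :
    Chow (M ／ F.1) →ₐ[ℚ] AugChow M ⧸ Ideal.torsionOf (AugChow M) (AugChow M) (AugChow.x M F) :=
  Ideal.Quotient.liftₐ (chowIdeal (M ／ F.1))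
    (MvPolynomial.aeval fun G => Ideal.Quotient.mk _ (AugChow.x M (F.ofContract G))) <| by
    classical
    intro a ha
    rw [← RingHom.mem_ker]
    revert a
    change chowIdeal _ ≤ _
    refine sup_le (Ideal.span_le.2 ?_) (Ideal.span_le.2 ?_)
    · rintro _ ⟨i, hi, j, hj, -, rfl⟩
      rw [SetLike.mem_coe, RingHom.mem_ker, map_sub, linForm, linForm, map_sum, map_sum]
      simp only [MvPolynomial.aeval_X]
      rw [← map_sum, ← map_sum, ← map_sub]
      refine mk_torsionOf_eq_zero ?_
      rw [sub_mul, AugChow.sum_ofContract F hi.1 hi.2, AugChow.sum_ofContract F hj.1 hj.2,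
        sub_self]
    · rintro _ ⟨G, H, hGH, hHG, rfl⟩
      rw [SetLike.mem_coe, RingHom.mem_ker, map_mul, MvPolynomial.aeval_X, MvPolynomial.aeval_X,
        ← map_mul, AugChow.x_mul_x, map_zero]
      · exact fun h => hGH fun a ha => (h (Or.inl ha)).resolve_right
          (Set.disjoint_left.1 (disjoint_of_isFlat_contract G.2.1) ha)
      · exact fun h => hHG fun a ha => (h (Or.inl ha)).resolve_right
          (Set.disjoint_left.1 (disjoint_of_isFlat_contract H.2.1) ha)

/-- The algebra homomorphism `x_G ↦ x_G`, `y_i ↦ y_i` to the quotient by the annihilator of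
`x_F`. -/
noncomputable def AugChow.restrictHom (F : PFlat M) :
    AugChow (M ↾ F.1) →ₐ[ℚ] AugChow M ⧸ Ideal.torsionOf (AugChow M) (AugChow M) (AugChow.x M F) :=
  Ideal.Quotient.liftₐ (augIdeal (M ↾ F.1))
    (MvPolynomial.aeval (Sum.elim
      (fun i => Ideal.Quotient.mk _ (AugChow.y M ⟨i.1, F.2.1.subset_ground i.2⟩))
      (fun G => Ideal.Quotient.mk _ (AugChow.x M (F.ofRestrict G))))) <| by
    classical
    intro a ha
    rw [← RingHom.mem_ker]
    revert a
    change augIdeal _ ≤ _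
    refine sup_le (Ideal.span_le.2 ?_) (Ideal.span_le.2 (Set.union_subset ?_ ?_))
    · rintro _ ⟨i, rfl⟩
      rw [SetLike.mem_coe, RingHom.mem_ker, map_sub, map_sum]
      simp only [yVar, xVar, MvPolynomial.aeval_X, Sum.elim_inl, Sum.elim_inr]
      rw [← map_sum, ← map_sub]
      refine mk_torsionOf_eq_zero ?_
      rw [sub_mul, AugChow.sum_ofRestrict F (F.2.1.subset_ground i.2) i.2, sub_self]
    · rintro _ ⟨G, H, hGH, hHG, rfl⟩
      simp only [SetLike.mem_coe, RingHom.mem_ker, map_mul, xVar, MvPolynomial.aeval_X,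
        Sum.elim_inr]
      rw [← map_mul, AugChow.x_mul_x (F := F.ofRestrict G) (G := F.ofRestrict H) hGH hHG,
        map_zero]
    · rintro _ ⟨i, G, hiG, rfl⟩
      simp only [SetLike.mem_coe, RingHom.mem_ker, map_mul, xVar, yVar, MvPolynomial.aeval_X,
        Sum.elim_inl, Sum.elim_inr]
      rw [← map_mul, AugChow.y_mul_x, map_zero]
      exact hiG

open scoped TensorProduct

/-- The pushforward `∏ x_{F'} ⊗ ∏ x_{F''} ↦ x_F ∏ x_{F' ∪ F} ∏ x_{F''}` (see `Chow.push_tmul`). -/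
noncomputable def Chow.push (F : NPFlat M) : Chow (M ／ F.1) ⊗[ℚ] Chow (M ↾ F.1) →ₗ[ℚ] Chow M :=
  mulQuot (Chow.x M F) ∘ₗ
    (Algebra.TensorProduct.productMap (Chow.contractHom F) (Chow.restrictHom F)).toLinearMap

/-- The pushforward `∏ x_{F'} ⊗ ∏ x_{F''} ↦ x_F ∏ x_{F' ∪ F} ∏ x_{F''}`
(see `AugChow.push_tmul`). -/
noncomputable def AugChow.push (F : PFlat M) :
    Chow (M ／ F.1) ⊗[ℚ] AugChow (M ↾ F.1) →ₗ[ℚ] AugChow M :=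
  mulQuot (AugChow.x M F) ∘ₗ
    (Algebra.TensorProduct.productMap (AugChow.contractHom F) (AugChow.restrictHom F)).toLinearMap

theorem Chow.push_tmul (F : NPFlat M) (S : Finset (NPFlat (M ／ F.1)))
    (T : Finset (NPFlat (M ↾ F.1))) :
    Chow.push F ((∏ G ∈ S, Chow.x _ G) ⊗ₜ (∏ G ∈ T, Chow.x _ G)) =
      Chow.x M F * (∏ G ∈ S, Chow.x M (F.ofContract G)) * ∏ G ∈ T, Chow.x M (F.ofRestrict G) := by
  have h₁ (G) : Chow.contractHom F (Chow.x _ G) = Ideal.Quotient.mk _ (Chow.x M (F.ofContract G)) :=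
    MvPolynomial.aeval_X _ _
  have h₂ (G) : Chow.restrictHom F (Chow.x _ G) = Ideal.Quotient.mk _ (Chow.x M (F.ofRestrict G)) :=
    MvPolynomial.aeval_X _ _
  simp only [Chow.push, LinearMap.comp_apply, AlgHom.toLinearMap_apply,
    Algebra.TensorProduct.productMap_apply_tmul, map_prod, h₁, h₂]
  rw [← map_prod, ← map_prod, ← map_mul]
  refine Eq.trans (b := (_ * _) * Chow.x M F) rfl ?_
  ring

theorem AugChow.push_tmul (F : PFlat M) (S : Finset (NPFlat (M ／ F.1)))
    (T : Finset (PFlat (M ↾ F.1))) :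
    AugChow.push F ((∏ G ∈ S, Chow.x _ G) ⊗ₜ (∏ G ∈ T, AugChow.x _ G)) =
      AugChow.x M F * (∏ G ∈ S, AugChow.x M (F.ofContract G)) *
        ∏ G ∈ T, AugChow.x M (F.ofRestrict G) := by
  have h₁ (G) : AugChow.contractHom F (Chow.x _ G) =
      Ideal.Quotient.mk _ (AugChow.x M (F.ofContract G)) := MvPolynomial.aeval_X _ _
  have h₂ (G) : AugChow.restrictHom F (AugChow.x _ G) =
      Ideal.Quotient.mk _ (AugChow.x M (F.ofRestrict G)) := MvPolynomial.aeval_X _ _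
  simp only [AugChow.push, LinearMap.comp_apply, AlgHom.toLinearMap_apply,
    Algebra.TensorProduct.productMap_apply_tmul, map_prod, h₁, h₂]
  rw [← map_prod, ← map_prod, ← map_mul]
  refine Eq.trans (b := (_ * _) * AugChow.x M F) rfl ?_
  ring

/-! ### The summands -/

variable (M)

/-- The proper flats of rank at least two (they are automatically nonempty). -/
abbrev Chow.Index : Type _ := {F : NPFlat M // 2 ≤ M.eRk F.1}

variable {M} in
/-- The image of `Chow (M ／ F) ⊗ J (M ↾ F)` under the pushforward. -/
noncomputable def Chow.part (F : NPFlat M) : Submodule ℚ (Chow M) :=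
  LinearMap.range (Chow.push F ∘ₗ LinearMap.lTensor (Chow (M ／ F.1)) (Chow.J (M ↾ F.1)).subtype)

variable {M} in
/-- The image of `Chow (M ／ F) ⊗ J (M ↾ F)` under the pushforward, for the augmented Chow ring. -/
noncomputable def AugChow.part (F : PFlat M) : Submodule ℚ (AugChow M) :=
  LinearMap.range
    (AugChow.push F ∘ₗ LinearMap.lTensor (Chow (M ／ F.1)) (AugChow.J (M ↾ F.1)).subtype)

/-- The summands of the Chow ring: the subalgebra generated by `α` (at `none`), and the
images of the pushforwards. -/
noncomputable def Chow.summand : Option (Chow.Index M) → Submodule ℚ (Chow M)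
  | none => Subalgebra.toSubmodule (Chow.H M)
  | some F => Chow.part F.1

/-- The summands of the augmented Chow ring: the subalgebra generated by `α` (at `none`), and the
images of the pushforwards, over the nonempty proper flats. -/
noncomputable def AugChow.summand : Option (NPFlat M) → Submodule ℚ (AugChow M)
  | none => Subalgebra.toSubmodule (AugChow.H M)
  | some F => AugChow.part F.toPFlat

end Rings

open Classical in
/-- `A` is the internal direct sum of the subspaces `S i`, each of which is an `H`-submodule, and
distinct ones are orthogonal for the pairing `(a, b) ↦ deg (a * b)`. -/
structure IsOrthogonalDecomposition {A : Type*} [CommRing A] [Algebra ℚ A] (H : Subalgebra ℚ A)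
    (deg : A →ₗ[ℚ] ℚ) {ι : Type*} (S : ι → Submodule ℚ A) : Prop where
  mul_mem : ∀ i, ∀ h ∈ H, ∀ s ∈ S i, h * s ∈ S i
  isInternal : DirectSum.IsInternal S
  orthogonal : ∀ i j, i ≠ j → ∀ a ∈ S i, ∀ b ∈ S j, deg (a * b) = 0

end MatroidChow

namespace MatroidChow

open scoped Matroid TensorProduct

/-! ### Linear functionals on polynomial rings -/

/-! For a flat F, let B be the Chow ring of M ／ F and C the ring (ordinary or augmented) of M ↾ F.
Besides the pushforward from B ⊗ C there is a surjective algebra map res F in the other direction,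
and push F (res F a) = x_F a. It sends α to α ⊗ 1 and γ_F = α - ∑_{G ≥ F} x_G to 1 ⊗ α. Both parts
of the theorem follow from such maps, so they are treated together through the axioms collected in
`IsRestrictionSystem` and `IsPushforwardSystem`.

The degree map is built by induction on the rank from the rule deg (x_F a) = (deg ⊗ deg) (res F a).
The rules for F and G must agree on x_F x_G a (`tensorDeg_res_comm`). The relations rewrite every
monomial in terms of squarefree monomials of chains, and on these both rules merely test whether the
chain is complete.

Surjectivity of res F gives the projection formula push F t * a = push F (t * res F a). By induction
the pairings on B and C are nondegenerate, hence so is the one on B ⊗ C. So push F is injective and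
no nonzero element of its image lies in the radical of deg (`eq_zero_of_push`).

Orthogonality: α and the x_K with K > F restrict into B ⊗ 1, so they preserve push F (B ⊗ J), on
which deg vanishes because J has no top-degree piece. The summand of a larger flat G consists of
polynomials in α and the x_K with K ≥ G, so it is orthogonal to that of F. For incomparable flats
x_F x_G = 0.

Spanning (`mem_of_reduction`): by descending induction on the smallest variable of a monomial, x_F
is traded for γ_F. The products x_F γ_F ^ k * a with small k lie in the summand of F, and the others
are handled by γ_F ^ e = 0, where e is the rank of F, plus one in the augmented case. This power
vanishes because a flat that contains a basis of F contains F (`pow_card_mul_mem_span`).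

Finally, orthogonal subspaces that span, each meeting the radical of deg trivially, are independent
and make deg nondegenerate. This yields the decomposition and also the nondegeneracy that the next
rank needs. -/

/-- Compatible functionals `D v` glue to a functional whose value at `X v * p` is `D v p`. -/
theorem exists_functional_of_compatible {σ : Type*} (D : σ → MvPolynomial σ ℚ →ₗ[ℚ] ℚ) (c : ℚ)
    (h : ∀ v w p, D v (MvPolynomial.X w * p) = D w (MvPolynomial.X v * p)) :
    ∃ E : MvPolynomial σ ℚ →ₗ[ℚ] ℚ, E 1 = c ∧ ∀ v p, E (MvPolynomial.X v * p) = D v p := by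
  classical
  -- The value at a monomial other than `1` is computed by splitting off an arbitrarily chosen
  -- variable of its support. Compatibility makes the choice irrelevant.
  let φ : (σ →₀ ℕ) → ℚ := fun m => if hm : m.support.Nonempty then
    D hm.choose (MvPolynomial.monomial (m - Finsupp.single hm.choose 1) 1) else c
  let E : MvPolynomial σ ℚ →ₗ[ℚ] ℚ := (MvPolynomial.basisMonomials σ ℚ).constr ℚ φ
  have hE (m : σ →₀ ℕ) : E (MvPolynomial.monomial m 1) = φ m := by
    have := (MvPolynomial.basisMonomials σ ℚ).constr_basis ℚ φ m
    rwa [MvPolynomial.coe_basisMonomials] at this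
  have hX (v : σ) (m : σ →₀ ℕ) : MvPolynomial.X v * MvPolynomial.monomial m (1 : ℚ) =
      MvPolynomial.monomial (Finsupp.single v 1 + m) 1 := by
    rw [MvPolynomial.X, MvPolynomial.monomial_mul, one_mul]
  refine ⟨E, ?_, fun v p => ?_⟩
  · rw [MvPolynomial.one_def, hE]
    simp [φ]
  · suffices hs : E ∘ₗ LinearMap.mulLeft ℚ (MvPolynomial.X v) = D v from LinearMap.congr_fun hs p
    refine (MvPolynomial.basisMonomials σ ℚ).ext fun m => ?_
    rw [MvPolynomial.coe_basisMonomials, LinearMap.comp_apply, LinearMap.mulLeft_apply, hX, hE]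
    have hm : (Finsupp.single v 1 + m).support.Nonempty := ⟨v, by simp⟩
    simp only [φ, dif_pos hm]
    generalize hw : hm.choose = w
    have hws : w ∈ (Finsupp.single v 1 + m).support := hw ▸ hm.choose_spec
    by_cases hvw : w = v
    · rw [hvw, add_tsub_cancel_left]
    · have hwm : Finsupp.single w 1 ≤ m := by
        rw [Finsupp.single_le_iff]
        have := Finsupp.mem_support_iff.1 hws
        rw [Finsupp.add_apply, Finsupp.single_apply, if_neg (fun h => hvw h.symm), zero_add] at this
        omega
      obtain ⟨m', rfl⟩ := exists_add_of_le hwm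
      -- Both variables divide the monomial, and the hypothesis exchanges the one split off by
      -- choice for `v`.
      rw [add_left_comm, add_tsub_cancel_left, ← hX, ← hX, h]

/-- A subspace that contains `1` and is stable under multiplication by the elements of `s` contains
the subalgebra generated by `s`. -/
theorem adjoin_le_of_mul_mem {A : Type*} [CommRing A] [Algebra ℚ A] {s : Set A}
    {V : Submodule ℚ A} (h1 : 1 ∈ V) (h : ∀ a ∈ s, ∀ v ∈ V, a * v ∈ V) :
    ∀ a ∈ Algebra.adjoin ℚ s, a ∈ V := by
  intro a ha
  -- Stability of all of `V` is what survives products in the induction.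
  suffices hs : ∀ v ∈ V, a * v ∈ V by simpa using hs 1 h1
  induction ha using Algebra.adjoin_induction with
  | mem a ha => exact h a ha
  | algebraMap r => exact fun v hv => by rw [← Algebra.smul_def]; exact V.smul_mem r hv
  | add a b _ _ iha ihb => exact fun v hv => by rw [add_mul]; exact V.add_mem (iha v hv) (ihb v hv)
  | mul a b _ _ iha ihb => exact fun v hv => by rw [mul_assoc]; exact iha _ (ihb v hv)

/-! ### Squarefree monomials of chains -/

section Chains

variable {P : Type*} [PartialOrder P] [Fintype P] [DecidableEq P] {A : Type*} [CommRing A] [Algebra ℚ A]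

/-- The subspace spanned by the ideal `N` and the squarefree monomials of the chains with `k`
members that are disjoint from `S₀` and form a chain with it. -/
noncomputable def chainSpan (x : P → A) (S₀ : Finset P) (N : Ideal A) (k : ℕ) : Submodule ℚ A :=
  N.restrictScalars ℚ ⊔ Submodule.span ℚ {a | ∃ S : Finset P, S.card = k ∧ Disjoint S S₀ ∧
    IsChain (· ≤ ·) ((S ∪ S₀ : Finset P) : Set P) ∧ a = ∏ F ∈ S, x F}

/-- The condition under which every monomial can be rewritten in terms of squarefree ones. -/
def HasChainRelations (x : P → A) (S₀ : Finset P) (N : Ideal A) : Prop :=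
  ∀ S : Finset P, Disjoint S S₀ → IsChain (· ≤ ·) ((S ∪ S₀ : Finset P) : Set P) →
    ∀ H ∈ S ∪ S₀, ∃ c : P → ℚ, c H = 1 ∧ (∀ K ∈ S ∪ S₀, K ≠ H → c K ≠ 0 → K < H) ∧
      (∑ K, c K • x K) * ∏ F ∈ S, x F ∈ N

variable {x : P → A} {S₀ : Finset P} {N : Ideal A}

/-- Induction on `H`. A variable outside the chain either extends it or is killed by an incomparable
member. If `H` already occurs, a relation replaces `x H` by variables that are outside the chain or
smaller members of it. The set `S₀` stands for variables by which the result will be multiplied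
later, and `N` for what such a multiplication kills. -/
theorem mul_prod_mem_chainSpan (hinc : ∀ F G, ¬ F ≤ G → ¬ G ≤ F → x F * x G = 0)
    (hN : ∀ H, ∀ K ∈ S₀, ¬ H ≤ K → ¬ K ≤ H → x H ∈ N) (hrel : HasChainRelations x S₀ N)
    {S : Finset P} (hd : Disjoint S S₀) (hS : IsChain (· ≤ ·) ((S ∪ S₀ : Finset P) : Set P))
    (H : P) : x H * ∏ F ∈ S, x F ∈ chainSpan x S₀ N (S.card + 1) := by
  have hnew (H : P) (hH : H ∉ S ∪ S₀) : x H * ∏ F ∈ S, x F ∈ chainSpan x S₀ N (S.card + 1) := by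
    by_cases hc : ∀ K ∈ S ∪ S₀, H ≤ K ∨ K ≤ H
    · have hHS : H ∉ S := fun h => hH (Finset.mem_union_left _ h)
      refine Submodule.mem_sup_right (Submodule.subset_span ⟨insert H S, ?_, ?_, ?_, ?_⟩)
      · exact Finset.card_insert_of_notMem hHS
      · exact Finset.disjoint_insert_left.2 ⟨fun h => hH (Finset.mem_union_right _ h), hd⟩
      · rw [Finset.insert_union, Finset.coe_insert]
        exact hS.insert fun K hK _ => hc K hK
      · rw [Finset.prod_insert hHS]
    · push Not at hc
      obtain ⟨K, hK, h1, h2⟩ := hc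
      rcases Finset.mem_union.1 hK with hK | hK
      · rw [← Finset.mul_prod_erase _ _ hK, ← mul_assoc, hinc H K h1 h2, zero_mul]
        exact Submodule.zero_mem _
      · exact Submodule.mem_sup_left (N.mul_mem_right _ (hN H K hK h1 h2))
  induction H using WellFoundedLT.induction with
  | ind H ih =>
    by_cases hH : H ∈ S ∪ S₀
    · obtain ⟨c, hcH, hc, hz⟩ := hrel S hd hS H hH
      have hz' : (∑ K, c K • x K) * ∏ F ∈ S, x F ∈ chainSpan x S₀ N (S.card + 1) :=
        Submodule.mem_sup_left hz
      have hsum : (∑ K, c K • x K) = x H + ∑ K ∈ Finset.univ.erase H, c K • x K := by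
        rw [← Finset.add_sum_erase _ _ (Finset.mem_univ H), hcH, one_smul]
      rw [hsum, add_mul] at hz'
      -- The relation puts the whole sum in `N`, so `x H` may be replaced by minus the remaining
      -- terms.
      refine (Submodule.add_mem_iff_left _ ?_).1 hz'
      rw [Finset.sum_mul]
      refine Submodule.sum_mem _ fun K hK => ?_
      rw [smul_mul_assoc]
      by_cases hcK : c K = 0
      · rw [hcK, zero_smul]
        exact Submodule.zero_mem _
      · refine Submodule.smul_mem _ _ ?_
        by_cases hKS : K ∈ S ∪ S₀
        · exact ih K (hc K hKS (Finset.ne_of_mem_erase hK) hcK)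
        · exact hnew K hKS
    · exact hnew H hH

/-- A homogeneous polynomial in linear combinations of the `x F` is a combination of squarefree
monomials of chains. -/
theorem aeval_mem_chainSpan (hinc : ∀ F G, ¬ F ≤ G → ¬ G ≤ F → x F * x G = 0)
    (hN : ∀ H, ∀ K ∈ S₀, ¬ H ≤ K → ¬ K ≤ H → x H ∈ N) (hrel : HasChainRelations x S₀ N)
    (hS₀ : IsChain (· ≤ ·) (S₀ : Set P)) {σ : Type*} {v : σ → A}
    (hv : ∀ s, v s ∈ Submodule.span ℚ (Set.range x)) {k : ℕ} {p : MvPolynomial σ ℚ}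
    (hp : p ∈ MvPolynomial.homogeneousSubmodule σ ℚ k) :
    MvPolynomial.aeval v p ∈ chainSpan x S₀ N k := by
  have hstep (k : ℕ) (a : A) (ha : a ∈ chainSpan x S₀ N k) (s : σ) :
      v s * a ∈ chainSpan x S₀ N (k + 1) := by
    have hvs := hv s
    generalize v s = b at hvs
    induction hvs using Submodule.span_induction with
    | mem y hy =>
      obtain ⟨H, rfl⟩ := hy
      obtain ⟨n, hn, b, hb, rfl⟩ := Submodule.mem_sup.1 ha
      rw [mul_add]
      refine Submodule.add_mem _ (Submodule.mem_sup_left (N.mul_mem_left _ hn)) ?_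
      clear ha
      induction hb using Submodule.span_induction with
      | mem b hb =>
        obtain ⟨S, rfl, hd, hS, rfl⟩ := hb
        exact mul_prod_mem_chainSpan hinc hN hrel hd hS H
      | zero => rw [mul_zero]; exact Submodule.zero_mem _
      | add b b' _ _ h h' => rw [mul_add]; exact Submodule.add_mem _ h h'
      | smul r b _ h => rw [mul_smul_comm]; exact Submodule.smul_mem _ _ h
    | zero => rw [zero_mul]; exact Submodule.zero_mem _
    | add b b' _ _ h h' => rw [add_mul]; exact Submodule.add_mem _ h h'
    | smul r b _ h => rw [smul_mul_assoc]; exact Submodule.smul_mem _ _ h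
  have hmon (d : ℕ) : ∀ m : σ →₀ ℕ, m.degree = d →
      (m.prod fun s n => v s ^ n) ∈ chainSpan x S₀ N d := by
    induction d with
    | zero =>
      intro m hm
      rw [Finsupp.degree_eq_zero_iff] at hm
      refine Submodule.mem_sup_right (Submodule.subset_span ⟨∅, ?_, ?_, ?_, ?_⟩)
      · simp
      · simp
      · simpa using hS₀
      · simp [hm]
    | succ d ih =>
      intro m hm
      obtain ⟨s, hs⟩ : ∃ s, m s ≠ 0 := by
        by_contra! h
        rw [show m = 0 from Finsupp.ext h, map_zero] at hm
        omega
      obtain ⟨m, rfl⟩ := exists_add_of_le (Finsupp.single_le_iff.2 (Nat.one_le_iff_ne_zero.2 hs))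
      rw [map_add, Finsupp.degree_single] at hm
      rw [Finsupp.prod_add_index' (h := fun s n => v s ^ n) (fun _ => pow_zero _) (fun _ _ _ => pow_add _ _ _),
        Finsupp.prod_single_index (h := fun s n => v s ^ n) (pow_zero _), pow_one]
      exact hstep _ _ (ih m (by omega)) s
  rw [MvPolynomial.aeval_def, MvPolynomial.eval₂_eq]
  refine Submodule.sum_mem _ fun m hm => ?_
  rw [← Algebra.smul_def]
  refine Submodule.smul_mem _ _ ?_
  have hdeg : m.degree = k := by
    rw [← hp (MvPolynomial.mem_support_iff.1 hm), Finsupp.degree_eq_weight_one]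
    rfl
  exact hmon k m hdeg

end Chains

/-! ### Tensor products of pairings -/

section Tensor

/-- The functional `b ⊗ c ↦ f b * g c`. -/
noncomputable def tensorDeg {B C : Type*} [CommRing B] [Algebra ℚ B] [CommRing C] [Algebra ℚ C]
    (f : B →ₗ[ℚ] ℚ) (g : C →ₗ[ℚ] ℚ) : B ⊗[ℚ] C →ₗ[ℚ] ℚ :=
  LinearMap.mul' ℚ ℚ ∘ₗ TensorProduct.map f g

variable {B C : Type*} [CommRing B] [Algebra ℚ B] [CommRing C] [Algebra ℚ C]
  {f : B →ₗ[ℚ] ℚ} {g : C →ₗ[ℚ] ℚ}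

@[simp]
theorem tensorDeg_tmul (b : B) (c : C) : tensorDeg f g (b ⊗ₜ c) = f b * g c := rfl

/-- The pairing `(a, b) ↦ f (a * b)` has trivial radical. -/
def IsNondegenerate (f : B →ₗ[ℚ] ℚ) : Prop := ∀ a, (∀ b, f (a * b) = 0) → a = 0

/-- Write the tensor as a sum of b_i ⊗ β_i over a basis β of `C`. For fixed `u`, the element with
coordinates f (b_i u) pairs to zero with all of `C`, so f (b_i u) = 0 for every `u` and each b_i
vanishes. No finiteness of dimension is used. -/
theorem IsNondegenerate.tensorDeg (hf : IsNondegenerate f) (hg : IsNondegenerate g) :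
    IsNondegenerate (tensorDeg f g) := by
  classical
  intro t ht
  let β := Module.Basis.ofVectorSpace ℚ C
  obtain ⟨b, rfl⟩ := (TensorProduct.equivFinsuppOfBasisRight (M := B) β).symm.surjective t
  rw [TensorProduct.equivFinsuppOfBasisRight_symm_apply] at ht ⊢
  suffices hb : b = 0 by rw [hb, Finsupp.sum_zero_index]
  ext i
  refine hf _ fun u => ?_
  have hw : b.sum (fun i b' => f (b' * u) • β i) = 0 := by
    refine hg _ fun v => ?_
    have := ht (u ⊗ₜ v)
    rw [Finsupp.sum, Finset.sum_mul, map_sum] at this ⊢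
    rw [← this]
    refine Finset.sum_congr rfl fun j _ => ?_
    rw [Algebra.TensorProduct.tmul_mul_tmul, tensorDeg_tmul, smul_mul_assoc, map_smul, smul_eq_mul]
  have hi := congrArg (fun w => β.repr w i) hw
  simp only [Finsupp.sum, map_sum, map_smul, Module.Basis.repr_self, map_zero, Finsupp.coe_zero,
    Pi.zero_apply, Finsupp.coe_finsetSum, Finset.sum_apply, Finsupp.smul_apply,
    Finsupp.single_apply, smul_eq_mul, mul_ite, mul_one, mul_zero] at hi
  rw [Finset.sum_ite_eq'] at hi
  split_ifs at hi with h
  · exact hi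
  · rw [Finsupp.notMem_support_iff.1 h, zero_mul, map_zero]

end Tensor

/-! ### Spanning: rewriting monomials through the classes γ. -/

section Reduction

variable {P : Type*} [PartialOrder P] {A : Type*} [CommRing A] [Algebra ℚ A]
  {x : P → A}

/-- Every element of a subalgebra generated by variables `x K` is a scalar plus a combination of
monomials with a distinguished minimal variable. -/
theorem adjoin_image_le_span (hinc : ∀ F G, ¬ F ≤ G → ¬ G ≤ F → x F * x G = 0) (U : Set P) :
    ∀ a ∈ Algebra.adjoin ℚ (x '' U), a ∈ Submodule.span ℚ ({1} ∪ {a | ∃ K ∈ U, ∃ m : ℕ, 1 ≤ m ∧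
      ∃ b ∈ Algebra.adjoin ℚ (x '' Set.Ioi K), a = x K ^ m * b}) := by
  refine adjoin_le_of_mul_mem (Submodule.subset_span (Or.inl rfl)) ?_
  rintro _ ⟨H, hH, rfl⟩ v hv
  induction hv using Submodule.span_induction with
  | zero => rw [mul_zero]; exact Submodule.zero_mem _
  | add b b' _ _ h h' => rw [mul_add]; exact Submodule.add_mem _ h h'
  | smul r b _ h => rw [mul_smul_comm]; exact Submodule.smul_mem _ _ h
  | mem v hv =>
    rcases hv with rfl | ⟨K, hK, m, hm, b, hb, rfl⟩
    · exact Submodule.subset_span (Or.inr ⟨H, hH, 1, le_rfl, 1, one_mem _, by ring⟩)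
    · by_cases hHK : H = K
      · subst hHK
        exact Submodule.subset_span (Or.inr ⟨H, hH, m + 1, by omega, b, hb, by ring⟩)
      by_cases h1 : H ≤ K
      · refine Submodule.subset_span (Or.inr ⟨H, hH, 1, le_rfl, x K ^ m * b, ?_, by ring⟩)
        have hlt : H < K := lt_of_le_of_ne h1 hHK
        refine mul_mem (pow_mem (Algebra.subset_adjoin (Set.mem_image_of_mem x hlt)) m) ?_
        exact Algebra.adjoin_mono (Set.image_mono (Set.Ioi_subset_Ioi h1)) hb
      by_cases h2 : K ≤ H
      · refine Submodule.subset_span (Or.inr ⟨K, hK, m, hm, x H * b, ?_, by ring⟩)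
        exact mul_mem (Algebra.subset_adjoin
          (Set.mem_image_of_mem x (lt_of_le_of_ne h2 (Ne.symm hHK)))) hb
      · obtain ⟨m, rfl⟩ := Nat.exists_eq_add_of_le' hm
        rw [show x H * (x K ^ (m + 1) * b) = x H * x K * (x K ^ m * b) by ring, hinc H K h1 h2,
          zero_mul]
        exact Submodule.zero_mem _

variable [Fintype P]

open Classical in
/-- Reduction of all monomials to the powers of `α` and the products `x F * γ F ^ k * a`, where
`γ F = α - ∑_{G ≥ F} x G` and `a` only involves the variables `x K` with `K > F`. -/
theorem mem_of_reduction (hinc : ∀ F G, ¬ F ≤ G → ¬ G ≤ F → x F * x G = 0)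
    {α : A} {e : P → ℕ} (hγ : ∀ F, (α - ∑ G with F ≤ G, x G) ^ e F = 0)
    (hα : ∀ F, ∃ t ∈ Algebra.adjoin ℚ (x '' Set.Ioi F), α * x F = t * x F)
    {W : Submodule ℚ A} (h1 : 1 ∈ W) (hαW : ∀ w ∈ W, α * w ∈ W)
    (hW : ∀ F k, k + 1 < e F → ∀ a ∈ Algebra.adjoin ℚ (x '' Set.Ioi F),
      x F * (α - ∑ G with F ≤ G, x G) ^ k * a ∈ W) :
    ∀ a ∈ Algebra.adjoin ℚ (Set.range x), a ∈ W := by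
  -- Descending induction on the smallest variable of a monomial.
  have key (F : P) : ∀ m : ℕ, 1 ≤ m → ∀ a ∈ Algebra.adjoin ℚ (x '' Set.Ioi F),
      x F ^ m * a ∈ W := by
    induction F using WellFoundedGT.induction with
    | ind F ih =>
      set R := Algebra.adjoin ℚ (x '' Set.Ioi F) with hR
      -- Elements of `R` involve only variables above `F`, so the induction hypothesis covers them.
      have hRW (b : A) (hb : b ∈ R) : b ∈ W := by
        refine Submodule.span_le.2 ?_ (adjoin_image_le_span hinc _ b hb)
        rintro _ (rfl | ⟨K, hK, m, hm, b, hb, rfl⟩)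
        · exact h1
        · exact ih K hK m hm b hb
      set s := ∑ G with F < G, x G with hs
      have hsR : s ∈ R := sum_mem fun G hG =>
        Algebra.subset_adjoin ⟨G, (Finset.mem_filter.1 hG).2, rfl⟩
      set γ := α - ∑ G with F ≤ G, x G with hγd
      have hγs : γ = α - s - x F := by
        have : (Finset.univ.filter fun G => F ≤ G) =
            insert F (Finset.univ.filter fun G => F < G) := by
          ext G
          simp [le_iff_eq_or_lt, eq_comm]
        rw [hγd, this, Finset.sum_insert (by simp)]
        ring
      obtain ⟨t, ht, hαt⟩ := hα F
      have hpow (n : ℕ) : ∀ b ∈ R, (α - s) ^ n * b ∈ W := by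
        induction n with
        | zero => simpa using hRW
        | succ n ihn =>
          intro b hb
          rw [show (α - s) ^ (n + 1) * b = α * ((α - s) ^ n * b) - (α - s) ^ n * (s * b) by ring]
          exact sub_mem (hαW _ (ihn b hb)) (ihn _ (mul_mem hsR hb))
      -- In the presence of a factor `x F`, the class `α` may be replaced by the element `t` of `R`.
      have htF (n : ℕ) : x F * (α - s) ^ n = x F * (t - s) ^ n := by
        induction n with
        | zero => simp
        | succ n ihn =>
          calc x F * (α - s) ^ (n + 1) = (x F * (α - s) ^ n) * (α - s) := by ring
            _ = (α * x F) * (t - s) ^ n - x F * (t - s) ^ n * s := by rw [ihn]; ring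
            _ = x F * (t - s) ^ (n + 1) := by rw [hαt]; ring
      -- One factor γ is expanded as (α - s) - x F. The term with `x F` has a smaller power of γ,
      -- low enough for `hW`, and the bound on `j` is exactly what this needs.
      have hγW (j : ℕ) (hj : j + 1 ≤ e F) : ∀ n, ∀ b ∈ R, γ ^ j * (α - s) ^ n * b ∈ W := by
        induction j with
        | zero => simpa using hpow
        | succ j ihj =>
          intro n b hb
          have e1 : γ ^ (j + 1) * (α - s) ^ n * b =
              γ ^ j * (α - s) ^ (n + 1) * b - x F * γ ^ j * ((t - s) ^ n * b) := by
            calc γ ^ (j + 1) * (α - s) ^ n * b = γ ^ j * γ * (α - s) ^ n * b := by ring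
              _ = γ ^ j * (α - s) ^ (n + 1) * b - (x F * (α - s) ^ n) * γ ^ j * b := by
                nth_rw 2 [hγs]; ring
              _ = _ := by rw [htF]; ring
          rw [e1]
          exact sub_mem (ihj (by omega) _ b hb)
            (hW F j (by omega) _ (mul_mem (pow_mem (sub_mem ht hsR) n) hb))
      have hxγ (k : ℕ) : ∀ b ∈ R, x F * γ ^ k * b ∈ W := by
        intro b hb
        rcases lt_trichotomy (k + 1) (e F) with h | h | h
        · exact hW F k h b hb
        -- The borderline power just misses `hW`: here x F = (α - s) - γ, and the last term
        -- contributes γ ^ e F = 0.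
        · have e1 : x F * γ ^ k * b = γ ^ k * (α - s) ^ 1 * b - γ ^ (k + 1) * b := by
            linear_combination γ ^ k * b * hγs
          rw [e1, h, hγ F, zero_mul, sub_zero]
          exact hγW k h.le 1 b hb
        · rw [pow_eq_zero_of_le (Nat.lt_succ_iff.1 h) (hγ F), mul_zero, zero_mul]
          exact zero_mem _
      -- Higher powers of `x F` reduce to the first by x F ^ 2 = x F (t - s) - x F γ.
      have hxF (n : ℕ) : ∀ k, ∀ b ∈ R, x F ^ (n + 1) * γ ^ k * b ∈ W := by
        induction n with
        | zero => simpa using hxγ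
        | succ n ihn =>
          intro k b hb
          have e1 : x F ^ (n + 1 + 1) * γ ^ k * b =
              x F ^ (n + 1) * γ ^ k * ((t - s) * b) - x F ^ (n + 1) * γ ^ (k + 1) * b := by
            calc x F ^ (n + 1 + 1) * γ ^ k * b
                = x F ^ n * γ ^ k * b * (x F * (α - s) ^ 1) - x F ^ (n + 1) * γ ^ k * γ * b := by
                  linear_combination x F ^ (n + 1) * γ ^ k * b * hγs
              _ = _ := by rw [htF]; ring
          rw [e1]
          exact sub_mem (ihn _ _ (mul_mem (sub_mem ht hsR) hb)) (ihn _ _ hb)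
      intro m hm b hb
      obtain ⟨m, rfl⟩ := Nat.exists_eq_add_of_le' hm
      simpa using hxF m 0 b hb
  intro a ha
  rw [← Set.image_univ] at ha
  refine Submodule.span_le.2 ?_ (adjoin_image_le_span hinc _ a ha)
  rintro _ (rfl | ⟨K, -, m, hm, b, hb, rfl⟩)
  · exact h1
  · exact key K m hm b hb

end Reduction

/-! ### Orthogonal families of subspaces -/

section Orthogonal

variable {A : Type*} [CommRing A] [Algebra ℚ A] {deg : A →ₗ[ℚ] ℚ} {ι : Type*}
  {S : ι → Submodule ℚ A}

/-- Each component of an element of the radical is again in the radical: it pairs with its own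
subspace as the whole element does, and with the other subspaces trivially. -/
theorem IsNondegenerate.of_orthogonal (hsup : ⨆ i, S i = ⊤)
    (horth : ∀ i j, i ≠ j → ∀ a ∈ S i, ∀ b ∈ S j, deg (a * b) = 0)
    (hrad : ∀ i, ∀ s ∈ S i, (∀ b, deg (s * b) = 0) → s = 0) : IsNondegenerate deg := by
  classical
  intro a ha
  obtain ⟨f, hf, rfl⟩ := (Submodule.mem_iSup_iff_exists_finsupp S a).1 (hsup ▸ Submodule.mem_top)
  refine Finset.sum_eq_zero fun i _ => hrad i _ (hf i) fun b => ?_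
  induction (hsup ▸ Submodule.mem_top : b ∈ ⨆ i, S i) using Submodule.iSup_induction' with
  | zero => rw [mul_zero, map_zero]
  | add b c _ _ hb hc => rw [mul_add, map_add, hb, hc, add_zero]
  | mem j b hb =>
    by_cases hij : i = j
    · subst hij
      have h := ha b
      rw [Finsupp.sum, Finset.sum_mul, map_sum, Finset.sum_eq_single i] at h
      · exact h
      · exact fun k _ hk => horth k i hk _ (hf k) _ hb
      · intro hi
        rw [Finsupp.notMem_support_iff.1 hi, zero_mul, map_zero]
    · exact horth i j hij _ (hf i) _ hb

/-- An element of `S i` that is also a sum of elements of the other subspaces is orthogonal to those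
subspaces for the first reason and to `S i` for the second, hence to everything. -/
theorem iSupIndep_of_orthogonal (hsup : ⨆ i, S i = ⊤)
    (horth : ∀ i j, i ≠ j → ∀ a ∈ S i, ∀ b ∈ S j, deg (a * b) = 0)
    (hrad : ∀ i, ∀ s ∈ S i, (∀ b, deg (s * b) = 0) → s = 0) : iSupIndep S := by
  refine fun i => Submodule.disjoint_def.2 fun s hs hs' => hrad i s hs fun b => ?_
  induction (hsup ▸ Submodule.mem_top : b ∈ ⨆ i, S i) using Submodule.iSup_induction' with
  | zero => rw [mul_zero, map_zero]
  | add b c _ _ hb hc => rw [mul_add, map_add, hb, hc, add_zero]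
  | mem j b hb =>
    by_cases hij : i = j
    · subst hij
      have : s ∈ LinearMap.ker (deg ∘ₗ LinearMap.mulRight ℚ b) := by
        refine iSup₂_le (a := LinearMap.ker (deg ∘ₗ LinearMap.mulRight ℚ b))
          (fun j hj c hc => ?_) hs'
        exact horth j i hj c hc b hb
      exact this
    · exact horth i j hij _ hs _ hb

/-- The functional `deg` detects the elements of the subalgebra generated by `α`. -/
theorem eq_zero_of_mem_adjoin {α : A} {n : ℕ} (hα : α ^ (n + 1) = 0)
    (hdeg : ∀ k, deg (α ^ k) = if k = n then 1 else 0) {s : A} (hs : s ∈ Algebra.adjoin ℚ {α})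
    (h : ∀ b, deg (s * b) = 0) : s = 0 := by
  rw [Algebra.adjoin_singleton_eq_range_aeval] at hs
  obtain ⟨p, rfl⟩ := hs
  change ∀ b, deg (Polynomial.aeval α p * b) = 0 at h
  change Polynomial.aeval α p = 0
  rw [Polynomial.aeval_eq_sum_range] at h ⊢
  refine Finset.sum_eq_zero fun i hi => ?_
  by_cases hin : i ≤ n
  -- Pairing with this power reads off the coefficient of `α ^ i`.
  · have := h (α ^ (n - i))
    rw [Finset.sum_mul, map_sum, Finset.sum_eq_single i] at this
    · rw [smul_mul_assoc, ← pow_add, map_smul, hdeg, if_pos (by omega), smul_eq_mul, mul_one] at this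
      rw [this, zero_smul]
    · intro j _ hj
      rw [smul_mul_assoc, ← pow_add, map_smul, hdeg, if_neg (by omega), smul_zero]
    · exact fun hi' => absurd hi hi'
  · rw [pow_eq_zero_of_le (by omega) hα, smul_zero]

end Orthogonal

/-! ### Decompositions from restriction and pushforward maps -/

section Decomposition

variable {P : Type*} [PartialOrder P] [Fintype P] {A : Type*} [CommRing A] [Algebra ℚ A]
  {B C : P → Type*} [∀ F, CommRing (B F)] [∀ F, Algebra ℚ (B F)]
  [∀ F, CommRing (C F)] [∀ F, Algebra ℚ (C F)]

open Classical in
/-- The properties of the restriction maps `res F`, the pushforward maps `push F` and the degree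
maps that yield an orthogonal decomposition. -/
structure IsPushforwardSystem (x : P → A) (α : A) (n : ℕ) (e : P → ℕ) (deg : A →ₗ[ℚ] ℚ)
    (degB : ∀ F, B F →ₗ[ℚ] ℚ) (degC : ∀ F, C F →ₗ[ℚ] ℚ) (αC : ∀ F, C F)
    (J : ∀ F, Submodule ℚ (C F)) (res : ∀ F, A →ₐ[ℚ] B F ⊗[ℚ] C F)
    (push : ∀ F, B F ⊗[ℚ] C F →ₗ[ℚ] A) : Prop where
  mul_eq_zero : ∀ F G, ¬ F ≤ G → ¬ G ≤ F → x F * x G = 0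
  adjoin_eq_top : Algebra.adjoin ℚ (Set.range x) = ⊤
  pow_eq_zero : ∀ F, (α - ∑ G with F ≤ G, x G) ^ e F = 0
  alpha_pow : α ^ (n + 1) = 0
  deg_alpha : ∀ k, deg (α ^ k) = if k = n then 1 else 0
  res_surjective : ∀ F, Function.Surjective (res F)
  push_res : ∀ F a, push F (res F a) = x F * a
  deg_mul : ∀ F a, deg (x F * a) = tensorDeg (degB F) (degC F) (res F a)
  res_x : ∀ F K, F < K → ∃ b, res F (x K) = b ⊗ₜ 1
  res_alpha : ∀ F, ∃ b, res F α = b ⊗ₜ 1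
  exists_res_eq : ∀ F b, ∃ a ∈ Algebra.adjoin ℚ (x '' Set.Ioi F), res F a = b ⊗ₜ 1
  res_gamma : ∀ F, res F (α - ∑ G with F ≤ G, x G) = 1 ⊗ₜ αC F
  nondegenerate_left : ∀ F, IsNondegenerate (degB F)
  nondegenerate_right : ∀ F, IsNondegenerate (degC F)
  deg_eq_zero : ∀ F, ∀ j ∈ J F, degC F j = 0
  pow_mem : ∀ F k, k + 1 < e F → αC F ^ k ∈ J F
  le_adjoin : ∀ F, J F ≤ Subalgebra.toSubmodule (Algebra.adjoin ℚ {αC F})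

/-- The image of `B ⊗ J` under a map defined on `B ⊗ C`. -/
noncomputable def pushPart {B C : Type*} [CommRing B] [Algebra ℚ B] [CommRing C] [Algebra ℚ C]
    (push : B ⊗[ℚ] C →ₗ[ℚ] A) (J : Submodule ℚ C) : Submodule ℚ A :=
  LinearMap.range (push ∘ₗ LinearMap.lTensor B J.subtype)

theorem pushPart_induction {B C : Type*} [CommRing B] [Algebra ℚ B] [CommRing C] [Algebra ℚ C]
    {push : B ⊗[ℚ] C →ₗ[ℚ] A} {J : Submodule ℚ C} {V : Submodule ℚ A}
    (h : ∀ b, ∀ j ∈ J, push (b ⊗ₜ j) ∈ V) : pushPart push J ≤ V := by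
  rintro _ ⟨t, rfl⟩
  induction t with
  | zero => rw [map_zero]; exact zero_mem _
  | add t u ht hu => rw [map_add]; exact add_mem ht hu
  | tmul b j => exact h b j j.2

theorem push_tmul_mem_pushPart {B C : Type*} [CommRing B] [Algebra ℚ B] [CommRing C] [Algebra ℚ C]
    {push : B ⊗[ℚ] C →ₗ[ℚ] A} {J : Submodule ℚ C} (b : B) {j : C} (hj : j ∈ J) :
    push (b ⊗ₜ j) ∈ pushPart push J :=
  ⟨b ⊗ₜ ⟨j, hj⟩, rfl⟩

namespace IsPushforwardSystem

variable {x : P → A} {α : A} {n : ℕ} {e : P → ℕ} {deg : A →ₗ[ℚ] ℚ}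
  {degB : ∀ F, B F →ₗ[ℚ] ℚ} {degC : ∀ F, C F →ₗ[ℚ] ℚ} {αC : ∀ F, C F}
  {J : ∀ F, Submodule ℚ (C F)} {res : ∀ F, A →ₐ[ℚ] B F ⊗[ℚ] C F}
  {push : ∀ F, B F ⊗[ℚ] C F →ₗ[ℚ] A}

/-- The projection formula: as `t` is the restriction of some a', both sides equal `x F` times a'
times `a`. -/
theorem push_mul (h : IsPushforwardSystem x α n e deg degB degC αC J res push)
    (F : P) (t : B F ⊗[ℚ] C F) (a : A) : push F t * a = push F (t * res F a) := by
  obtain ⟨a', rfl⟩ := h.res_surjective F t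
  rw [← map_mul, h.push_res, h.push_res, mul_assoc]

theorem deg_push (h : IsPushforwardSystem x α n e deg degB degC αC J res push)
    (F : P) (t : B F ⊗[ℚ] C F) : deg (push F t) = tensorDeg (degB F) (degC F) t := by
  obtain ⟨a, rfl⟩ := h.res_surjective F t
  rw [h.push_res, h.deg_mul]

/-- By the projection formula `deg` of `push F t * b` is the tensor pairing of `t` with `res F b`,
and every element of the tensor product is such a restriction. Injectivity of `push F` follows, as
does trivial intersection of the summand with the radical. -/
theorem eq_zero_of_push (h : IsPushforwardSystem x α n e deg degB degC αC J res push)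
    (F : P) (t : B F ⊗[ℚ] C F) (ht : ∀ b, deg (push F t * b) = 0) : t = 0 := by
  refine (h.nondegenerate_left F).tensorDeg (h.nondegenerate_right F) t fun u => ?_
  obtain ⟨a, rfl⟩ := h.res_surjective F u
  rw [← h.deg_push, ← h.push_mul, ht]

theorem push_injective (h : IsPushforwardSystem x α n e deg degB degC αC J res push)
    (F : P) : Function.Injective (push F) := by
  rw [injective_iff_map_eq_zero]
  exact fun t ht => h.eq_zero_of_push F t fun b => by rw [ht, zero_mul, map_zero]

/-- Such a `c` acts through the left tensor factor only, so `J F` need not be an ideal. -/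
theorem mul_mem_pushPart (h : IsPushforwardSystem x α n e deg degB degC αC J res push)
    (F : P) {c : A} (hc : ∃ b, res F c = b ⊗ₜ 1) {s : A}
    (hs : s ∈ pushPart (push F) (J F)) : c * s ∈ pushPart (push F) (J F) := by
  obtain ⟨b, hb⟩ := hc
  revert s
  suffices hs : pushPart (push F) (J F) ≤ (pushPart (push F) (J F)).comap (LinearMap.mulLeft ℚ c)
    from hs
  refine pushPart_induction fun b' j hj => ?_
  rw [Submodule.mem_comap, LinearMap.mulLeft_apply, mul_comm, h.push_mul, hb,
    Algebra.TensorProduct.tmul_mul_tmul, mul_one]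
  exact push_tmul_mem_pushPart _ hj

theorem deg_pushPart (h : IsPushforwardSystem x α n e deg degB degC αC J res push)
    (F : P) {s : A} (hs : s ∈ pushPart (push F) (J F)) : deg s = 0 := by
  suffices hle : pushPart (push F) (J F) ≤ LinearMap.ker deg from hle hs
  refine pushPart_induction fun b j hj => ?_
  rw [LinearMap.mem_ker, h.deg_push, tensorDeg_tmul, h.deg_eq_zero F j hj, mul_zero]

theorem res_eq_of_mem_adjoin (h : IsPushforwardSystem x α n e deg degB degC αC J res push)
    (F : P) {a : A}
    (ha : a ∈ Algebra.adjoin ℚ (insert α (x '' Set.Ioi F))) : ∃ b, res F a = b ⊗ₜ 1 := by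
  suffices hle : Algebra.adjoin ℚ (insert α (x '' Set.Ioi F)) ≤
      (Algebra.TensorProduct.includeLeft : B F →ₐ[ℚ] B F ⊗[ℚ] C F).range.comap (res F) by
    obtain ⟨b, hb⟩ := hle ha
    exact ⟨b, hb.symm⟩
  refine Algebra.adjoin_le (Set.insert_subset ?_ ?_)
  · obtain ⟨b, hb⟩ := h.res_alpha F
    exact ⟨b, hb.symm⟩
  · rintro _ ⟨K, hK, rfl⟩
    obtain ⟨b, hb⟩ := h.res_x F K hK
    exact ⟨b, hb.symm⟩

/-- Lift `b` to a polynomial in the variables above `F`, and `j`, a polynomial in `αC F`, to the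
same polynomial in γ_F, which restricts to 1 ⊗ `αC F`. The pushforward of `b ⊗ j` is `x F` times the
product of the two lifts. -/
theorem pushPart_le (h : IsPushforwardSystem x α n e deg degB degC αC J res push)
    (F : P) : pushPart (push F) (J F) ≤
    Subalgebra.toSubmodule (Algebra.adjoin ℚ (insert α (x '' Set.Ici F))) := by
  classical
  have hx (K : P) (hK : F ≤ K) : x K ∈ Algebra.adjoin ℚ (insert α (x '' Set.Ici F)) :=
    Algebra.subset_adjoin (Or.inr ⟨K, hK, rfl⟩)
  refine pushPart_induction fun b j hj => ?_
  obtain ⟨a, ha, hab⟩ := h.exists_res_eq F b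
  have hγ : α - ∑ G with F ≤ G, x G ∈ Algebra.adjoin ℚ (insert α (x '' Set.Ici F)) :=
    sub_mem (Algebra.subset_adjoin (Or.inl rfl))
      (sum_mem fun G hG => hx G (Finset.mem_filter.1 hG).2)
  obtain ⟨p, hp⟩ : ∃ p : Polynomial ℚ, Polynomial.aeval (αC F) p = j := by
    have := h.le_adjoin F hj
    rw [Algebra.adjoin_singleton_eq_range_aeval] at this
    exact this
  have hj' : res F (Polynomial.aeval (α - ∑ G with F ≤ G, x G) p) = 1 ⊗ₜ j := by
    rw [← Polynomial.aeval_algHom_apply, h.res_gamma, ← hp]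
    exact Polynomial.aeval_algHom_apply Algebra.TensorProduct.includeRight _ _
  have hbj : b ⊗ₜ[ℚ] j = res F (a * Polynomial.aeval (α - ∑ G with F ≤ G, x G) p) := by
    rw [map_mul, hab, hj', Algebra.TensorProduct.tmul_mul_tmul, mul_one, one_mul]
  rw [hbj, h.push_res]
  refine Subalgebra.mul_mem _ (hx F le_rfl) (Subalgebra.mul_mem _ ?_ ?_)
  · refine Algebra.adjoin_mono ?_ ha
    exact (Set.image_mono Set.Ioi_subset_Ici_self).trans (Set.subset_insert _ _)
  · exact Algebra.adjoin_le (Set.singleton_subset_iff.2 hγ)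
      (Polynomial.aeval_mem_adjoin_singleton _ _)

theorem deg_mul_eq_zero (h : IsPushforwardSystem x α n e deg degB degC αC J res push)
    (F : P) {s : A} (hs : s ∈ pushPart (push F) (J F)) {a : A}
    (ha : a ∈ Algebra.adjoin ℚ (insert α (x '' Set.Ioi F))) : deg (a * s) = 0 :=
  h.deg_pushPart F (h.mul_mem_pushPart F (h.res_eq_of_mem_adjoin F ha) hs)

/-- The summand of the larger element `G` lies in the algebra of `α` and the variables strictly
above `F`, which preserves the summand of `F`, where `deg` is zero. -/
theorem deg_mul_eq_zero_of_lt (h : IsPushforwardSystem x α n e deg degB degC αC J res push)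
    {F G : P} (hFG : F < G) {s t : A}
    (hs : s ∈ pushPart (push F) (J F)) (ht : t ∈ pushPart (push G) (J G)) : deg (t * s) = 0 := by
  refine h.deg_mul_eq_zero F hs (Algebra.adjoin_mono ?_ (h.pushPart_le G ht))
  exact Set.insert_subset_insert (Set.image_mono (Set.Ici_subset_Ioi.2 hFG))

theorem deg_mul_eq_zero_of_ne (h : IsPushforwardSystem x α n e deg degB degC αC J res push)
    {F G : P} (hFG : F ≠ G) {s t : A}
    (hs : s ∈ pushPart (push F) (J F)) (ht : t ∈ pushPart (push G) (J G)) : deg (s * t) = 0 := by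
  by_cases h1 : F ≤ G
  · rw [mul_comm]
    exact h.deg_mul_eq_zero_of_lt (lt_of_le_of_ne h1 hFG) hs ht
  by_cases h2 : G ≤ F
  · exact h.deg_mul_eq_zero_of_lt (lt_of_le_of_ne h2 hFG.symm) ht hs
  -- For incomparable `F` and `G` the elements are multiples of `x F` and `x G`, whose product
  -- vanishes.
  · obtain ⟨u, rfl⟩ := hs
    obtain ⟨v, rfl⟩ := ht
    rw [LinearMap.comp_apply, LinearMap.comp_apply]
    obtain ⟨a, ha⟩ := h.res_surjective F (LinearMap.lTensor (B F) (J F).subtype u)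
    obtain ⟨b, hb⟩ := h.res_surjective G (LinearMap.lTensor (B G) (J G).subtype v)
    rw [← ha, ← hb, h.push_res, h.push_res, mul_mul_mul_comm, h.mul_eq_zero F G h1 h2, zero_mul,
      map_zero]

/-- The summands: the subalgebra generated by `α` and the images of the pushforwards. -/
theorem isOrthogonalDecomposition (h : IsPushforwardSystem x α n e deg degB degC αC J res push)
    {ι : Type*} {f : ι → P} (hf : Function.Injective f)
    (hfe : ∀ F, 1 < e F → F ∈ Set.range f) {S : Option ι → Submodule ℚ A}
    (hS : S none = Subalgebra.toSubmodule (Algebra.adjoin ℚ {α}))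
    (hS' : ∀ i, S (some i) = pushPart (push (f i)) (J (f i))) :
    IsNondegenerate deg ∧ IsOrthogonalDecomposition (Algebra.adjoin ℚ {α}) deg S := by
  classical
  have hH (F : P) {a : A} (ha : a ∈ Algebra.adjoin ℚ {α}) :
      a ∈ Algebra.adjoin ℚ (insert α (x '' Set.Ioi F)) :=
    Algebra.adjoin_mono (Set.singleton_subset_iff.2 (Set.mem_insert _ _)) ha
  have hmul (i : Option ι) (a : A) (ha : a ∈ Algebra.adjoin ℚ {α}) (s : A) (hs : s ∈ S i) :
      a * s ∈ S i := by
    cases i with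
    | none => rw [hS] at hs ⊢; exact Subalgebra.mul_mem _ ha hs
    | some i =>
      rw [hS'] at hs ⊢
      exact h.mul_mem_pushPart _ (h.res_eq_of_mem_adjoin _ (hH _ ha)) hs
  have hαH : α ∈ Algebra.adjoin ℚ {α} := Algebra.subset_adjoin rfl
  have horth (i j : Option ι) (hij : i ≠ j) (a : A) (ha : a ∈ S i) (b : A) (hb : b ∈ S j) :
      deg (a * b) = 0 := by
    cases i with
    | none =>
      cases j with
      | none => exact absurd rfl hij
      | some j =>
        rw [hS] at ha
        rw [hS'] at hb
        exact h.deg_mul_eq_zero _ hb (hH _ ha)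
    | some i =>
      rw [hS'] at ha
      cases j with
      | none =>
        rw [hS] at hb
        rw [mul_comm]
        exact h.deg_mul_eq_zero _ ha (hH _ hb)
      | some j =>
        rw [hS'] at hb
        exact h.deg_mul_eq_zero_of_ne (fun he => hij (congrArg some (hf he))) ha hb
  have hrad (i : Option ι) (s : A) (hs : s ∈ S i) (hd : ∀ b, deg (s * b) = 0) : s = 0 := by
    cases i with
    | none =>
      rw [hS] at hs
      exact eq_zero_of_mem_adjoin h.alpha_pow h.deg_alpha hs hd
    | some i =>
      rw [hS'] at hs
      obtain ⟨t, rfl⟩ := hs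
      rw [LinearMap.comp_apply] at hd ⊢
      rw [h.eq_zero_of_push _ _ hd, map_zero]
  have hsup : ⨆ i, S i = ⊤ := by
    rw [eq_top_iff]
    intro a _
    have hle (i : Option ι) : S i ≤ ⨆ i, S i := le_iSup S i
    refine mem_of_reduction h.mul_eq_zero h.pow_eq_zero ?_ ?_ ?_ ?_ a
      (h.adjoin_eq_top ▸ Algebra.mem_top)
    · intro F
      -- Any lift `t` of `b` to the variables above `F` has the same restriction as `α`, and `x F *
      -- a` depends only on the restriction of `a`.
      obtain ⟨b, hb⟩ := h.res_alpha F
      obtain ⟨t, ht, htb⟩ := h.exists_res_eq F b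
      refine ⟨t, ht, ?_⟩
      rw [mul_comm, ← h.push_res, hb, ← htb, h.push_res, mul_comm]
    · refine hle none ?_
      rw [hS]
      exact Subalgebra.one_mem _
    · intro w hw
      induction hw using Submodule.iSup_induction' with
      | zero => rw [mul_zero]; exact zero_mem _
      | add b c _ _ hb hc => rw [mul_add]; exact add_mem hb hc
      | mem i b hb => exact hle i (hmul i α hαH b hb)
    · intro F k hk b hb
      -- Only `F` with `1 < e F` occur here, so the others need no summand.
      obtain ⟨i, rfl⟩ := hfe F (by omega)
      refine hle (some i) ?_
      rw [hS']
      obtain ⟨c, hc⟩ := h.res_eq_of_mem_adjoin (f i) (Algebra.adjoin_mono (Set.subset_insert _ _) hb)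
      rw [mul_assoc, ← h.push_res, map_mul, hc, map_pow, h.res_gamma,
        Algebra.TensorProduct.tmul_pow, Algebra.TensorProduct.tmul_mul_tmul, one_pow, one_mul,
        mul_one]
      exact push_tmul_mem_pushPart _ (h.pow_mem _ k hk)
  refine ⟨.of_orthogonal hsup horth hrad, hmul, ?_, horth⟩
  convert DirectSum.isInternal_submodule_of_iSupIndep_of_iSup_eq_top
    (iSupIndep_of_orthogonal hsup horth hrad) hsup
  rfl

end IsPushforwardSystem

end Decomposition

/-! ### Ranks of flats -/

section Ranks

variable {α : Type*} {M : Matroid α}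

theorem loopless_restrict [M.Loopless] {F : Set α} (hF : F ⊆ M.E) : (M ↾ F).Loopless :=
  (Matroid.restrict_isRestriction M F hF).loopless

theorem loopless_contract {F : Set α} (hF : M.IsFlat F) : (M ／ F).Loopless := by
  rw [Matroid.loopless_iff, Matroid.contract_loops_eq, hF.closure, sdiff_self]
  rfl

theorem rk_restrict_ground (M : Matroid α) : rk (M ↾ M.E) = rk M := by
  rw [Matroid.restrict_ground_eq_self]

variable [Finite α]

theorem coe_rk (M : Matroid α) : (rk M : ℕ∞) = M.eRank :=
  ENat.natCast_toNat ((Matroid.eRank_ne_top_iff M).2 inferInstance)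

theorem coe_rk_restrict (M : Matroid α) (X : Set α) : (rk (M ↾ X) : ℕ∞) = M.eRk X := by
  rw [coe_rk, Matroid.eRank_restrict]

theorem rk_restrict_mono {X Y : Set α} (h : X ⊆ Y) : rk (M ↾ X) ≤ rk (M ↾ Y) := by
  rw [← Nat.cast_le (α := ℕ∞), coe_rk_restrict, coe_rk_restrict]
  exact M.eRk_mono h

theorem rk_restrict_le (M : Matroid α) (X : Set α) : rk (M ↾ X) ≤ rk M := by
  rw [← Nat.cast_le (α := ℕ∞), coe_rk_restrict, coe_rk]
  exact M.eRk_le_eRank X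

theorem eq_of_rk_le {F G : Set α} (hF : M.IsFlat F) (hG : M.IsFlat G) (h : F ⊆ G)
    (hr : rk (M ↾ G) ≤ rk (M ↾ F)) : F = G := by
  rw [← Nat.cast_le (α := ℕ∞), coe_rk_restrict, coe_rk_restrict] at hr
  rw [← hF.closure, ← hG.closure]
  exact (M.isRkFinite_set F).closure_eq_closure_of_subset_of_eRk_ge_eRk h hr

theorem rk_restrict_lt {F G : Set α} (hF : M.IsFlat F) (hG : M.IsFlat G) (h : F ⊂ G) :
    rk (M ↾ F) < rk (M ↾ G) := by
  by_contra hr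
  exact h.ne (eq_of_rk_le hF hG h.subset (not_lt.1 hr))

theorem rk_restrict_lt_rk {F : Set α} (hF : M.IsFlat F) (h : F ≠ M.E) : rk (M ↾ F) < rk M := by
  rw [← rk_restrict_ground M]
  exact rk_restrict_lt hF M.ground_isFlat (hF.subset_ground.ssubset_of_ne h)

theorem rk_restrict_pos [M.Loopless] {X : Set α} (hX : X.Nonempty) (hXE : X ⊆ M.E) :
    1 ≤ rk (M ↾ X) := by
  obtain ⟨e, he⟩ := hX
  rw [← Nat.cast_le (α := ℕ∞), coe_rk_restrict, Nat.cast_one,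
    ← Matroid.eRk_singleton_eq (M := M) (hXE he)]
  exact M.eRk_mono (Set.singleton_subset_iff.2 he)

theorem rk_pos_iff [M.Loopless] : 1 ≤ rk M ↔ M.E.Nonempty := by
  refine ⟨fun h => ?_, fun h => ?_⟩
  · rw [Set.nonempty_iff_ne_empty]
    intro hE
    have h' : (rk M : ℕ∞) = 0 := by
      rw [coe_rk, ← Matroid.eRk_ground, hE, Matroid.eRk_empty]
    have : rk M = 0 := by exact_mod_cast h'
    omega
  · rw [← rk_restrict_ground M]
    exact rk_restrict_pos h subset_rfl

theorem rk_restrict_indep {I : Set α} (hI : M.Indep I) : rk (M ↾ I) = I.ncard := by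
  rw [← Nat.cast_inj (R := ℕ∞), coe_rk_restrict, hI.eRk_eq_encard, Set.Finite.cast_ncard_eq]
  exact Set.toFinite I

theorem rk_restrict_closure (M : Matroid α) (X : Set α) :
    rk (M ↾ M.closure X) = rk (M ↾ X) := by
  rw [← Nat.cast_inj (R := ℕ∞), coe_rk_restrict, coe_rk_restrict, Matroid.eRk_closure_eq]

/-- A base of the contraction together with a basis of `F` is a base of `M`. -/
theorem rk_contract_add {F : Set α} (hF : F ⊆ M.E) : rk (M ／ F) + rk (M ↾ F) = rk M := by
  obtain ⟨I, hI⟩ := M.exists_isBasis F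
  obtain ⟨J, hJ⟩ := (M ／ F).exists_isBase
  obtain ⟨hJI, hd⟩ := hI.contract_indep_iff.1 hJ.indep
  have hs := ((Matroid.contract_spanning_iff hF).1 hJ.spanning).1
  have hB : M.IsBase (J ∪ I) := by
    refine hJI.isBase_of_spanning ?_
    have hJF : J ∪ F ⊆ M.E := Set.union_subset (hJ.subset_ground.trans Set.sdiff_subset) hF
    rw [Matroid.spanning_iff_closure_eq hJF] at hs
    rw [Matroid.spanning_iff_closure_eq hJI.subset_ground, ← hs,
      ← Matroid.closure_union_closure_right_eq, hI.closure_eq_closure,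
      Matroid.closure_union_closure_right_eq]
  rw [← Nat.cast_inj (R := ℕ∞), Nat.cast_add, coe_rk_restrict, coe_rk, coe_rk,
    ← hJ.encard_eq_eRank, ← hI.encard_eq_eRk, ← hB.encard_eq_eRank, Set.encard_union_eq]
  exact (hd.mono_left hI.subset).symm

theorem NPFlat.rk_lt_rk {F G : NPFlat M} (h : F < G) : rk (M ↾ F.1) < rk (M ↾ G.1) :=
  rk_restrict_lt F.2.1 G.2.1 h

theorem PFlat.rk_lt_rk {F G : PFlat M} (h : F < G) : rk (M ↾ F.1) < rk (M ↾ G.1) :=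
  rk_restrict_lt F.2.1 G.2.1 h

theorem injOn_of_isChain {P : Type*} [PartialOrder P] {r : P → ℕ} (hr : StrictMono r) {S : Set P}
    (hS : IsChain (· ≤ ·) S) : Set.InjOn r S := by
  intro F hF G hG h
  by_contra hne
  rcases hS hF hG hne with hle | hle
  · exact (hr (lt_of_le_of_ne hle hne)).ne h
  · exact (hr (lt_of_le_of_ne hle (Ne.symm hne))).ne' h

/-- The rank is injective on a chain, with values from `1` (as there are no loops) to `rk M - 1`. -/
theorem NPFlat.card_lt [M.Loopless] (hM : 1 ≤ rk M) {S : Finset (NPFlat M)}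
    (hS : IsChain (· ≤ ·) (S : Set (NPFlat M))) : S.card + 1 ≤ rk M := by
  have h : S.card ≤ (Finset.Ico 1 (rk M)).card := by
    refine Finset.card_le_card_of_injOn (fun F => rk (M ↾ F.1)) ?_
      (injOn_of_isChain (fun _ _ => NPFlat.rk_lt_rk) hS)
    intro F _
    rw [Finset.mem_coe, Finset.mem_Ico]
    exact ⟨rk_restrict_pos F.2.2.1 F.2.1.subset_ground, rk_restrict_lt_rk F.2.1 F.2.2.2⟩
  rw [Nat.card_Ico] at h
  omega

/-- A chain of proper flats whose members have rank at least `k` has at most `rk M - k` members. -/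
theorem PFlat.card_add_le {S : Finset (PFlat M)} (hS : IsChain (· ≤ ·) (S : Set (PFlat M))) {k : ℕ}
    (hk : k ≤ rk M) (hSk : ∀ F ∈ S, k ≤ rk (M ↾ F.1)) : S.card + k ≤ rk M := by
  have h : S.card ≤ (Finset.Ico k (rk M)).card := by
    refine Finset.card_le_card_of_injOn (fun F => rk (M ↾ F.1)) ?_
      (injOn_of_isChain (fun _ _ => PFlat.rk_lt_rk) hS)
    intro F hF
    rw [Finset.mem_coe, Finset.mem_Ico]
    exact ⟨hSk F hF, rk_restrict_lt_rk F.2.1 F.2.2⟩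
  rw [Nat.card_Ico] at h
  omega

end Ranks

/-! ### Degree maps with prescribed values on flags -/

section FlagDegree

variable {P : Type*} [PartialOrder P] {A : Type*} [CommRing A] [Algebra ℚ A]

/-- The chains of `P` have at most `n` members, and `deg` is `1` on the monomials of the chains with
`n` members and `0` on those of all other chains. -/
structure IsFlagDegree (x : P → A) (n : ℕ) (deg : A →ₗ[ℚ] ℚ) : Prop where
  card_le : ∀ S : Finset P, IsChain (· ≤ ·) (S : Set P) → S.card ≤ n
  apply_prod : ∀ S : Finset P, IsChain (· ≤ ·) (S : Set P) →
    deg (∏ F ∈ S, x F) = if S.card = n then 1 else 0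

theorem IsFlagDegree.apply_one {x : P → A} {n : ℕ} {deg : A →ₗ[ℚ] ℚ} (h : IsFlagDegree x n deg) :
    deg 1 = if n = 0 then 1 else 0 := by
  have := h.apply_prod ∅ (by simp)
  rw [Finset.prod_empty] at this
  rw [this]
  cases n <;> simp

variable [DecidableEq P] {x : P → A}

/-- Linear functionals that vanish on `N` and on the monomials of chains with `k` members vanish on
homogeneous polynomials of degree `k`. -/
theorem apply_eq_zero_of_mem_chainSpan {S₀ : Finset P} {N : Ideal A} {k : ℕ} {f : A →ₗ[ℚ] ℚ}
    (hN : ∀ a ∈ N, f a = 0)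
    (hf : ∀ S : Finset P, S.card = k → Disjoint S S₀ →
      IsChain (· ≤ ·) ((S ∪ S₀ : Finset P) : Set P) → f (∏ F ∈ S, x F) = 0) {a : A}
    (ha : a ∈ chainSpan x S₀ N k) : f a = 0 := by
  suffices h : chainSpan x S₀ N k ≤ LinearMap.ker f from h ha
  refine sup_le (fun a ha => hN a ha) (Submodule.span_le.2 ?_)
  rintro _ ⟨S, hk, hd, hS, rfl⟩
  exact hf S hk hd hS

/-- Every element is a polynomial in the `x F`, so modulo `N` it is a combination of the chain
monomials on which `f` is assumed to vanish. -/
theorem eq_zero_of_chains [Fintype P] {S₀ : Finset P} {N : Ideal A}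
    (hinc : ∀ F G, ¬ F ≤ G → ¬ G ≤ F → x F * x G = 0)
    (hx : Algebra.adjoin ℚ (Set.range x) = ⊤)
    (hN : ∀ H, ∀ K ∈ S₀, ¬ H ≤ K → ¬ K ≤ H → x H ∈ N) (hrel : HasChainRelations x S₀ N)
    (hS₀ : IsChain (· ≤ ·) (S₀ : Set P)) {f : A →ₗ[ℚ] ℚ} (hfN : ∀ a ∈ N, f a = 0)
    (hf : ∀ S : Finset P, Disjoint S S₀ →
      IsChain (· ≤ ·) ((S ∪ S₀ : Finset P) : Set P) → f (∏ F ∈ S, x F) = 0) : f = 0 := by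
  ext a
  have ha : a ∈ Algebra.adjoin ℚ (Set.range x) := hx ▸ Algebra.mem_top
  rw [Algebra.adjoin_range_eq_range_aeval] at ha
  obtain ⟨p, rfl⟩ := ha
  change f (MvPolynomial.aeval x p) = 0
  rw [← p.sum_homogeneousComponent, map_sum, map_sum]
  refine Finset.sum_eq_zero fun k _ => ?_
  refine apply_eq_zero_of_mem_chainSpan hfN (fun S _ => hf S)
    (aeval_mem_chainSpan hinc hN hrel hS₀ (fun s => Submodule.subset_span ⟨s, rfl⟩)
      (p.homogeneousComponent_mem k))

end FlagDegree

/-! ### Restriction maps -/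

section Restriction

variable {P : Type*} [PartialOrder P] [Fintype P] {A : Type*} [CommRing A] [Algebra ℚ A]
  {Q R : P → Type*} [∀ F, PartialOrder (Q F)] [∀ F, PartialOrder (R F)]
  {B C : P → Type*} [∀ F, CommRing (B F)] [∀ F, Algebra ℚ (B F)]
  [∀ F, CommRing (C F)] [∀ F, Algebra ℚ (C F)]

open Classical in
/-- The ring `A` is generated by variables `x F`, and `res F` and `push F` are the restriction and
pushforward maps. The poset `Q F` is the part of `P` above `F`, and the poset `R F` the part
below `F`. -/
structure IsRestrictionSystem (x : P → A) (α : A) (xB : ∀ F, Q F → B F) (αB : ∀ F, B F)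
    (xC : ∀ F, R F → C F) (αC : ∀ F, C F) (u : ∀ F, Q F → P) (v : ∀ F, R F → P)
    (res : ∀ F, A →ₐ[ℚ] B F ⊗[ℚ] C F) (push : ∀ F, B F ⊗[ℚ] C F →ₗ[ℚ] A) : Prop where
  mul_eq_zero : ∀ F G, ¬ F ≤ G → ¬ G ≤ F → x F * x G = 0
  adjoin_eq_top : Algebra.adjoin ℚ (Set.range x) = ⊤
  adjoin_left : ∀ F, Algebra.adjoin ℚ (Set.range (xB F)) = ⊤
  adjoin_right : ∀ F, Algebra.adjoin ℚ (Set.range (xC F)) = ⊤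
  u_le : ∀ F G H, u F G ≤ u F H ↔ G ≤ H
  v_le : ∀ F G H, v F G ≤ v F H ↔ G ≤ H
  range_u : ∀ F, Set.range (u F) = Set.Ioi F
  range_v : ∀ F, Set.range (v F) = Set.Iio F
  res_u : ∀ F G, res F (x (u F G)) = xB F G ⊗ₜ 1
  res_v : ∀ F G, res F (x (v F G)) = 1 ⊗ₜ xC F G
  res_eq_zero : ∀ F G, ¬ F ≤ G → ¬ G ≤ F → res F (x G) = 0
  push_res : ∀ F a, push F (res F a) = x F * a
  res_alpha : ∀ F, res F α = αB F ⊗ₜ 1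
  res_gamma : ∀ F, res F (α - ∑ G with F ≤ G, x G) = 1 ⊗ₜ αC F
  exists_relation : ∀ S : Finset P, IsChain (· ≤ ·) (S : Set P) → ∀ H ∈ S, ∃ c : P → ℚ, c H = 1 ∧
    (∀ K ∈ S, K ≠ H → c K ≠ 0 → K < H) ∧ (∑ K, c K • x K) * x H = 0 ∧ res H (∑ K, c K • x K) = 0

namespace IsRestrictionSystem

variable {x : P → A} {α : A} {xB : ∀ F, Q F → B F} {αB : ∀ F, B F}
    {xC : ∀ F, R F → C F} {αC : ∀ F, C F} {u : ∀ F, Q F → P} {v : ∀ F, R F → P}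
    {res : ∀ F, A →ₐ[ℚ] B F ⊗[ℚ] C F} {push : ∀ F, B F ⊗[ℚ] C F →ₗ[ℚ] A}

theorem u_injective (h : IsRestrictionSystem x α xB αB xC αC u v res push)
    (F : P) : Function.Injective (u F) := fun G H hGH =>
  le_antisymm ((h.u_le F G H).1 hGH.le) ((h.u_le F H G).1 hGH.ge)

theorem v_injective (h : IsRestrictionSystem x α xB αB xC αC u v res push)
    (F : P) : Function.Injective (v F) := fun G H hGH =>
  le_antisymm ((h.v_le F G H).1 hGH.le) ((h.v_le F H G).1 hGH.ge)

theorem exists_res_left (h : IsRestrictionSystem x α xB αB xC αC u v res push) (F : P) (b : B F) :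
    ∃ a ∈ Algebra.adjoin ℚ (x '' Set.Ioi F), res F a = b ⊗ₜ 1 := by
  have hle : Algebra.adjoin ℚ (Set.range (xB F)) ≤
      ((Algebra.adjoin ℚ (x '' Set.Ioi F)).map (res F)).comap
        (Algebra.TensorProduct.includeLeft : B F →ₐ[ℚ] B F ⊗[ℚ] C F) := by
    refine Algebra.adjoin_le ?_
    rintro _ ⟨G, rfl⟩
    exact ⟨x (u F G), Algebra.subset_adjoin ⟨_, h.range_u F ▸ ⟨G, rfl⟩, rfl⟩, h.res_u F G⟩
  rw [h.adjoin_left] at hle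
  exact hle (Algebra.mem_top : b ∈ _)

theorem exists_res_right (h : IsRestrictionSystem x α xB αB xC αC u v res push)
    (F : P) (c : C F) : ∃ a, res F a = 1 ⊗ₜ c := by
  have hle : Algebra.adjoin ℚ (Set.range (xC F)) ≤
      (res F).range.comap (Algebra.TensorProduct.includeRight : C F →ₐ[ℚ] B F ⊗[ℚ] C F) := by
    refine Algebra.adjoin_le ?_
    rintro _ ⟨G, rfl⟩
    exact ⟨x (v F G), h.res_v F G⟩
  rw [h.adjoin_right] at hle
  exact hle (Algebra.mem_top : c ∈ _)

theorem res_surjective (h : IsRestrictionSystem x α xB αB xC αC u v res push)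
    (F : P) : Function.Surjective (res F) := by
  intro t
  induction t with
  | zero => exact ⟨0, map_zero _⟩
  | add t t' ht ht' =>
    obtain ⟨a, rfl⟩ := ht
    obtain ⟨b, rfl⟩ := ht'
    exact ⟨a + b, map_add _ _ _⟩
  | tmul b c =>
    obtain ⟨a, -, ha⟩ := h.exists_res_left F b
    obtain ⟨a', ha'⟩ := h.exists_res_right F c
    exact ⟨a * a', by rw [map_mul, ha, ha', Algebra.TensorProduct.tmul_mul_tmul, mul_one, one_mul]⟩

/-- With `S₀` empty, `H` belongs to `S`, so the monomial contains the factor `x H` that the relation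
annihilates. -/
theorem hasChainRelations_empty (h : IsRestrictionSystem x α xB αB xC αC u v res push)
    [DecidableEq P] : HasChainRelations x ∅ ⊥ := by
  intro S _ hS H hH
  rw [Finset.union_empty] at hS hH ⊢
  obtain ⟨c, h1, h2, h3, -⟩ := h.exists_relation S hS H hH
  refine ⟨c, h1, h2, ?_⟩
  rw [Ideal.mem_bot, ← Finset.mul_prod_erase _ _ hH, ← mul_assoc, h3, zero_mul]

theorem aeval_mem_chainSpan_empty (h : IsRestrictionSystem x α xB αB xC αC u v res push)
    [DecidableEq P] {σ : Type*} {w : σ → A}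
    (hw : ∀ s, w s ∈ Submodule.span ℚ (Set.range x)) {k : ℕ} {p : MvPolynomial σ ℚ}
    (hp : p ∈ MvPolynomial.homogeneousSubmodule σ ℚ k) :
    MvPolynomial.aeval w p ∈ chainSpan x ∅ ⊥ k :=
  aeval_mem_chainSpan h.mul_eq_zero (by simp) h.hasChainRelations_empty (by simp) hw hp

variable {n : ℕ} {nB nC : P → ℕ} {degB : ∀ F, B F →ₗ[ℚ] ℚ} {degC : ∀ F, C F →ₗ[ℚ] ℚ}

/-- A degree map vanishes on the homogeneous polynomials of other degrees. -/
theorem apply_aeval_eq_zero (h : IsRestrictionSystem x α xB αB xC αC u v res push)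
    {deg : A →ₗ[ℚ] ℚ} (hdeg : IsFlagDegree x n deg)
    {σ : Type*} {w : σ → A} (hw : ∀ s, w s ∈ Submodule.span ℚ (Set.range x)) {k : ℕ} (hk : k ≠ n)
    {p : MvPolynomial σ ℚ} (hp : p ∈ MvPolynomial.homogeneousSubmodule σ ℚ k) :
    deg (MvPolynomial.aeval w p) = 0 := by
  classical
  refine apply_eq_zero_of_mem_chainSpan ?_ ?_ (h.aeval_mem_chainSpan_empty hw hp)
  · intro a ha
    rw [Ideal.mem_bot.1 ha, map_zero]
  · intro S hSk _ hS
    rw [Finset.union_empty] at hS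
    rw [hdeg.apply_prod S hS, if_neg (hSk ▸ hk)]

/-- A degree map is determined by its values on flags. -/
theorem flagDegree_unique (h : IsRestrictionSystem x α xB αB xC αC u v res push)
    {deg deg' : A →ₗ[ℚ] ℚ} (hdeg : IsFlagDegree x n deg)
    (hdeg' : IsFlagDegree x n deg') : deg = deg' := by
  classical
  rw [← sub_eq_zero]
  refine eq_zero_of_chains (S₀ := ∅) (N := ⊥) h.mul_eq_zero h.adjoin_eq_top (by simp)
    h.hasChainRelations_empty (by simp) ?_ ?_
  · intro a ha
    rw [Ideal.mem_bot.1 ha, map_zero]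
  · intro S _ hS
    rw [Finset.union_empty] at hS
    rw [LinearMap.sub_apply, hdeg.apply_prod S hS, hdeg'.apply_prod S hS, sub_self]

/-- The chain splits into its members above and below `F`, and its restriction is the tensor product
of the two chain monomials. As neither part can exceed its maximal length, the total length is
maximal only if both are. -/
theorem tensorDeg_res_prod (h : IsRestrictionSystem x α xB αB xC αC u v res push)
    {F : P} (hB : IsFlagDegree (xB F) (nB F) (degB F))
    (hC : IsFlagDegree (xC F) (nC F) (degC F)) {S : Finset P} (hF : F ∉ S)
    (hS : IsChain (· ≤ ·) (insert F (S : Set P))) :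
    tensorDeg (degB F) (degC F) (res F (∏ G ∈ S, x G)) =
      if S.card = nB F + nC F then 1 else 0 := by
  classical
  have hS' : IsChain (· ≤ ·) (S : Set P) := hS.mono (Set.subset_insert _ _)
  have huS : Set.InjOn (u F) (u F ⁻¹' S) := (h.u_injective F).injOn
  have hvS : Set.InjOn (v F) (v F ⁻¹' S) := (h.v_injective F).injOn
  set T := S.preimage (u F) huS with hT
  set T' := S.preimage (v F) hvS with hT'
  have hfil : S.filter (fun G => G ∉ Set.range (u F)) = S.filter (fun G => G ∈ Set.range (v F)) := by
    refine Finset.filter_congr fun G hG => ?_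
    rw [h.range_u, h.range_v, Set.mem_Ioi, Set.mem_Iio]
    have hne : F ≠ G := fun he => hF (he ▸ hG)
    rcases hS (Set.mem_insert _ _) (Set.mem_insert_of_mem _ hG) hne with hle | hle
    · have := lt_of_le_of_ne hle hne
      exact ⟨fun h' => absurd this h', fun h' => absurd this h'.asymm⟩
    · have := lt_of_le_of_ne hle hne.symm
      exact ⟨fun _ => this, fun h' => h'.asymm⟩
  have hcard : T.card + T'.card = S.card := by
    rw [Finset.card_preimage, Finset.card_preimage, ← hfil, Finset.card_filter_add_card_filter_not]
  have hTc : IsChain (· ≤ ·) (T : Set (Q F)) := by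
    intro G hG H hH hne
    rw [hT, Finset.coe_preimage] at hG hH
    simp only [← h.u_le]
    exact hS' hG hH fun he => hne (h.u_injective F he)
  have hTc' : IsChain (· ≤ ·) (T' : Set (R F)) := by
    intro G hG H hH hne
    rw [hT', Finset.coe_preimage] at hG hH
    simp only [← h.v_le]
    exact hS' hG hH fun he => hne (h.v_injective F he)
  have h1 : ∏ G ∈ S with G ∈ Set.range (u F), res F (x G) = (∏ G ∈ T, xB F G) ⊗ₜ 1 := by
    rw [← Finset.prod_preimage' _ _ huS]
    simp only [h.res_u]
    exact (map_prod (Algebra.TensorProduct.includeLeft : B F →ₐ[ℚ] B F ⊗[ℚ] C F) _ _).symm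
  have h2 : ∏ G ∈ S with G ∈ Set.range (v F), res F (x G) = 1 ⊗ₜ (∏ G ∈ T', xC F G) := by
    rw [← Finset.prod_preimage' _ _ hvS]
    simp only [h.res_v]
    exact (map_prod (Algebra.TensorProduct.includeRight : C F →ₐ[ℚ] B F ⊗[ℚ] C F) _ _).symm
  rw [map_prod, ← Finset.prod_filter_mul_prod_filter_not S (· ∈ Set.range (u F)), hfil, h1, h2,
    Algebra.TensorProduct.tmul_mul_tmul, mul_one, one_mul, tensorDeg_tmul, hB.apply_prod T hTc,
    hC.apply_prod T' hTc']
  have hb := hB.card_le T hTc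
  have hc := hC.card_le T' hTc'
  split_ifs <;> first | omega | norm_num

/-- This is the compatibility needed to glue the degree map. The difference of the two sides is a
linear functional of `a`. It vanishes on the ideal `N` below and on the monomials of chains
compatible with `F` and `G`, where both sides test for the same length. -/
theorem tensorDeg_res_comm (h : IsRestrictionSystem x α xB αB xC αC u v res push)
    (hB : ∀ F, IsFlagDegree (xB F) (nB F) (degB F))
    (hC : ∀ F, IsFlagDegree (xC F) (nC F) (degC F)) (hn : ∀ F, nB F + nC F + 1 = n) (F G : P)
    (a : A) : tensorDeg (degB F) (degC F) (res F (x G * a)) =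
      tensorDeg (degB G) (degC G) (res G (x F * a)) := by
  classical
  by_cases hFG : F = G
  · rw [hFG]
  by_cases hcomp : F ≤ G ∨ G ≤ F
  swap
  · push Not at hcomp
    rw [map_mul (res F), map_mul (res G), h.res_eq_zero F G hcomp.1 hcomp.2,
      h.res_eq_zero G F hcomp.2 hcomp.1, zero_mul, zero_mul, map_zero, map_zero]
  -- The elements that vanish on both sides once multiplied by the other variable and restricted.
  let N : Ideal A := (Ideal.torsionOf _ _ (res F (x G))).comap (res F) ⊓
    (Ideal.torsionOf _ _ (res G (x F))).comap (res G)
  have hN (a : A) : a ∈ N ↔ res F (a * x G) = 0 ∧ res G (a * x F) = 0 := by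
    rw [map_mul, map_mul]
    exact Iff.rfl
  have hd (S : Finset P) (hS : Disjoint S {F, G}) : F ∉ S ∧ G ∉ S := by
    rw [Finset.disjoint_insert_right, Finset.disjoint_singleton_right] at hS
    exact hS
  let f : A →ₗ[ℚ] ℚ := (tensorDeg (degB F) (degC F)) ∘ₗ (res F).toLinearMap ∘ₗ
      LinearMap.mulLeft ℚ (x G) - (tensorDeg (degB G) (degC G)) ∘ₗ (res G).toLinearMap ∘ₗ
      LinearMap.mulLeft ℚ (x F)
  suffices hf : f = 0 from sub_eq_zero.1 (LinearMap.congr_fun hf a)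
  refine eq_zero_of_chains (S₀ := {F, G}) (N := N) h.mul_eq_zero h.adjoin_eq_top ?_ ?_ ?_ ?_ ?_
  · intro H K hK h1 h2
    rw [hN]
    rcases Finset.mem_insert.1 hK with rfl | hK
    · rw [map_mul, h.res_eq_zero K H h2 h1, h.mul_eq_zero H K h1 h2, zero_mul, map_zero]
      exact ⟨rfl, rfl⟩
    · rw [Finset.mem_singleton] at hK
      subst hK
      rw [map_mul (res K), h.res_eq_zero K H h2 h1, h.mul_eq_zero H K h1 h2, zero_mul, map_zero]
      exact ⟨rfl, rfl⟩
  · intro S _ hSc H hH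
    obtain ⟨c, h1, h2, h3, h4⟩ := h.exists_relation _ hSc H hH
    refine ⟨c, h1, h2, ?_⟩
    generalize ∑ K, c K • x K = z at h3 h4
    rcases Finset.mem_union.1 hH with hH | hH
    · rw [← Finset.mul_prod_erase _ _ hH, ← mul_assoc, h3, zero_mul]
      exact zero_mem _
    rw [hN]
    -- When `H` is `F` or `G`, one side vanishes because the relation restricts to zero at `H`, the
    -- other because the additional variable is `x H`, which the relation annihilates.
    rcases Finset.mem_insert.1 hH with rfl | hH
    · rw [mul_assoc, mul_right_comm, h3, zero_mul, map_zero, map_mul, h4, zero_mul]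
      exact ⟨rfl, rfl⟩
    · rw [Finset.mem_singleton] at hH
      subst hH
      rw [mul_right_comm, h3, zero_mul, map_zero, mul_assoc, map_mul, h4, zero_mul]
      exact ⟨rfl, rfl⟩
  · rw [Finset.coe_pair]
    exact hcomp.elim IsChain.pair fun hle => Set.pair_comm F G ▸ IsChain.pair hle
  · intro a ha
    rw [hN] at ha
    change tensorDeg _ _ (res F (x G * a)) - tensorDeg _ _ (res G (x F * a)) = 0
    rw [mul_comm, ha.1, mul_comm, ha.2, map_zero, map_zero, sub_zero]
  · intro S hS hSc
    obtain ⟨hF, hG⟩ := hd S hS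
    change tensorDeg _ _ (res F (x G * _)) - tensorDeg _ _ (res G (x F * _)) = 0
    have hset : ((S ∪ {F, G} : Finset P) : Set P) = insert F ((insert G S : Finset P) : Set P) := by
      ext K
      simp only [Finset.coe_union, Finset.coe_insert, Finset.coe_singleton, Set.mem_union,
        Set.mem_insert_iff, Set.mem_singleton_iff, Finset.mem_coe]
      tauto
    have hset' : ((S ∪ {F, G} : Finset P) : Set P) =
        insert G ((insert F S : Finset P) : Set P) := by
      rw [hset, Finset.coe_insert, Finset.coe_insert, Set.insert_comm]
    rw [← Finset.prod_insert hF, ← Finset.prod_insert hG,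
      h.tensorDeg_res_prod (hB F) (hC F) (by simp [hFG, hF]) (hset ▸ hSc),
      h.tensorDeg_res_prod (hB G) (hC G) (by simp [Ne.symm hFG, hG]) (hset' ▸ hSc),
      Finset.card_insert_of_notMem hF, Finset.card_insert_of_notMem hG]
    have h1 := hn F
    have h2 := hn G
    rw [show nB F + nC F = nB G + nC G by omega, sub_self]

/-- The degree map is glued from the degree maps of the factors of the tensor products. -/
theorem exists_flagDegree (h : IsRestrictionSystem x α xB αB xC αC u v res push)
    (hB : ∀ F, IsFlagDegree (xB F) (nB F) (degB F))
    (hC : ∀ F, IsFlagDegree (xC F) (nC F) (degC F)) (hn : ∀ F, nB F + nC F + 1 = n)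
    (hcard : ∀ S : Finset P, IsChain (· ≤ ·) (S : Set P) → S.card ≤ n)
    {σ : Type*} {π : MvPolynomial σ ℚ →ₐ[ℚ] A} (hπ : Function.Surjective π)
    {gens : Set (MvPolynomial σ ℚ)} (hgens : RingHom.ker π = Ideal.span gens)
    {w : σ → P → ℚ} (hw : ∀ t, π (MvPolynomial.X t) = ∑ F, w t F • x F)
    (hx : ∀ F, ∃ t, w t F = 1 ∧ ∀ G, G ≠ F → w t G = 0)
    (hker : ∀ E : MvPolynomial σ ℚ →ₗ[ℚ] ℚ,
      (∀ t, E (MvPolynomial.X t) = ∑ F, w t F * if nB F = 0 ∧ nC F = 0 then 1 else 0) →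
      (∀ t s, E (MvPolynomial.X t * MvPolynomial.X s) =
        ∑ F, w t F * tensorDeg (degB F) (degC F) (res F (π (MvPolynomial.X s)))) →
      ∀ g ∈ gens, E g = 0) :
    ∃ deg : A →ₗ[ℚ] ℚ, IsFlagDegree x n deg ∧
      ∀ F a, deg (x F * a) = tensorDeg (degB F) (degC F) (res F a) := by
  classical
  let D (t : σ) : MvPolynomial σ ℚ →ₗ[ℚ] ℚ :=
    ∑ F, w t F • ((tensorDeg (degB F) (degC F)) ∘ₗ (res F).toLinearMap ∘ₗ π.toLinearMap)
  have hD (t : σ) (p : MvPolynomial σ ℚ) :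
      D t p = ∑ F, w t F * tensorDeg (degB F) (degC F) (res F (π p)) := by
    simp [D, LinearMap.sum_apply]
  have hDcomm (t s : σ) (p : MvPolynomial σ ℚ) :
      D t (MvPolynomial.X s * p) = D s (MvPolynomial.X t * p) := by
    simp only [hD, map_mul π, hw, Finset.sum_mul, map_sum, smul_mul_assoc, map_smul, smul_eq_mul,
      Finset.mul_sum]
    rw [Finset.sum_comm]
    refine Finset.sum_congr rfl fun F _ => Finset.sum_congr rfl fun G _ => ?_
    rw [h.tensorDeg_res_comm hB hC hn, mul_left_comm]
  obtain ⟨E, hE1, hE⟩ := exists_functional_of_compatible D (if n = 0 then 1 else 0) hDcomm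
  have hEg := hker E (fun t => by
      have h1 := hE t 1
      rw [mul_one, hD] at h1
      refine h1.trans (Finset.sum_congr rfl fun F _ => ?_)
      rw [map_one, map_one, Algebra.TensorProduct.one_def, tensorDeg_tmul, (hB F).apply_one,
        (hC F).apply_one, ite_and, ite_mul, one_mul, zero_mul])
    fun t s => by rw [hE, hD]
  -- As soon as some variable is split off, `E` is computed in `A`, where `g` is zero. Only the
  -- values of `E` at the generators themselves require a check, supplied by `hker`.
  have hEmul (g : MvPolynomial σ ℚ) (hg : g ∈ gens) (p : MvPolynomial σ ℚ) : E (p * g) = 0 := by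
    have hπg : π g = 0 := by
      rw [← RingHom.mem_ker, hgens]
      exact Ideal.subset_span hg
    induction p using MvPolynomial.induction_on with
    | C a => rw [MvPolynomial.C_mul', map_smul, hEg g hg, smul_zero]
    | add p q hp hq => rw [add_mul, map_add, hp, hq, add_zero]
    | mul_X p t _ =>
      rw [mul_comm p, mul_assoc, hE, hD]
      simp [hπg]
  have hEker (p : MvPolynomial σ ℚ) (hp : π p = 0) : E p = 0 := by
    rw [← RingHom.mem_ker, hgens] at hp
    suffices hs : ∀ q, E (q * p) = 0 by simpa using hs 1
    induction hp using Submodule.span_induction with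
    | mem g hg => exact hEmul g hg
    | zero => simp
    | add a b _ _ ha hb => intro q; rw [mul_add, map_add, ha, hb, add_zero]
    | smul r a _ ha => intro q; rw [smul_eq_mul, ← mul_assoc, ha]
  -- Since `E` vanishes on the kernel of `π`, composing with any linear section `g` gives the
  -- induced functional on `A`.
  obtain ⟨g, hg⟩ := π.toLinearMap.exists_rightInverse_of_surjective
    (LinearMap.range_eq_top.2 hπ)
  have hg' (a : A) : π (g a) = a := LinearMap.congr_fun hg a
  have hdeg (p : MvPolynomial σ ℚ) : E (g (π p)) = E p := by
    rw [← sub_eq_zero, ← map_sub]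
    exact hEker _ (by rw [map_sub, hg', sub_self])
  have hmul (F : P) (a : A) : E (g (x F * a)) = tensorDeg (degB F) (degC F) (res F a) := by
    obtain ⟨t, ht, ht'⟩ := hx F
    obtain ⟨p, rfl⟩ := hπ a
    have hxt : π (MvPolynomial.X t) = x F := by
      rw [hw, Finset.sum_eq_single F]
      · rw [ht, one_smul]
      · intro G _ hG
        rw [ht' G hG, zero_smul]
      · exact fun h => absurd (Finset.mem_univ F) h
    rw [← hxt, ← map_mul, hdeg, hE, hD, Finset.sum_eq_single F]
    · rw [ht, one_mul]
    · intro G _ hG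
      rw [ht' G hG, zero_mul]
    · exact fun h => absurd (Finset.mem_univ F) h
  refine ⟨E ∘ₗ g, ⟨hcard, fun S hS => ?_⟩, hmul⟩
  rcases S.eq_empty_or_nonempty with rfl | ⟨F, hF⟩
  · rw [Finset.prod_empty, LinearMap.comp_apply, ← map_one π, hdeg, hE1, Finset.card_empty]
    simp only [eq_comm]
  · rw [← Finset.mul_prod_erase _ _ hF, LinearMap.comp_apply, hmul,
      h.tensorDeg_res_prod (hB F) (hC F) (Finset.notMem_erase F S), Finset.card_erase_of_mem hF]
    · have h1 := hn F
      have h2 := Finset.card_pos.2 ⟨F, hF⟩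
      congr 1
      rw [eq_iff_iff]
      omega
    · rw [← Finset.coe_insert, Finset.insert_erase hF]
      exact hS

/-- Expand one factor `α` as a sum of variables. The term of `F` is `degB F` of a power of `αB F`
times `degC F 1`, and the latter is nonzero only if `nC F = 0`. By `hT0` this happens for a single
`F` of `T`, where `nB F = n - 1`. -/
theorem deg_pow_alpha (h : IsRestrictionSystem x α xB αB xC αC u v res push)
    {deg : A →ₗ[ℚ] ℚ} (hdeg : IsFlagDegree x n deg)
    (hmul : ∀ F a, deg (x F * a) = tensorDeg (degB F) (degC F) (res F a))
    (hC : ∀ F, IsFlagDegree (xC F) (nC F) (degC F)) (hn : ∀ F, nB F + nC F + 1 = n)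
    (hBα : ∀ F k, degB F (αB F ^ k) = if k = nB F then 1 else 0) {T : Finset P}
    (hT : α = ∑ F ∈ T, x F) (hT0 : 0 < n → ∃ F ∈ T, nC F = 0 ∧ ∀ G ∈ T, nC G = 0 → G = F) (k : ℕ) :
    deg (α ^ k) = if k = n then 1 else 0 := by
  cases k with
  | zero => rw [pow_zero, hdeg.apply_one]; simp only [eq_comm]
  | succ k =>
    have hsum : deg (α ^ (k + 1)) =
        ∑ F ∈ T, (if k = nB F then 1 else 0) * (if nC F = 0 then 1 else 0) := by
      rw [pow_succ']
      nth_rw 1 [hT]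
      rw [Finset.sum_mul, map_sum]
      refine Finset.sum_congr rfl fun F _ => ?_
      rw [hmul, map_pow, h.res_alpha, Algebra.TensorProduct.tmul_pow, one_pow, tensorDeg_tmul,
        hBα, (hC F).apply_one]
    rw [hsum]
    by_cases hk : k + 1 = n
    · obtain ⟨F, hF, hF0, hF'⟩ := hT0 (by omega)
      have := hn F
      rw [if_pos hk, Finset.sum_eq_single F, if_pos hF0, if_pos (by omega), one_mul]
      · intro G hG hGF
        rw [if_neg (c := nC G = 0) fun h0 => hGF (hF' G hG h0), mul_zero]
      · exact fun h => absurd hF h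
    · rw [if_neg hk]
      refine Finset.sum_eq_zero fun F _ => ?_
      have := hn F
      split_ifs <;> first | omega | simp

open Classical in
theorem isPushforwardSystem (h : IsRestrictionSystem x α xB αB xC αC u v res push)
    {deg : A →ₗ[ℚ] ℚ} (hdeg : ∀ k, deg (α ^ k) = if k = n then 1 else 0)
    (hmul : ∀ F a, deg (x F * a) = tensorDeg (degB F) (degC F) (res F a))
    (hB : ∀ F, IsNondegenerate (degB F)) (hC : ∀ F, IsNondegenerate (degC F)) {e : P → ℕ}
    (hpow : ∀ F, (α - ∑ G with F ≤ G, x G) ^ e F = 0) (hα : α ^ (n + 1) = 0)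
    {J : ∀ F, Submodule ℚ (C F)} (hJ : ∀ F, ∀ j ∈ J F, degC F j = 0)
    (hJ' : ∀ F k, k + 1 < e F → αC F ^ k ∈ J F)
    (hJ'' : ∀ F, J F ≤ Subalgebra.toSubmodule (Algebra.adjoin ℚ {αC F})) :
    IsPushforwardSystem x α n e deg degB degC αC J res push where
  mul_eq_zero := h.mul_eq_zero
  adjoin_eq_top := h.adjoin_eq_top
  pow_eq_zero := hpow
  alpha_pow := hα
  deg_alpha := hdeg
  res_surjective := h.res_surjective
  push_res := h.push_res
  deg_mul := hmul
  res_x F K hFK := by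
    rw [← Set.mem_Ioi, ← h.range_u] at hFK
    obtain ⟨G, rfl⟩ := hFK
    exact ⟨_, h.res_u F G⟩
  res_alpha F := ⟨_, h.res_alpha F⟩
  exists_res_eq := h.exists_res_left
  res_gamma := h.res_gamma
  nondegenerate_left := hB
  nondegenerate_right := hC
  deg_eq_zero := hJ
  pow_mem := hJ'
  le_adjoin := hJ''

end IsRestrictionSystem

end Restriction

/-! ### Variables on the star of an element of a poset -/

section Star

variable {P Q R : Type*} [PartialOrder P] [PartialOrder Q] [PartialOrder R]

/-- The posets `Q` and `R` are the parts of `P` above and below `F`. -/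
structure IsStar (F : P) (u : Q → P) (v : R → P) : Prop where
  u_le : ∀ G H, u G ≤ u H ↔ G ≤ H
  v_le : ∀ G H, v G ≤ v H ↔ G ≤ H
  range_u : Set.range u = Set.Ioi F
  range_v : Set.range v = Set.Iio F

open Classical in
/-- The function on `P` given by `a` above `F`, by `b` below `F`, by `z` at `F`, and zero at the
elements incomparable to `F`. -/
noncomputable def starVar {T : Type*} [Zero T] (F : P) (u : Q → P) (v : R → P) (a : Q → T)
    (b : R → T) (z : T) : P → T :=
  Function.extend u a (Function.extend v b fun G => if G = F then z else 0)

namespace IsStar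

variable {F : P} {u : Q → P} {v : R → P}

theorem u_injective (h : IsStar F u v) : Function.Injective u := fun G H hGH =>
  le_antisymm ((h.u_le G H).1 hGH.le) ((h.u_le H G).1 hGH.ge)

theorem v_injective (h : IsStar F u v) : Function.Injective v := fun G H hGH =>
  le_antisymm ((h.v_le G H).1 hGH.le) ((h.v_le H G).1 hGH.ge)

theorem lt_u (h : IsStar F u v) (G : Q) : F < u G := by
  rw [← Set.mem_Ioi, ← h.range_u]
  exact ⟨G, rfl⟩

theorem v_lt (h : IsStar F u v) (G : R) : v G < F := by
  rw [← Set.mem_Iio, ← h.range_v]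
  exact ⟨G, rfl⟩

section

variable {T : Type*} [Zero T] {a : Q → T} {b : R → T} {z : T}

theorem starVar_u (h : IsStar F u v)
    (G : Q) : starVar F u v a b z (u G) = a G := h.u_injective.extend_apply _ _ _

open Classical in
theorem starVar_of_not_lt (h : IsStar F u v) {G : P} (hG : ¬ F < G) :
    starVar F u v a b z G = Function.extend v b (fun G => if G = F then z else 0) G :=
  Function.extend_apply' _ _ _ fun ⟨K, hK⟩ => hG (lt_of_lt_of_eq (h.lt_u K) hK)

theorem starVar_v (h : IsStar F u v) (G : R) : starVar F u v a b z (v G) = b G := by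
  rw [h.starVar_of_not_lt (h.v_lt G).not_gt]
  exact h.v_injective.extend_apply _ _ _

theorem starVar_self (h : IsStar F u v) : starVar F u v a b z F = z := by
  rw [h.starVar_of_not_lt (lt_irrefl F), Function.extend_apply', if_pos rfl]
  exact fun ⟨K, hK⟩ => (h.v_lt K).ne hK

theorem starVar_eq_zero (h : IsStar F u v)
    {G : P} (h1 : ¬ F ≤ G) (h2 : ¬ G ≤ F) : starVar F u v a b z G = 0 := by
  rw [h.starVar_of_not_lt fun h' => h1 h'.le, Function.extend_apply',
    if_neg fun he => h1 he.ge]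
  exact fun ⟨K, hK⟩ => h2 (hK ▸ (h.v_lt K).le)

end

theorem cases (h : IsStar F u v)
    (G : P) : (∃ K, u K = G) ∨ (∃ K, v K = G) ∨ G = F ∨ (¬ F ≤ G ∧ ¬ G ≤ F) := by
  by_cases h1 : F < G
  · left
    rw [← Set.mem_Ioi, ← h.range_u] at h1
    exact h1
  by_cases h2 : G < F
  · right; left
    rw [← Set.mem_Iio, ← h.range_v] at h2
    exact h2
  by_cases h3 : G = F
  · exact Or.inr (Or.inr (Or.inl h3))
  · exact Or.inr (Or.inr (Or.inr ⟨fun h => h1 (lt_of_le_of_ne h (Ne.symm h3)),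
      fun h => h2 (lt_of_le_of_ne h h3)⟩))

/-- Products of incomparable variables vanish on the star. -/
theorem starVar_mul_starVar (h : IsStar F u v)
    {T : Type*} [MulZeroClass T] {a : Q → T} {b : R → T} {z : T}
    (ha : ∀ G H, ¬ G ≤ H → ¬ H ≤ G → a G * a H = 0)
    (hb : ∀ G H, ¬ G ≤ H → ¬ H ≤ G → b G * b H = 0) {G H : P} (h1 : ¬ G ≤ H) (h2 : ¬ H ≤ G) :
    starVar F u v a b z G * starVar F u v a b z H = 0 := by
  rcases h.cases G with ⟨K, rfl⟩ | ⟨K, rfl⟩ | rfl | ⟨h3, h4⟩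
  · rcases h.cases H with ⟨L, rfl⟩ | ⟨L, rfl⟩ | rfl | ⟨h5, h6⟩
    · rw [h.starVar_u, h.starVar_u]
      exact ha K L ((h.u_le K L).not.1 h1) ((h.u_le L K).not.1 h2)
    · exact absurd ((h.v_lt L).le.trans (h.lt_u K).le) h2
    · exact absurd (h.lt_u K).le h2
    · rw [h.starVar_eq_zero h5 h6, mul_zero]
  · rcases h.cases H with ⟨L, rfl⟩ | ⟨L, rfl⟩ | rfl | ⟨h5, h6⟩
    · exact absurd ((h.v_lt K).le.trans (h.lt_u L).le) h1
    · rw [h.starVar_v, h.starVar_v]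
      exact hb K L ((h.v_le K L).not.1 h1) ((h.v_le L K).not.1 h2)
    · exact absurd (h.v_lt K).le h1
    · rw [h.starVar_eq_zero h5 h6, mul_zero]
  · rw [h.starVar_eq_zero h1 h2, mul_zero]
  · rw [h.starVar_eq_zero h3 h4, zero_mul]

variable [Fintype P] [Fintype Q] [Fintype R]

theorem sum_eq (h : IsStar F u v) {T : Type*} [AddCommMonoid T] {g : P → T}
    (hg : ∀ G, ¬ F ≤ G → ¬ G ≤ F → g G = 0) :
    ∑ G, g G = ∑ G, g (u G) + ∑ G, g (v G) + g F := by
  classical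
  have h1 : ∑ G, g (u G) = ∑ G with F < G, g G := by
    refine (Finset.sum_image (f := g) (s := Finset.univ) h.u_injective.injOn).symm.trans
      (Finset.sum_congr ?_ fun _ _ => rfl)
    ext G
    simpa using Set.ext_iff.1 h.range_u G
  have h2 : ∑ G, g (v G) = ∑ G with G < F, g G := by
    refine (Finset.sum_image (f := g) (s := Finset.univ) h.v_injective.injOn).symm.trans
      (Finset.sum_congr ?_ fun _ _ => rfl)
    ext G
    simpa using Set.ext_iff.1 h.range_v G
  rw [h1, h2, Finset.sum_filter, Finset.sum_filter,
    ← Fintype.sum_ite_eq' F g, ← Finset.sum_add_distrib, ← Finset.sum_add_distrib]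
  refine Finset.sum_congr rfl fun G _ => ?_
  by_cases h1 : F < G
  · simp [h1, h1.not_gt, h1.ne']
  by_cases h2 : G < F
  · simp [h2, h2.not_gt, h2.ne]
  by_cases h3 : G = F
  · simp [h3]
  · simp only [h1, h2, h3, if_false, add_zero]
    exact hg G (fun h => h1 (lt_of_le_of_ne h (Ne.symm h3))) fun h => h2 (lt_of_le_of_ne h h3)

theorem sum_filter_starVar (h : IsStar F u v)
    {T : Type*} [AddCommMonoid T] (a : Q → T) (b : R → T) (z : T)
    (p : P → Prop) [DecidablePred p] :
    ∑ G with p G, starVar F u v a b z G =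
      ∑ G with p (u G), a G + ∑ G with p (v G), b G + if p F then z else 0 := by
  rw [Finset.sum_filter, h.sum_eq, Finset.sum_filter, Finset.sum_filter]
  · simp only [h.starVar_u, h.starVar_v, h.starVar_self]
  · intro G h1 h2
    rw [h.starVar_eq_zero h1 h2, ite_self]

end IsStar

/-- In a chain of subsets of `E`, a member `f H` that is a proper subset of `E` omits an element
common to all larger members. -/
theorem exists_mem_of_isChain {α : Type*} {f : P → Set α} (hf : ∀ F G, F ≤ G ↔ f F ⊆ f G)
    {S : Finset P} (hS : IsChain (· ≤ ·) (S : Set P)) {E : Set α} (hE : ∀ K ∈ S, f K ⊆ E) {H : P}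
    (hH : ∃ j ∈ E, j ∉ f H) : ∃ j ∈ E, j ∉ f H ∧ ∀ K ∈ S, H < K → j ∈ f K := by
  classical
  rcases (S.filter (H < ·)).eq_empty_or_nonempty with he | hne
  · obtain ⟨j, hjE, hj⟩ := hH
    refine ⟨j, hjE, hj, fun K hK hHK => ?_⟩
    have : K ∈ S.filter (H < ·) := Finset.mem_filter.2 ⟨hK, hHK⟩
    rw [he] at this
    exact absurd this (Finset.notMem_empty K)
  · obtain ⟨L, hL⟩ := Finset.exists_minimal hne
    -- Any element of the next larger member `L` that is missing from `f H` will do.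
    obtain ⟨hLS, hHL⟩ := Finset.mem_filter.1 hL.prop
    obtain ⟨j, hjL, hjH⟩ := Set.not_subset.1 ((hf L H).not.1 hHL.not_ge)
    refine ⟨j, hE L hLS hjL, hjH, fun K hK hHK => ?_⟩
    have hLK : L ≤ K := by
      rcases eq_or_ne L K with he | hne
      · exact he.le
      rcases hS hLS hK hne with hle | hle
      · exact hle
      · exact hL.le_of_le (Finset.mem_filter.2 ⟨hK, hHK⟩) hle
    exact (hf L K).1 hLK hjL

end Star

/-! ### The stars of flats -/

section Flats

variable {α : Type*} {M : Matroid α}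

theorem NPFlat.isStar (F : NPFlat M) : IsStar F F.ofContract F.ofRestrict where
  u_le G H := by
    refine ⟨fun h a ha => ?_, fun h => Set.union_subset_union_left _ h⟩
    exact (h (Or.inl ha)).resolve_right
      (Set.disjoint_left.1 (disjoint_of_isFlat_contract G.2.1) ha)
  v_le _ _ := Iff.rfl
  range_u := by
    ext H
    refine ⟨?_, fun h => ?_⟩
    · rintro ⟨G, rfl⟩
      obtain ⟨a, ha⟩ := G.2.2.1
      refine ⟨Set.subset_union_right, fun h => ?_⟩
      exact Set.disjoint_left.1 (disjoint_of_isFlat_contract G.2.1) ha (h (Or.inl ha))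
    · have hle : F.1 ⊆ H.1 := h.le
      obtain ⟨i, hi, hiF⟩ := Set.not_subset.1 h.not_ge
      refine ⟨⟨H.1 \ F.1, isFlat_contract_of_subset H.2.1 hle, ⟨i, hi, hiF⟩, fun he => ?_⟩,
        Subtype.ext (Set.sdiff_union_of_subset hle)⟩
      refine H.2.2.2 ?_
      rw [← Set.sdiff_union_of_subset hle, he, Matroid.contract_ground,
        Set.sdiff_union_of_subset F.2.1.subset_ground]
  range_v := by
    ext H
    refine ⟨?_, fun h => ?_⟩
    · rintro ⟨G, rfl⟩
      exact ⟨G.2.1.subset_ground, fun h => G.2.2.2 (Set.Subset.antisymm G.2.1.subset_ground h)⟩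
    · have hle : H.1 ⊆ F.1 := h.le
      exact ⟨⟨H.1, isFlat_restrict_of_subset F.2.1 H.2.1 hle, H.2.2.1,
        fun he => h.not_ge he.ge⟩, rfl⟩

theorem PFlat.isStar (F : PFlat M) : IsStar F F.ofContract F.ofRestrict where
  u_le G H := by
    refine ⟨fun h a ha => ?_, fun h => Set.union_subset_union_left _ h⟩
    exact (h (Or.inl ha)).resolve_right
      (Set.disjoint_left.1 (disjoint_of_isFlat_contract G.2.1) ha)
  v_le _ _ := Iff.rfl
  range_u := by
    ext H
    refine ⟨?_, fun h => ?_⟩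
    · rintro ⟨G, rfl⟩
      obtain ⟨a, ha⟩ := G.2.2.1
      refine ⟨Set.subset_union_right, fun h => ?_⟩
      exact Set.disjoint_left.1 (disjoint_of_isFlat_contract G.2.1) ha (h (Or.inl ha))
    · have hle : F.1 ⊆ H.1 := h.le
      obtain ⟨i, hi, hiF⟩ := Set.not_subset.1 h.not_ge
      refine ⟨⟨H.1 \ F.1, isFlat_contract_of_subset H.2.1 hle, ⟨i, hi, hiF⟩, fun he => ?_⟩,
        Subtype.ext (Set.sdiff_union_of_subset hle)⟩
      refine H.2.2 ?_
      rw [← Set.sdiff_union_of_subset hle, he, Matroid.contract_ground,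
        Set.sdiff_union_of_subset F.2.1.subset_ground]
  range_v := by
    ext H
    refine ⟨?_, fun h => ?_⟩
    · rintro ⟨G, rfl⟩
      exact ⟨G.2.1.subset_ground, fun h => G.2.2 (Set.Subset.antisymm G.2.1.subset_ground h)⟩
    · have hle : H.1 ⊆ F.1 := h.le
      exact ⟨⟨H.1, isFlat_restrict_of_subset F.2.1 H.2.1 hle,
        fun he => h.not_ge he.ge⟩, rfl⟩

theorem exists_mem_ground_notMem {F : Set α} (hF : M.IsFlat F) (h : F ≠ M.E) :
    ∃ j ∈ M.E, j ∉ F :=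
  Set.exists_of_ssubset (hF.subset_ground.ssubset_of_ne h)

end Flats

/-! ### Pushforward after restriction is multiplication by `x F`. -/

section Adjoin

variable {A : Type*} [CommRing A] [Algebra ℚ A]

theorem adjoin_eq_top_of_surjective {σ : Type*} {π : MvPolynomial σ ℚ →ₐ[ℚ] A}
    (hπ : Function.Surjective π) {s : Set A}
    (h : ∀ t, π (MvPolynomial.X t) ∈ Algebra.adjoin ℚ s) : Algebra.adjoin ℚ s = ⊤ := by
  rw [eq_top_iff]
  rintro a -
  obtain ⟨p, rfl⟩ := hπ a
  induction p using MvPolynomial.induction_on with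
  | C r =>
    rw [show (MvPolynomial.C r : MvPolynomial σ ℚ) = algebraMap ℚ _ r from rfl, AlgHom.commutes]
    exact Subalgebra.algebraMap_mem _ r
  | add p q hp hq => rw [map_add]; exact add_mem hp hq
  | mul_X p t hp => rw [map_mul]; exact mul_mem hp (h t)

open scoped Classical in
/-- The composition of the restriction and pushforward maps is multiplication by `x F`. -/
theorem mulQuot_productMap_res {P Q R B C : Type*} [PartialOrder P] [PartialOrder Q]
    [PartialOrder R] [CommRing B] [Algebra ℚ B] [CommRing C] [Algebra ℚ C] {x : P → A}
    (hx : Algebra.adjoin ℚ (Set.range x) = ⊤)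
    (hinc : ∀ F G, ¬ F ≤ G → ¬ G ≤ F → x F * x G = 0) {F : P} {u : Q → P} {v : R → P}
    (h : IsStar F u v) {f : B →ₐ[ℚ] A ⧸ Ideal.torsionOf A A (x F)}
    {g : C →ₐ[ℚ] A ⧸ Ideal.torsionOf A A (x F)} {res : A →ₐ[ℚ] B ⊗[ℚ] C} {xB : Q → B} {xC : R → C}
    {z : B ⊗[ℚ] C}
    (hres : ∀ G, res (x G) = starVar F u v (fun K => xB K ⊗ₜ 1) (fun K => 1 ⊗ₜ xC K) z G)
    (hf : ∀ K, f (xB K) = Ideal.Quotient.mk _ (x (u K)))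
    (hg : ∀ K, g (xC K) = Ideal.Quotient.mk _ (x (v K)))
    {T : Finset P} (hT : F ∈ T) {α : A} (hα : α = ∑ G ∈ T, x G) {αB : B} (hres' : res α = αB ⊗ₜ 1)
    (hfα : f αB = Ideal.Quotient.mk _ α) (a : A) :
    (mulQuot (x F) ∘ₗ (Algebra.TensorProduct.productMap f g).toLinearMap) (res a) = x F * a := by
  have hφ : (Algebra.TensorProduct.productMap f g).comp res = Ideal.Quotient.mkₐ ℚ _ := by
    set φ := (Algebra.TensorProduct.productMap f g).comp res with hφ
    have hne (G : P) (hG : G ≠ F) : φ (x G) = Ideal.Quotient.mk _ (x G) := by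
      rw [hφ, AlgHom.comp_apply, hres]
      rcases h.cases G with ⟨K, rfl⟩ | ⟨K, rfl⟩ | h' | ⟨h1, h2⟩
      · rw [h.starVar_u, Algebra.TensorProduct.productMap_apply_tmul, map_one, mul_one, hf]
      · rw [h.starVar_v, Algebra.TensorProduct.productMap_apply_tmul, map_one, one_mul, hg]
      · exact absurd h' hG
      · rw [h.starVar_eq_zero h1 h2, map_zero, mk_torsionOf_eq_zero (hinc _ _ h2 h1)]
    -- The image of `x F` need not be computed: `φ` is known on `α` and on all other terms of the
    -- sum for `α`, so the term of `F` follows by cancellation.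
    have hF : φ (x F) = Ideal.Quotient.mk _ (x F) := by
      have hφα : φ α = Ideal.Quotient.mk _ α := by
        rw [hφ, AlgHom.comp_apply, hres', Algebra.TensorProduct.productMap_apply_tmul, map_one,
          mul_one, hfα]
      rw [hα, ← Finset.add_sum_erase _ _ hT, map_add, map_add, map_sum, map_sum,
        Finset.sum_congr rfl fun G hG => hne G (Finset.ne_of_mem_erase hG)] at hφα
      exact add_right_cancel hφα
    refine AlgHom.ext_of_adjoin_eq_top hx ?_
    rintro _ ⟨G, rfl⟩
    by_cases hG : G = F
    · rw [hG]
      exact hF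
    · exact hne G hG
  have ha := AlgHom.congr_fun hφ a
  rw [AlgHom.comp_apply] at ha
  rw [LinearMap.comp_apply, AlgHom.toLinearMap_apply, ha]
  exact mul_comm a (x F)

end Adjoin

/-! ### Restriction maps of the Chow ring. -/

section Chow

variable {α : Type*} [Finite α] {M : Matroid α}

namespace Chow

theorem adjoin_x : Algebra.adjoin ℚ (Set.range (Chow.x M)) = ⊤ :=
  adjoin_eq_top_of_surjective (π := Ideal.Quotient.mkₐ ℚ (chowIdeal M))
    (Ideal.Quotient.mkₐ_surjective _ _) fun F => Algebra.subset_adjoin ⟨F, rfl⟩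

/-- The image of `x_F` under the restriction to `M ／ F` and `M ↾ F`. -/
noncomputable def selfVar (F : NPFlat M) : Chow (M ／ F.1) ⊗[ℚ] Chow (M ↾ F.1) :=
  -(1 ⊗ₜ Chow.alpha (M ↾ F.1)) - (∑ G, Chow.x (M ／ F.1) G - Chow.alpha (M ／ F.1)) ⊗ₜ 1

/-- The images of the variables under the restriction to `M ／ F` and `M ↾ F`. -/
noncomputable def resVar (F : NPFlat M) : NPFlat M → Chow (M ／ F.1) ⊗[ℚ] Chow (M ↾ F.1) :=
  starVar F F.ofContract F.ofRestrict (fun G => Chow.x _ G ⊗ₜ 1) (fun G => 1 ⊗ₜ Chow.x _ G)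
    (selfVar F)

open Classical in
-- The choice of `selfVar` makes this sum independent of `i`. For `i` in `F` all flats above `F`
-- contribute, and `selfVar` corrects their sum and removes the α of the localization. For `i`
-- outside `F` only flats above `F` that contain `i` appear.
theorem sum_resVar (F : NPFlat M) {i : α} (hi : i ∈ M.E) :
    ∑ G : NPFlat M with i ∈ G.1, resVar F G = Chow.alpha (M ／ F.1) ⊗ₜ 1 := by
  rw [resVar, F.isStar.sum_filter_starVar]
  rw [← TensorProduct.sum_tmul, ← TensorProduct.tmul_sum]
  by_cases hiF : i ∈ F.1
  · have h1 : (Finset.univ.filter fun G : NPFlat (M ／ F.1) => i ∈ (F.ofContract G).1) = .univ :=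
      Finset.filter_true_of_mem fun G _ => Or.inr hiF
    have h2 := Chow.alpha_eq (M := M ↾ F.1) hiF
    rw [if_pos hiF, h1, selfVar, h2, TensorProduct.sub_tmul]
    change _ + 1 ⊗ₜ[ℚ] (∑ G : NPFlat (M ↾ F.1) with i ∈ G.1, Chow.x _ G) + _ = _
    abel
  · have h1 : (Finset.univ.filter fun G : NPFlat (M ↾ F.1) => i ∈ (F.ofRestrict G).1) = ∅ :=
      Finset.filter_false_of_mem fun G _ h => hiF (G.2.1.subset_ground h)
    rw [if_neg hiF, add_zero, h1, Finset.sum_empty, TensorProduct.tmul_zero, add_zero,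
      Chow.alpha_eq (M := M ／ F.1) ⟨hi, hiF⟩]
    congr 1
    refine Finset.sum_congr (Finset.filter_congr fun G _ => ?_) fun _ _ => rfl
    exact ⟨fun h => h.resolve_right hiF, Or.inl⟩

/-- The restriction map to `M ／ F` and `M ↾ F`. -/
noncomputable def resHom (F : NPFlat M) :
    Chow M →ₐ[ℚ] Chow (M ／ F.1) ⊗[ℚ] Chow (M ↾ F.1) :=
  Ideal.Quotient.liftₐ (chowIdeal M) (MvPolynomial.aeval (resVar F)) <| by
    classical
    intro a ha
    rw [← RingHom.mem_ker]
    revert a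
    change chowIdeal _ ≤ _
    refine sup_le (Ideal.span_le.2 ?_) (Ideal.span_le.2 ?_)
    · rintro _ ⟨i, hi, j, hj, -, rfl⟩
      rw [SetLike.mem_coe, RingHom.mem_ker, map_sub, linForm, linForm, map_sum, map_sum]
      simp only [MvPolynomial.aeval_X]
      rw [sum_resVar F hi, sum_resVar F hj, sub_self]
    · rintro _ ⟨G, H, hGH, hHG, rfl⟩
      rw [SetLike.mem_coe, RingHom.mem_ker, map_mul, MvPolynomial.aeval_X, MvPolynomial.aeval_X,
        resVar]
      refine F.isStar.starVar_mul_starVar (T := Chow (M ／ F.1) ⊗[ℚ] Chow (M ↾ F.1))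
        (fun K L h1 h2 => ?_) (fun K L h1 h2 => ?_) hGH hHG
      · rw [Algebra.TensorProduct.tmul_mul_tmul, Chow.x_mul_x h1 h2, TensorProduct.zero_tmul]
      · rw [Algebra.TensorProduct.tmul_mul_tmul, Chow.x_mul_x h1 h2, TensorProduct.tmul_zero]

theorem resHom_x (F G : NPFlat M) : resHom F (Chow.x M G) = resVar F G :=
  MvPolynomial.aeval_X _ _

theorem resHom_alpha (F : NPFlat M) :
    resHom F (Chow.alpha M) = Chow.alpha (M ／ F.1) ⊗ₜ 1 := by
  classical
  obtain ⟨i, hi⟩ := F.2.2.1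
  have hiE := F.2.1.subset_ground hi
  rw [Chow.alpha_eq hiE, map_sum, ← sum_resVar F hiE]
  simp only [resHom_x]

open Classical in
-- Only flats above `F` and `F` itself are subtracted. They cancel `α ⊗ 1` and leave the
-- localization's α from `selfVar`.
theorem resHom_gamma (F : NPFlat M) :
    resHom F (Chow.alpha M - ∑ G with F ≤ G, Chow.x M G) = 1 ⊗ₜ Chow.alpha (M ↾ F.1) := by
  rw [map_sub, resHom_alpha, map_sum]
  simp only [resHom_x]
  rw [resVar, F.isStar.sum_filter_starVar, if_pos le_rfl,
    Finset.filter_true_of_mem (fun G _ => (F.isStar.lt_u G).le),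
    Finset.filter_false_of_mem (fun G _ => (F.isStar.v_lt G).not_ge), Finset.sum_empty,
    ← TensorProduct.sum_tmul, selfVar, TensorProduct.sub_tmul]
  abel

theorem contractHom_x (F : NPFlat M) (G : NPFlat (M ／ F.1)) :
    contractHom F (Chow.x _ G) = Ideal.Quotient.mk _ (Chow.x M (F.ofContract G)) :=
  MvPolynomial.aeval_X _ _

theorem restrictHom_x (F : NPFlat M) (G : NPFlat (M ↾ F.1)) :
    restrictHom F (Chow.x _ G) = Ideal.Quotient.mk _ (Chow.x M (F.ofRestrict G)) :=
  MvPolynomial.aeval_X _ _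

theorem contractHom_alpha (F : NPFlat M) :
    contractHom F (Chow.alpha (M ／ F.1)) = Ideal.Quotient.mk _ (Chow.alpha M) := by
  classical
  obtain ⟨i, hi, hiF⟩ := exists_mem_ground_notMem F.2.1 F.2.2.2
  rw [Chow.alpha_eq (M := M ／ F.1) ⟨hi, hiF⟩, map_sum]
  simp only [contractHom_x]
  rw [← map_sum, ← sub_eq_zero, ← map_sub]
  refine mk_torsionOf_eq_zero ?_
  rw [sub_mul, Chow.sum_ofContract F hi hiF, sub_self]

theorem push_resHom (F : NPFlat M) (a : Chow M) : push F (resHom F a) = Chow.x M F * a := by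
  classical
  obtain ⟨i, hi⟩ := F.2.2.1
  exact mulQuot_productMap_res adjoin_x (fun _ _ h1 h2 => Chow.x_mul_x h1 h2) F.isStar (resHom_x F)
    (contractHom_x F) (restrictHom_x F) (Finset.mem_filter.2 ⟨Finset.mem_univ F, hi⟩)
    (Chow.alpha_eq (F.2.1.subset_ground hi)) (resHom_alpha F) (contractHom_alpha F) a

variable (M) in
theorem isRestrictionSystem : IsRestrictionSystem (Chow.x M) (Chow.alpha M)
    (fun F : NPFlat M => Chow.x (M ／ F.1)) (fun F => Chow.alpha (M ／ F.1))
    (fun F => Chow.x (M ↾ F.1)) (fun F => Chow.alpha (M ↾ F.1))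
    NPFlat.ofContract NPFlat.ofRestrict resHom push where
  mul_eq_zero _ _ h1 h2 := Chow.x_mul_x h1 h2
  adjoin_eq_top := adjoin_x
  adjoin_left _ := adjoin_x
  adjoin_right _ := adjoin_x
  u_le F := F.isStar.u_le
  v_le F := F.isStar.v_le
  range_u F := F.isStar.range_u
  range_v F := F.isStar.range_v
  res_u F G := (resHom_x F _).trans (F.isStar.starVar_u G)
  res_v F G := (resHom_x F _).trans (F.isStar.starVar_v G)
  res_eq_zero F G h1 h2 := (resHom_x F _).trans (F.isStar.starVar_eq_zero h1 h2)
  push_res := push_resHom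
  res_alpha := resHom_alpha
  res_gamma := resHom_gamma
  exists_relation S hS H hH := by
    classical
    obtain ⟨j, hjE, hjH, hj⟩ := exists_mem_of_isChain (f := fun F : NPFlat M => F.1)
      (fun _ _ => Iff.rfl) hS (fun K _ => K.2.1.subset_ground)
      (exists_mem_ground_notMem H.2.1 H.2.2.2)
    -- The relation is the linear form of some `i` minus that of `j`. With `i` in the smallest
    -- member of the chain, the coefficient at a member is `1` if it omits `j` and `0` otherwise, so
    -- it vanishes at all members larger than `H`.
    obtain ⟨L, hL⟩ := Finset.exists_minimal (s := S) ⟨H, hH⟩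
    have hLS (K : NPFlat M) (hK : K ∈ S) : L ≤ K := by
      rcases eq_or_ne L K with he | hne
      · exact he.le
      rcases hS hL.prop hK hne with hle | hle
      · exact hle
      · exact hL.le_of_le hK hle
    obtain ⟨i, hi⟩ := L.2.2.1
    have hzero : ∑ K : NPFlat M, ((if i ∈ K.1 then 1 else 0) - if j ∈ K.1 then 1 else 0 : ℚ) •
        Chow.x M K = 0 := by
      simp only [sub_smul, ite_smul, one_smul, zero_smul, Finset.sum_sub_distrib,
        ← Finset.sum_filter]
      rw [Chow.sum_eq_sum (L.2.1.subset_ground hi) hjE, sub_self]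
    refine ⟨fun K => (if i ∈ K.1 then 1 else 0) - if j ∈ K.1 then 1 else 0, ?_, ?_, ?_, ?_⟩
    · simp only [if_pos (hLS H hH hi), if_neg hjH, sub_zero]
    · intro K hK hne hc
      simp only [if_pos (hLS K hK hi)] at hc
      have hjK : j ∉ K.1 := fun h => hc (by rw [if_pos h, sub_self])
      rcases hS hK hH hne with hle | hle
      · exact lt_of_le_of_ne hle hne
      · exact absurd (hj K hK (lt_of_le_of_ne hle hne.symm)) hjK
    · rw [hzero, zero_mul]
    · rw [hzero, map_zero]

end Chow

end Chow

/-! ### Restriction maps of the augmented Chow ring. -/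

section AugChow

variable {α : Type*} [Finite α] {M : Matroid α}

namespace AugChow

theorem x_mem_span (F : PFlat M) : AugChow.x M F ∈ Submodule.span ℚ (Set.range (AugChow.x M)) :=
  Submodule.subset_span ⟨F, rfl⟩

theorem y_mem_span (i : M.E) : AugChow.y M i ∈ Submodule.span ℚ (Set.range (AugChow.x M)) := by
  classical
  rw [AugChow.y_eq]
  exact sum_mem fun F _ => x_mem_span F

theorem adjoin_x : Algebra.adjoin ℚ (Set.range (AugChow.x M)) = ⊤ := by
  refine adjoin_eq_top_of_surjective (π := Ideal.Quotient.mkₐ ℚ (augIdeal M))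
    (Ideal.Quotient.mkₐ_surjective _ _) ?_
  rintro (i | F)
  · exact Algebra.span_le_adjoin ℚ _ (y_mem_span i)
  · exact Algebra.subset_adjoin ⟨F, rfl⟩

/-- The image of `x_F` under the restriction to `M ／ F` and `M ↾ F`. -/
noncomputable def selfVar (F : PFlat M) : Chow (M ／ F.1) ⊗[ℚ] AugChow (M ↾ F.1) :=
  -(1 ⊗ₜ AugChow.alpha (M ↾ F.1)) - (∑ G, Chow.x (M ／ F.1) G - Chow.alpha (M ／ F.1)) ⊗ₜ 1

/-- The images of the variables `x_G` under the restriction to `M ／ F` and `M ↾ F`. -/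
noncomputable def resVar (F : PFlat M) : PFlat M → Chow (M ／ F.1) ⊗[ℚ] AugChow (M ↾ F.1) :=
  starVar F F.ofContract F.ofRestrict (fun G => Chow.x _ G ⊗ₜ 1) (fun G => 1 ⊗ₜ AugChow.x _ G)
    (selfVar F)

open Classical in
/-- The images of the variables `y_i` under the restriction to `M ／ F` and `M ↾ F`. -/
noncomputable def resY (F : PFlat M) (i : M.E) : Chow (M ／ F.1) ⊗[ℚ] AugChow (M ↾ F.1) :=
  if h : i.1 ∈ (M ↾ F.1).E then 1 ⊗ₜ AugChow.y (M ↾ F.1) ⟨i.1, h⟩ else 0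

open Classical in
-- If `i` is in `F`, only flats below `F` can omit it, and they give the `y_i` of the localization.
-- Otherwise `F` and all flats below it omit `i`, and `selfVar` cancels their sum together with that
-- of the flats above `F` omitting `i`.
theorem sum_resVar_compl (F : PFlat M) (i : M.E) :
    ∑ G : PFlat M with i.1 ∉ G.1, resVar F G = resY F i := by
  rw [resVar, F.isStar.sum_filter_starVar, ← TensorProduct.sum_tmul, ← TensorProduct.tmul_sum, resY]
  by_cases hiF : i.1 ∈ F.1
  · have h1 : (Finset.univ.filter fun G : NPFlat (M ／ F.1) => i.1 ∉ (F.ofContract G).1) = ∅ :=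
      Finset.filter_false_of_mem fun G _ h => h (Or.inr hiF)
    rw [if_neg (not_not.2 hiF), dif_pos (c := i.1 ∈ (M ↾ F.1).E) hiF, h1,
      Finset.sum_empty, TensorProduct.zero_tmul, zero_add, add_zero, AugChow.y_eq]
    rfl
  · have h1 : (Finset.univ.filter fun G : PFlat (M ↾ F.1) => i.1 ∉ (F.ofRestrict G).1) = .univ :=
      Finset.filter_true_of_mem fun G _ h => hiF (G.2.1.subset_ground h)
    have h2 := Chow.alpha_eq (M := M ／ F.1) ⟨i.2, hiF⟩
    have h3 : (Finset.univ.filter fun G : NPFlat (M ／ F.1) => i.1 ∉ (F.ofContract G).1) =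
        Finset.univ.filter fun G : NPFlat (M ／ F.1) => i.1 ∉ G.1 :=
      Finset.filter_congr fun G _ => not_congr ⟨fun h => h.resolve_right hiF, Or.inl⟩
    rw [if_pos hiF,
      dif_neg (c := i.1 ∈ (M ↾ F.1).E) hiF, h1, h3, selfVar, h2,
      ← Finset.sum_filter_add_sum_filter_not Finset.univ fun G : NPFlat (M ／ F.1) => i.1 ∈ G.1,
      add_sub_cancel_left]
    change _ + 1 ⊗ₜ[ℚ] AugChow.alpha (M ↾ F.1) + _ = _
    abel

/-- The restriction map to `M ／ F` and `M ↾ F`. -/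
noncomputable def resHom (F : PFlat M) :
    AugChow M →ₐ[ℚ] Chow (M ／ F.1) ⊗[ℚ] AugChow (M ↾ F.1) :=
  Ideal.Quotient.liftₐ (augIdeal M) (MvPolynomial.aeval (Sum.elim (resY F) (resVar F))) <| by
    classical
    intro a ha
    rw [← RingHom.mem_ker]
    revert a
    change augIdeal _ ≤ _
    refine sup_le (Ideal.span_le.2 ?_) (Ideal.span_le.2 (Set.union_subset ?_ ?_))
    · rintro _ ⟨i, rfl⟩
      rw [SetLike.mem_coe, RingHom.mem_ker, map_sub, map_sum]
      simp only [yVar, xVar, MvPolynomial.aeval_X, Sum.elim_inl, Sum.elim_inr]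
      rw [sum_resVar_compl, sub_self]
    · rintro _ ⟨G, H, hGH, hHG, rfl⟩
      simp only [SetLike.mem_coe, RingHom.mem_ker, map_mul, xVar, MvPolynomial.aeval_X,
        Sum.elim_inr, resVar]
      refine F.isStar.starVar_mul_starVar (T := Chow (M ／ F.1) ⊗[ℚ] AugChow (M ↾ F.1))
        (fun K L h1 h2 => ?_) (fun K L h1 h2 => ?_) hGH hHG
      · rw [Algebra.TensorProduct.tmul_mul_tmul, Chow.x_mul_x h1 h2, TensorProduct.zero_tmul]
      · rw [Algebra.TensorProduct.tmul_mul_tmul, AugChow.x_mul_x h1 h2, TensorProduct.tmul_zero]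
    · rintro _ ⟨i, G, hiG, rfl⟩
      simp only [SetLike.mem_coe, RingHom.mem_ker, map_mul, xVar, yVar, MvPolynomial.aeval_X,
        Sum.elim_inl, Sum.elim_inr, resVar, resY]
      split_ifs with hiF
      · rcases F.isStar.cases G with ⟨K, rfl⟩ | ⟨K, rfl⟩ | rfl | ⟨h1, h2⟩
        · exact absurd (Or.inr hiF) hiG
        · rw [F.isStar.starVar_v, Algebra.TensorProduct.tmul_mul_tmul, AugChow.y_mul_x,
            TensorProduct.tmul_zero]
          exact hiG
        · exact absurd hiF hiG
        · rw [F.isStar.starVar_eq_zero h1 h2]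
          exact mul_zero (M₀ := Chow (M ／ F.1) ⊗[ℚ] AugChow (M ↾ F.1)) _
      · exact zero_mul (M₀ := Chow (M ／ F.1) ⊗[ℚ] AugChow (M ↾ F.1)) _

theorem resHom_x (F G : PFlat M) : resHom F (AugChow.x M G) = resVar F G :=
  MvPolynomial.aeval_X _ _

theorem resHom_y (F : PFlat M) (i : M.E) : resHom F (AugChow.y M i) = resY F i :=
  MvPolynomial.aeval_X _ _

theorem resHom_alpha (F : PFlat M) :
    resHom F (AugChow.alpha M) = Chow.alpha (M ／ F.1) ⊗ₜ 1 := by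
  classical
  rw [AugChow.alpha, map_sum]
  simp only [resHom_x, resVar]
  rw [← Finset.filter_true (Finset.univ : Finset (PFlat M)), F.isStar.sum_filter_starVar,
    Finset.filter_true, Finset.filter_true, if_pos trivial, ← TensorProduct.sum_tmul,
    ← TensorProduct.tmul_sum, selfVar, TensorProduct.sub_tmul]
  change _ + 1 ⊗ₜ[ℚ] AugChow.alpha (M ↾ F.1) + _ = _
  abel

open Classical in
theorem resHom_gamma (F : PFlat M) :
    resHom F (AugChow.alpha M - ∑ G with F ≤ G, AugChow.x M G) =
      1 ⊗ₜ AugChow.alpha (M ↾ F.1) := by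
  rw [map_sub, resHom_alpha, map_sum]
  simp only [resHom_x]
  rw [resVar, F.isStar.sum_filter_starVar, if_pos le_rfl,
    Finset.filter_true_of_mem (fun G _ => (F.isStar.lt_u G).le),
    Finset.filter_false_of_mem (fun G _ => (F.isStar.v_lt G).not_ge), Finset.sum_empty,
    ← TensorProduct.sum_tmul, selfVar, TensorProduct.sub_tmul]
  abel

theorem contractHom_x (F : PFlat M) (G : NPFlat (M ／ F.1)) :
    contractHom F (Chow.x _ G) = Ideal.Quotient.mk _ (AugChow.x M (F.ofContract G)) :=
  MvPolynomial.aeval_X _ _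

theorem restrictHom_x (F : PFlat M) (G : PFlat (M ↾ F.1)) :
    restrictHom F (AugChow.x _ G) = Ideal.Quotient.mk _ (AugChow.x M (F.ofRestrict G)) :=
  MvPolynomial.aeval_X _ _

theorem contractHom_alpha (F : PFlat M) :
    contractHom F (Chow.alpha (M ／ F.1)) = Ideal.Quotient.mk _ (AugChow.alpha M) := by
  classical
  obtain ⟨i, hi, hiF⟩ := exists_mem_ground_notMem F.2.1 F.2.2
  rw [Chow.alpha_eq (M := M ／ F.1) ⟨hi, hiF⟩, map_sum]
  simp only [contractHom_x]
  rw [← map_sum, ← sub_eq_zero, ← map_sub]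
  refine mk_torsionOf_eq_zero ?_
  rw [sub_mul, AugChow.sum_ofContract F hi hiF, sub_self]

theorem push_resHom (F : PFlat M) (a : AugChow M) :
    push F (resHom F a) = AugChow.x M F * a := by
  classical
  exact mulQuot_productMap_res adjoin_x (fun _ _ h1 h2 => AugChow.x_mul_x h1 h2) F.isStar
    (resHom_x F) (contractHom_x F) (restrictHom_x F) (Finset.mem_univ F) rfl (resHom_alpha F)
    (contractHom_alpha F) a

variable (M) in
theorem isRestrictionSystem : IsRestrictionSystem (AugChow.x M) (AugChow.alpha M)
    (fun F : PFlat M => Chow.x (M ／ F.1)) (fun F => Chow.alpha (M ／ F.1))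
    (fun F => AugChow.x (M ↾ F.1)) (fun F => AugChow.alpha (M ↾ F.1))
    PFlat.ofContract PFlat.ofRestrict resHom push where
  mul_eq_zero _ _ h1 h2 := AugChow.x_mul_x h1 h2
  adjoin_eq_top := adjoin_x
  adjoin_left _ := Chow.adjoin_x
  adjoin_right _ := adjoin_x
  u_le F := F.isStar.u_le
  v_le F := F.isStar.v_le
  range_u F := F.isStar.range_u
  range_v F := F.isStar.range_v
  res_u F G := (resHom_x F _).trans (F.isStar.starVar_u G)
  res_v F G := (resHom_x F _).trans (F.isStar.starVar_v G)
  res_eq_zero F G h1 h2 := (resHom_x F _).trans (F.isStar.starVar_eq_zero h1 h2)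
  push_res := push_resHom
  res_alpha := resHom_alpha
  res_gamma := resHom_gamma
  exists_relation S hS H hH := by
    classical
    obtain ⟨j, hjE, hjH, hj⟩ := exists_mem_of_isChain (f := fun F : PFlat M => F.1)
      (fun _ _ => Iff.rfl) hS (fun K _ => K.2.1.subset_ground)
      (exists_mem_ground_notMem H.2.1 H.2.2)
    -- The relation expressing `y_j`, for `j` outside `H` but in all larger members: `y_j`
    -- annihilates `x_H` and restricts to zero at `H`.
    have hsum : ∑ K : PFlat M, (if j ∉ K.1 then 1 else 0 : ℚ) • AugChow.x M K =
        AugChow.y M ⟨j, hjE⟩ := by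
      simp only [ite_smul, one_smul, zero_smul, ← Finset.sum_filter]
      rw [AugChow.y_eq]
    refine ⟨fun K => if j ∉ K.1 then 1 else 0, if_pos hjH, ?_, ?_, ?_⟩
    · intro K hK hne hc
      have hjK : j ∉ K.1 := fun h => hc (if_neg (not_not.2 h))
      rcases hS hK hH hne with hle | hle
      · exact lt_of_le_of_ne hle hne
      · exact absurd (hj K hK (lt_of_le_of_ne hle hne.symm)) hjK
    · rw [hsum, AugChow.y_mul_x hjH]
    · rw [hsum, resHom_y, resY, dif_neg (c := j ∈ (M ↾ H.1).E) hjH]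

end AugChow

end AugChow

/-! ### Nilpotency of α and of the classes γ. -/

section Powers

open scoped Classical in
-- Each factor γ puts one more element `i` of `I` into the flats. If `G` omits `i`, then γ x_G is a
-- sum of x_H x_G with `i` in `H` and `F` not inside `H`. A nonzero term has `H` comparable to `G`,
-- hence above it, so `H` keeps what `G` already contained. When `I₀` and `I` together span `F`, no
-- flat is left.
theorem pow_card_mul_mem_span {α P A : Type*} [PartialOrder P] [Fintype P] [CommRing A] {x : P → A}
    (hinc : ∀ F G, ¬ F ≤ G → ¬ G ≤ F → x F * x G = 0) {f : P → Set α}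
    (hf : ∀ F G, F ≤ G ↔ f F ⊆ f G) {γ : A} {F : Set α}
    (hγ : ∀ i ∈ F, ∀ G, i ∉ f G → γ * x G = (∑ H with i ∈ f H ∧ ¬ F ⊆ f H, x H) * x G)
    {I₀ : Set α} {a : A} (ha : a ∈ Ideal.span (x '' {G | I₀ ⊆ f G ∧ ¬ F ⊆ f G})) (I : Finset α)
    (hI : ∀ i ∈ I, i ∈ F) :
    γ ^ I.card * a ∈ Ideal.span (x '' {G | (I₀ ⊆ f G ∧ ∀ i ∈ I, i ∈ f G) ∧ ¬ F ⊆ f G}) := by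
  induction I using Finset.induction_on with
  | empty => simpa using ha
  | insert i I hi ih =>
    rw [Finset.card_insert_of_notMem hi, pow_succ', mul_assoc]
    specialize ih fun j hj => hI j (Finset.mem_insert_of_mem hj)
    generalize γ ^ I.card * a = b at ih
    induction ih using Submodule.span_induction with
    | zero => rw [mul_zero]; exact zero_mem _
    | add b c _ _ hb hc => rw [mul_add]; exact add_mem hb hc
    | smul r b _ hb => rw [smul_eq_mul, mul_left_comm]; exact Ideal.mul_mem_left _ _ hb
    | mem b hb =>
      obtain ⟨G, ⟨⟨h0, h1⟩, h2⟩, rfl⟩ := hb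
      by_cases hiG : i ∈ f G
      · refine Ideal.mul_mem_left _ _ (Ideal.subset_span ⟨G, ⟨⟨h0, fun j hj => ?_⟩, h2⟩, rfl⟩)
        rcases Finset.mem_insert.1 hj with rfl | hj
        · exact hiG
        · exact h1 j hj
      rw [hγ i (hI i (Finset.mem_insert_self i I)) G hiG, Finset.sum_mul]
      refine sum_mem fun H hH => ?_
      obtain ⟨-, hiH, hFH⟩ := Finset.mem_filter.1 hH
      by_cases hGH : G ≤ H
      · have hle := (hf G H).1 hGH
        refine Ideal.mul_mem_right _ _ (Ideal.subset_span
          ⟨H, ⟨⟨h0.trans hle, fun j hj => ?_⟩, hFH⟩, rfl⟩)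
        rcases Finset.mem_insert.1 hj with rfl | hj
        · exact hiH
        · exact hle (h1 j hj)
      · rw [hinc H G (fun h => hiG ((hf H G).1 h hiH)) hGH]
        exact zero_mem _

variable {α : Type*} {M : Matroid α}

theorem subset_of_isBasis_subset {F G I : Set α} (hI : M.IsBasis I F) (hG : M.IsFlat G)
    (h : I ⊆ G) : F ⊆ G := by
  have h' := M.closure_subset_closure h
  rw [hG.closure, hI.closure_eq_closure] at h'
  exact (M.subset_closure F hI.subset_ground).trans h'

variable [Finite α]

theorem exists_finset_isBasis {F : Set α} (hF : F ⊆ M.E) :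
    ∃ I : Finset α, M.IsBasis I F ∧ I.card = rk (M ↾ F) := by
  obtain ⟨I, hI⟩ := M.exists_isBasis F
  refine ⟨I.toFinite.toFinset, by simpa using hI, ?_⟩
  rw [← Set.ncard_eq_toFinset_card, ← rk_restrict_indep hI.indep, ← rk_restrict_closure,
    hI.closure_eq_closure, rk_restrict_closure]

open Classical in
theorem Chow.alpha_sub_eq {F : Set α} (hF : F ⊆ M.E) {i : α} (hi : i ∈ F) :
    Chow.alpha M - ∑ G : NPFlat M with F ⊆ G.1, Chow.x M G =
      ∑ G : NPFlat M with i ∈ G.1 ∧ ¬ F ⊆ G.1, Chow.x M G := by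
  rw [Chow.alpha_eq (hF hi), sub_eq_iff_eq_add, ← Finset.sum_filter_add_sum_filter_not
    (Finset.univ.filter fun G : NPFlat M => i ∈ G.1) (fun G => ¬ F ⊆ G.1), Finset.filter_filter,
    Finset.filter_filter]
  congr 1
  refine Finset.sum_congr (Finset.filter_congr fun G _ => ?_) fun _ _ => rfl
  rw [not_not]
  exact ⟨fun h => h.2, fun h => ⟨h hi, h⟩⟩

open Classical in
/-- The power vanishes because the flats that contain a basis of `F` contain `F`. -/
theorem Chow.alpha_sub_pow_eq_zero [M.Loopless] {F : Set α} (hF : F ⊆ M.E) (hne : F.Nonempty) :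
    (Chow.alpha M - ∑ G : NPFlat M with F ⊆ G.1, Chow.x M G) ^ rk (M ↾ F) = 0 := by
  obtain ⟨I, hI, hc⟩ := exists_finset_isBasis hF
  obtain ⟨i, hi⟩ : I.Nonempty := by
    rw [← Finset.card_pos, hc]
    exact rk_restrict_pos hne hF
  have hIF : ∀ j ∈ I, j ∈ F := fun j hj => hI.subset hj
  -- The starting element is γ itself, already a sum over flats containing `i`. One basis element is
  -- thus free, and the exponent is the rank of `F`.
  have h := pow_card_mul_mem_span (x := Chow.x M) (f := fun G => G.1) (F := F)
    (γ := Chow.alpha M - ∑ G : NPFlat M with F ⊆ G.1, Chow.x M G) (I₀ := {i})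
    (a := Chow.alpha M - ∑ G : NPFlat M with F ⊆ G.1, Chow.x M G)
    (fun _ _ h1 h2 => Chow.x_mul_x h1 h2) (fun _ _ => Iff.rfl)
    (fun j hj G _ => by rw [Chow.alpha_sub_eq hF hj])
    (by
      rw [Chow.alpha_sub_eq hF (hIF i hi)]
      refine sum_mem fun G hG => Ideal.subset_span ⟨G, ⟨?_, (Finset.mem_filter.1 hG).2.2⟩, rfl⟩
      exact Set.singleton_subset_iff.2 (Finset.mem_filter.1 hG).2.1)
    (I.erase i) (fun j hj => hIF j (Finset.mem_of_mem_erase hj))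
  rw [← pow_succ, Finset.card_erase_add_one hi, hc] at h
  refine (Submodule.span_eq_bot.2 ?_).le h
  rintro _ ⟨G, ⟨⟨h1, h2⟩, h3⟩, rfl⟩
  refine absurd (subset_of_isBasis_subset hI G.2.1 fun j hj => ?_) h3
  by_cases hji : j = i
  · exact h1 hji
  · exact h2 j (Finset.mem_erase.2 ⟨hji, hj⟩)

open Classical in
theorem AugChow.alpha_sub_eq (F : Set α) :
    AugChow.alpha M - ∑ G : PFlat M with F ⊆ G.1, AugChow.x M G =
      ∑ G : PFlat M with ¬ F ⊆ G.1, AugChow.x M G := by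
  rw [sub_eq_iff_eq_add', AugChow.alpha, Finset.sum_filter_add_sum_filter_not]

open Classical in
/-- The power vanishes because the flats that contain a basis of `F` contain `F`. -/
theorem AugChow.alpha_sub_pow_eq_zero {F : Set α} (hF : F ⊆ M.E) :
    (AugChow.alpha M - ∑ G : PFlat M with F ⊆ G.1, AugChow.x M G) ^ (rk (M ↾ F) + 1) = 0 := by
  obtain ⟨I, hI, hc⟩ := exists_finset_isBasis hF
  rw [AugChow.alpha_sub_eq]
  -- Here γ as starting element contributes no basis element, so `I₀` is empty and the exponent is
  -- one more than the rank of `F`.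
  have h := pow_card_mul_mem_span (x := AugChow.x M) (f := fun G => G.1) (F := F)
    (γ := ∑ G : PFlat M with ¬ F ⊆ G.1, AugChow.x M G) (I₀ := ∅)
    (a := ∑ G : PFlat M with ¬ F ⊆ G.1, AugChow.x M G)
    (fun _ _ h1 h2 => AugChow.x_mul_x h1 h2) (fun _ _ => Iff.rfl)
    (fun j hj G hjG => by
      -- The flats omitting `j` add up to `y_j`, which annihilates `x_G` when `G` omits `j`.
      have hsplit : ∑ G : PFlat M with ¬ F ⊆ G.1, AugChow.x M G =
          ∑ G : PFlat M with j ∈ G.1 ∧ ¬ F ⊆ G.1, AugChow.x M G + AugChow.y M ⟨j, hF hj⟩ := by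
        rw [AugChow.y_eq, ← Finset.sum_filter_add_sum_filter_not
          (Finset.univ.filter fun G : PFlat M => ¬ F ⊆ G.1) (fun G => j ∈ G.1),
          Finset.filter_filter, Finset.filter_filter]
        congr 1
        · exact Finset.sum_congr (Finset.filter_congr fun G _ => and_comm) fun _ _ => rfl
        · exact Finset.sum_congr (Finset.filter_congr fun G _ =>
            ⟨fun h => h.2, fun h => ⟨fun h' => h (h' hj), h⟩⟩) fun _ _ => rfl
      rw [hsplit, add_mul, AugChow.y_mul_x hjG, add_zero])
    (sum_mem fun G hG => Ideal.subset_span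
      ⟨G, ⟨Set.empty_subset _, (Finset.mem_filter.1 hG).2⟩, rfl⟩)
    I (fun j hj => hI.subset hj)
  rw [← pow_succ, hc] at h
  refine (Submodule.span_eq_bot.2 ?_).le h
  rintro _ ⟨G, ⟨⟨-, h2⟩, h3⟩, rfl⟩
  exact absurd (subset_of_isBasis_subset hI G.2.1 h2) h3

/-- The case where `F` is the ground set: no proper flat contains it, so γ is α. -/
theorem Chow.alpha_pow_eq_zero [M.Loopless] (h : 1 ≤ rk M) : Chow.alpha M ^ rk M = 0 := by
  classical
  have h' := Chow.alpha_sub_pow_eq_zero (M := M) subset_rfl (rk_pos_iff.1 h)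
  rwa [rk_restrict_ground, Finset.filter_false_of_mem, Finset.sum_empty, sub_zero] at h'
  exact fun G _ hG => G.2.2.2 (Set.Subset.antisymm G.2.1.subset_ground hG)

theorem AugChow.alpha_pow_eq_zero : AugChow.alpha M ^ (rk M + 1) = 0 := by
  classical
  have h' := AugChow.alpha_sub_pow_eq_zero (M := M) subset_rfl
  rwa [rk_restrict_ground, Finset.filter_false_of_mem, Finset.sum_empty, sub_zero] at h'
  exact fun G _ hG => G.2.2 (Set.Subset.antisymm G.2.1.subset_ground hG)

end Powers

/-! ### Existence and nondegeneracy of the degree maps -/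

/-- A degree map for which the Poincaré pairing is nondegenerate. -/
structure IsPoincareDegree {P A : Type*} [PartialOrder P] [CommRing A] [Algebra ℚ A] (x : P → A)
    (α : A) (n : ℕ) (deg : A →ₗ[ℚ] ℚ) : Prop where
  isFlagDegree : IsFlagDegree x n deg
  deg_pow : ∀ k, deg (α ^ k) = if k = n then 1 else 0
  nondegenerate : IsNondegenerate deg

variable {α : Type*} [Finite α] {M : Matroid α}

/-! ### The Chow ring: induction on the rank. -/

section Chow

/-- The flat is the closure of `{i}`. Its uniqueness makes exactly one term survive in the degree of
a sum over the flats containing `i`. -/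
theorem NPFlat.exists_rk_eq_one [M.Loopless] (hM : 2 ≤ rk M) {i : α} (hi : i ∈ M.E) :
    ∃ F : NPFlat M, i ∈ F.1 ∧ rk (M ↾ F.1) = 1 ∧
      ∀ G : NPFlat M, i ∈ G.1 → rk (M ↾ G.1) = 1 → G = F := by
  have hr : rk (M ↾ M.closure {i}) = 1 := by
    rw [rk_restrict_closure, ← Nat.cast_inj (R := ℕ∞), coe_rk_restrict,
      Matroid.eRk_singleton_eq hi, Nat.cast_one]
  have hmem : i ∈ M.closure {i} := M.mem_closure_of_mem' rfl hi
  refine ⟨⟨M.closure {i}, M.isFlat_closure _, ⟨i, hmem⟩, fun h => ?_⟩, hmem, hr,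
    fun G hG hGr => ?_⟩
  · rw [h, rk_restrict_ground] at hr
    omega
  · refine Subtype.ext (eq_of_rk_le (M.isFlat_closure {i}) G.2.1 ?_ (hGr.trans hr.symm).le).symm
    rw [← G.2.1.closure]
    exact M.closure_subset_closure (Set.singleton_subset_iff.2 hG)

theorem NPFlat.one_le_rk_restrict [M.Loopless] (F : NPFlat M) : 1 ≤ rk (M ↾ F.1) :=
  rk_restrict_pos F.2.2.1 F.2.1.subset_ground

theorem one_le_rk_contract {F : Set α} (hF : M.IsFlat F) (h : F ≠ M.E) : 1 ≤ rk (M ／ F) := by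
  have h1 := rk_contract_add hF.subset_ground
  have h2 := rk_restrict_lt_rk hF h
  omega

namespace Chow

theorem mkₐ_eq_aeval : Ideal.Quotient.mkₐ ℚ (chowIdeal M) = MvPolynomial.aeval (Chow.x M) :=
  MvPolynomial.algHom_ext fun F => (MvPolynomial.aeval_X (Chow.x M) F).symm

theorem apply_eq_zero_of_mem_gr {n : ℕ} {deg : Chow M →ₗ[ℚ] ℚ}
    (hdeg : IsFlagDegree (Chow.x M) n deg) {k : ℕ} (hk : k ≠ n) {a : Chow M}
    (ha : a ∈ Chow.gr M k) : deg a = 0 := by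
  obtain ⟨p, hp, rfl⟩ := ha
  rw [mkₐ_eq_aeval]
  exact (isRestrictionSystem M).apply_aeval_eq_zero hdeg (fun F => Submodule.subset_span ⟨F, rfl⟩)
    hk hp

theorem x_mem_gr (F : NPFlat M) : Chow.x M F ∈ Chow.gr M 1 :=
  ⟨MvPolynomial.X F, MvPolynomial.isHomogeneous_X ℚ F, rfl⟩

theorem prod_x_mem_gr (S : Finset (NPFlat M)) : ∏ F ∈ S, Chow.x M F ∈ Chow.gr M S.card := by
  refine ⟨∏ F ∈ S, MvPolynomial.X F, ?_, map_prod (Ideal.Quotient.mkₐ ℚ (chowIdeal M)) _ _⟩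
  have h := MvPolynomial.IsHomogeneous.prod S (fun F => (MvPolynomial.X F : MvPolynomial _ ℚ))
    (fun _ => 1) fun F _ => MvPolynomial.isHomogeneous_X ℚ F
  rwa [Finset.sum_const, smul_eq_mul, mul_one] at h

theorem pow_mem_gr {a : Chow M} (ha : a ∈ Chow.gr M 1) (k : ℕ) : a ^ k ∈ Chow.gr M k := by
  obtain ⟨p, hp, rfl⟩ := ha
  refine ⟨p ^ k, ?_, map_pow (Ideal.Quotient.mkₐ ℚ (chowIdeal M)) _ _⟩
  have h := MvPolynomial.IsHomogeneous.pow hp k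
  rwa [one_mul] at h

theorem alpha_mem_gr : Chow.alpha M ∈ Chow.gr M 1 := by
  classical
  by_cases h : M.E.Nonempty
  · obtain ⟨i, hi⟩ := h
    rw [Chow.alpha_eq hi]
    exact sum_mem fun F _ => x_mem_gr F
  · rw [Chow.alpha, dif_neg h]
    exact zero_mem _

theorem J_le : Chow.J M ≤ Subalgebra.toSubmodule (Algebra.adjoin ℚ {Chow.alpha M}) :=
  iSup₂_le fun _ _ => inf_le_left

theorem apply_eq_zero_of_mem_J {deg : Chow M →ₗ[ℚ] ℚ}
    (hdeg : IsFlagDegree (Chow.x M) (rk M - 1) deg) {a : Chow M}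
    (ha : a ∈ Chow.J M) (hM : 1 ≤ rk M) : deg a = 0 := by
  suffices h : Chow.J M ≤ LinearMap.ker deg from h ha
  refine iSup₂_le fun k hk b hb => ?_
  exact apply_eq_zero_of_mem_gr hdeg (by omega) hb.2

theorem alpha_pow_mem_H (k : ℕ) : Chow.alpha M ^ k ∈ Chow.H M :=
  pow_mem (Algebra.subset_adjoin (Set.mem_singleton _)) k

theorem alpha_pow_mem_J {k : ℕ} (hk : k + 1 < rk M) : Chow.alpha M ^ k ∈ Chow.J M := by
  have h : Chow.alpha M ^ k ∈ Subalgebra.toSubmodule (Chow.H M) ⊓ Chow.gr M k :=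
    Submodule.mem_inf.2 ⟨(Subalgebra.mem_toSubmodule _).2 (alpha_pow_mem_H k),
      pow_mem_gr alpha_mem_gr k⟩
  exact (le_iSup₂_of_le (f := fun (k : ℕ) (_ : k + 1 ≠ rk M) =>
    Subalgebra.toSubmodule (Chow.H M) ⊓ Chow.gr M k) k hk.ne le_rfl) h

/-- The induction step: degree maps with nondegenerate pairings on the contractions and
localizations produce the degree map of `M` and all properties behind the decomposition. -/
theorem exists_isPushforwardSystem [M.Loopless] (hM : 1 ≤ rk M)
    (hB : ∀ F : NPFlat M, ∃ deg : Chow (M ／ F.1) →ₗ[ℚ] ℚ,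
      IsPoincareDegree (Chow.x _) (Chow.alpha _) (rk (M ／ F.1) - 1) deg)
    (hC : ∀ F : NPFlat M, ∃ deg : Chow (M ↾ F.1) →ₗ[ℚ] ℚ,
      IsPoincareDegree (Chow.x _) (Chow.alpha _) (rk (M ↾ F.1) - 1) deg) :
    ∃ (deg : Chow M →ₗ[ℚ] ℚ) (degB : ∀ F : NPFlat M, Chow (M ／ F.1) →ₗ[ℚ] ℚ)
      (degC : ∀ F : NPFlat M, Chow (M ↾ F.1) →ₗ[ℚ] ℚ),
      IsFlagDegree (Chow.x M) (rk M - 1) deg ∧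
      IsPushforwardSystem (Chow.x M) (Chow.alpha M) (rk M - 1) (fun F => rk (M ↾ F.1)) deg
        degB degC (fun F => Chow.alpha (M ↾ F.1)) (fun F => Chow.J (M ↾ F.1)) resHom push := by
  classical
  choose degB hB using hB
  choose degC hC using hC
  have hB' (F : NPFlat M) := (hB F).isFlagDegree
  have hC' (F : NPFlat M) := (hC F).isFlagDegree
  have hrB (F : NPFlat M) : 1 ≤ rk (M ／ F.1) := one_le_rk_contract F.2.1 F.2.2.2
  have hrC (F : NPFlat M) : 1 ≤ rk (M ↾ F.1) := F.one_le_rk_restrict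
  have hr (F : NPFlat M) : rk (M ／ F.1) - 1 + (rk (M ↾ F.1) - 1) + 1 = rk M - 1 := by
    have := hrB F
    have := hrC F
    have := rk_contract_add F.2.1.subset_ground
    omega
  obtain ⟨deg, hdeg, hmul⟩ := (isRestrictionSystem M).exists_flagDegree (n := rk M - 1) hB' hC' hr
    (fun S hS => by have := NPFlat.card_lt hM hS; omega)
    (π := Ideal.Quotient.mkₐ ℚ (chowIdeal M)) (Ideal.Quotient.mkₐ_surjective _ _)
    (gens := {p | ∃ i ∈ M.E, ∃ j ∈ M.E, i ≠ j ∧ p = linForm M i - linForm M j} ∪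
      {p | ∃ F G : NPFlat M, ¬ F.1 ⊆ G.1 ∧ ¬ G.1 ⊆ F.1 ∧
        p = MvPolynomial.X F * MvPolynomial.X G})
    (by rw [Ideal.span_union]; exact Ideal.Quotient.mkₐ_ker ℚ _)
    (w := fun G F => if F = G then 1 else 0)
    (fun G => by
      simp only [ite_smul, one_smul, zero_smul]
      exact (Fintype.sum_ite_eq' G (Chow.x M)).symm)
    (fun F => ⟨F, if_pos rfl, fun G hG => if_neg hG⟩)
    (by
      intro E hE1 hE2
      simp only [ite_mul, one_mul, zero_mul, Fintype.sum_ite_eq'] at hE1 hE2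
      -- On linear forms the glued functional can be nonzero only in rank two, where a variable has
      -- value `1` exactly if its flat has rank one, and each `i` lies in one such flat. So the
      -- value does not depend on `i`.
      have hlin (i : α) (hi : i ∈ M.E) : E (linForm M i) = if rk M = 2 then 1 else 0 := by
        have h1 (G : NPFlat M) : E (MvPolynomial.X G) = if rk M = 2 ∧ rk (M ↾ G.1) = 1
            then 1 else 0 := by
          have := hr G
          have := hrB G
          have := hrC G
          rw [hE1]
          refine if_congr ?_ rfl rfl
          omega
        rw [linForm, map_sum, Finset.sum_congr rfl fun G _ => h1 G]
        by_cases h2 : rk M = 2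
        · obtain ⟨F, hiF, hF, huniq⟩ := NPFlat.exists_rk_eq_one h2.ge hi
          rw [Finset.sum_eq_single F, if_pos ⟨h2, hF⟩, if_pos h2]
          · intro G hG hGF
            exact if_neg fun h => hGF (huniq G (Finset.mem_filter.1 hG).2 h.2)
          · exact fun h => absurd (Finset.mem_filter.2 ⟨Finset.mem_univ F, hiF⟩) h
        · rw [if_neg h2]
          exact Finset.sum_eq_zero fun G _ => if_neg fun h => h2 h.1
      rintro _ (⟨i, hi, j, hj, -, rfl⟩ | ⟨F, G, h1, h2, rfl⟩)
      · rw [map_sub, hlin i hi, hlin j hj, sub_self]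
      · rw [hE2]
        refine (congrArg _ ((resHom_x F G).trans ?_)).trans (map_zero _)
        exact F.isStar.starVar_eq_zero h1 h2)
  obtain ⟨i, hi⟩ := rk_pos_iff.1 hM
  have hdeg' := (isRestrictionSystem M).deg_pow_alpha hdeg hmul hC' hr
    (fun F => (hB F).deg_pow) (Chow.alpha_eq hi) (fun hn => by
      obtain ⟨F, hiF, hF, huniq⟩ := NPFlat.exists_rk_eq_one (by omega) hi
      refine ⟨F, Finset.mem_filter.2 ⟨Finset.mem_univ F, hiF⟩, by omega, fun G hG hG0 => ?_⟩
      have := hrC G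
      exact huniq G (Finset.mem_filter.1 hG).2 (by omega))
  refine ⟨deg, degB, degC, hdeg, (isRestrictionSystem M).isPushforwardSystem hdeg' hmul
    (fun F => (hB F).nondegenerate) (fun F => (hC F).nondegenerate) (fun F => ?_) ?_
    (fun F j hj => ?_) (fun F k hk => alpha_pow_mem_J hk) (fun F => J_le)⟩
  · exact Chow.alpha_sub_pow_eq_zero F.2.1.subset_ground F.2.2.1
  · rw [Nat.sub_add_cancel hM]
    exact alpha_pow_eq_zero hM
  · exact apply_eq_zero_of_mem_J (hC' F) hj (hrC F)

end Chow

end Chow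

/-- No flat has to be left out for this purpose, so the summands are indexed by all of `P`. -/
theorem IsPushforwardSystem.nondegenerate {P A : Type*} [PartialOrder P] [Fintype P] [CommRing A]
    [Algebra ℚ A] {B C : P → Type*} [∀ F, CommRing (B F)] [∀ F, Algebra ℚ (B F)]
    [∀ F, CommRing (C F)] [∀ F, Algebra ℚ (C F)] {x : P → A} {a : A} {n : ℕ} {e : P → ℕ}
    {deg : A →ₗ[ℚ] ℚ} {degB : ∀ F, B F →ₗ[ℚ] ℚ} {degC : ∀ F, C F →ₗ[ℚ] ℚ} {αC : ∀ F, C F}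
    {J : ∀ F, Submodule ℚ (C F)} {res : ∀ F, A →ₐ[ℚ] B F ⊗[ℚ] C F}
    {push : ∀ F, B F ⊗[ℚ] C F →ₗ[ℚ] A}
    (h : IsPushforwardSystem x a n e deg degB degC αC J res push) : IsNondegenerate deg :=
  (h.isOrthogonalDecomposition Function.injective_id (fun F _ => ⟨F, rfl⟩)
    (S := fun o => o.elim (Subalgebra.toSubmodule (Algebra.adjoin ℚ {a}))
      fun F => pushPart (push F) (J F)) rfl fun _ => rfl).1

/-- Strong induction on the rank: a nonempty proper flat of a loopless matroid has positive rank
below that of `M`, so contraction and localization both have smaller rank. -/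
theorem Chow.exists_isPoincareDegree (M : Matroid α) [M.Loopless] (hM : 1 ≤ rk M) :
    ∃ deg : Chow M →ₗ[ℚ] ℚ, IsPoincareDegree (Chow.x M) (Chow.alpha M) (rk M - 1) deg := by
  induction hn : rk M using Nat.strong_induction_on generalizing M with
  | _ n ih =>
    subst hn
    obtain ⟨deg, degB, degC, hdeg, h⟩ := exists_isPushforwardSystem hM
      (fun F => by
        have := loopless_contract F.2.1
        have h1 := rk_contract_add F.2.1.subset_ground
        have h2 := F.one_le_rk_restrict
        exact ih _ (by omega) _ (one_le_rk_contract F.2.1 F.2.2.2) rfl)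
      (fun F => by
        have := loopless_restrict F.2.1.subset_ground
        exact ih _ (rk_restrict_lt_rk F.2.1 F.2.2.2) _ F.one_le_rk_restrict rfl)
    exact ⟨deg, hdeg, h.deg_alpha, h.nondegenerate⟩

theorem Chow.exists_isPushforwardSystem_of_loopless (M : Matroid α) [M.Loopless] (hM : 1 ≤ rk M) :
    ∃ (deg : Chow M →ₗ[ℚ] ℚ) (degB : ∀ F : NPFlat M, Chow (M ／ F.1) →ₗ[ℚ] ℚ)
      (degC : ∀ F : NPFlat M, Chow (M ↾ F.1) →ₗ[ℚ] ℚ),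
      IsFlagDegree (Chow.x M) (rk M - 1) deg ∧
      IsPushforwardSystem (Chow.x M) (Chow.alpha M) (rk M - 1) (fun F => rk (M ↾ F.1)) deg
        degB degC (fun F => Chow.alpha (M ↾ F.1)) (fun F => Chow.J (M ↾ F.1)) resHom push :=
  exists_isPushforwardSystem hM
    (fun F => have := loopless_contract F.2.1
      exists_isPoincareDegree _ (one_le_rk_contract F.2.1 F.2.2.2))
    (fun F => have := loopless_restrict F.2.1.subset_ground
      exists_isPoincareDegree _ F.one_le_rk_restrict)

/-! ### The augmented Chow ring: induction on the rank. -/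

namespace AugChow

theorem mkₐ_eq_aeval : Ideal.Quotient.mkₐ ℚ (augIdeal M) =
    MvPolynomial.aeval (Sum.elim (AugChow.y M) (AugChow.x M)) := by
  refine MvPolynomial.algHom_ext fun t => ?_
  rw [MvPolynomial.aeval_X]
  cases t <;> rfl

theorem elim_mem_span (t : M.E ⊕ PFlat M) :
    Sum.elim (AugChow.y M) (AugChow.x M) t ∈ Submodule.span ℚ (Set.range (AugChow.x M)) := by
  cases t with
  | inl i => exact y_mem_span i
  | inr F => exact x_mem_span F

theorem apply_eq_zero_of_mem_gr {n : ℕ} {deg : AugChow M →ₗ[ℚ] ℚ}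
    (hdeg : IsFlagDegree (AugChow.x M) n deg) {k : ℕ} (hk : k ≠ n) {a : AugChow M}
    (ha : a ∈ AugChow.gr M k) : deg a = 0 := by
  obtain ⟨p, hp, rfl⟩ := ha
  rw [mkₐ_eq_aeval]
  exact (isRestrictionSystem M).apply_aeval_eq_zero hdeg elim_mem_span hk hp

theorem x_mem_gr (F : PFlat M) : AugChow.x M F ∈ AugChow.gr M 1 :=
  ⟨xVar M F, MvPolynomial.isHomogeneous_X ℚ _, rfl⟩

theorem prod_x_mem_gr (S : Finset (PFlat M)) : ∏ F ∈ S, AugChow.x M F ∈ AugChow.gr M S.card := by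
  refine ⟨∏ F ∈ S, xVar M F, ?_, map_prod (Ideal.Quotient.mkₐ ℚ (augIdeal M)) _ _⟩
  have h := MvPolynomial.IsHomogeneous.prod S (fun F => xVar M F)
    (fun _ => 1) fun F _ => MvPolynomial.isHomogeneous_X ℚ _
  rwa [Finset.sum_const, smul_eq_mul, mul_one] at h

theorem pow_mem_gr {a : AugChow M} (ha : a ∈ AugChow.gr M 1) (k : ℕ) :
    a ^ k ∈ AugChow.gr M k := by
  obtain ⟨p, hp, rfl⟩ := ha
  refine ⟨p ^ k, ?_, map_pow (Ideal.Quotient.mkₐ ℚ (augIdeal M)) _ _⟩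
  have h := MvPolynomial.IsHomogeneous.pow hp k
  rwa [one_mul] at h

theorem alpha_mem_gr : AugChow.alpha M ∈ AugChow.gr M 1 :=
  sum_mem fun F _ => x_mem_gr F

theorem J_le : AugChow.J M ≤ Subalgebra.toSubmodule (Algebra.adjoin ℚ {AugChow.alpha M}) :=
  iSup₂_le fun _ _ => inf_le_left

theorem apply_eq_zero_of_mem_J {deg : AugChow M →ₗ[ℚ] ℚ}
    (hdeg : IsFlagDegree (AugChow.x M) (rk M) deg) {a : AugChow M}
    (ha : a ∈ AugChow.J M) : deg a = 0 := by
  suffices h : AugChow.J M ≤ LinearMap.ker deg from h ha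
  exact iSup₂_le fun k hk b hb => apply_eq_zero_of_mem_gr hdeg hk hb.2

theorem alpha_pow_mem_H (k : ℕ) : AugChow.alpha M ^ k ∈ AugChow.H M :=
  pow_mem (Algebra.subset_adjoin (Set.mem_singleton _)) k

theorem alpha_pow_mem_J {k : ℕ} (hk : k < rk M) : AugChow.alpha M ^ k ∈ AugChow.J M := by
  have h : AugChow.alpha M ^ k ∈ Subalgebra.toSubmodule (AugChow.H M) ⊓ AugChow.gr M k :=
    Submodule.mem_inf.2 ⟨(Subalgebra.mem_toSubmodule _).2 (alpha_pow_mem_H k),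
      pow_mem_gr alpha_mem_gr k⟩
  exact (le_iSup₂_of_le (f := fun (k : ℕ) (_ : k ≠ rk M) =>
    Subalgebra.toSubmodule (AugChow.H M) ⊓ AugChow.gr M k) k hk.ne le_rfl) h

/-- The left factors are ordinary Chow rings, whose degree maps are already available even for the
empty flat. Only the localizations have to be assumed. -/
theorem exists_isPushforwardSystem [M.Loopless]
    (hC : ∀ F : PFlat M, ∃ deg : AugChow (M ↾ F.1) →ₗ[ℚ] ℚ,
      IsPoincareDegree (AugChow.x _) (AugChow.alpha _) (rk (M ↾ F.1)) deg) :
    ∃ (deg : AugChow M →ₗ[ℚ] ℚ) (degB : ∀ F : PFlat M, Chow (M ／ F.1) →ₗ[ℚ] ℚ)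
      (degC : ∀ F : PFlat M, AugChow (M ↾ F.1) →ₗ[ℚ] ℚ),
      IsFlagDegree (AugChow.x M) (rk M) deg ∧
      IsPushforwardSystem (AugChow.x M) (AugChow.alpha M) (rk M) (fun F => rk (M ↾ F.1) + 1) deg
        degB degC (fun F => AugChow.alpha (M ↾ F.1)) (fun F => AugChow.J (M ↾ F.1)) resHom
        push := by
  classical
  have hB (F : PFlat M) : ∃ deg : Chow (M ／ F.1) →ₗ[ℚ] ℚ,
      IsPoincareDegree (Chow.x _) (Chow.alpha _) (rk (M ／ F.1) - 1) deg :=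
    have := loopless_contract F.2.1
    Chow.exists_isPoincareDegree _ (one_le_rk_contract F.2.1 F.2.2)
  choose degB hB using hB
  choose degC hC using hC
  have hB' (F : PFlat M) := (hB F).isFlagDegree
  have hC' (F : PFlat M) := (hC F).isFlagDegree
  have hr (F : PFlat M) : rk (M ／ F.1) - 1 + rk (M ↾ F.1) + 1 = rk M := by
    have := one_le_rk_contract F.2.1 F.2.2
    have := rk_contract_add F.2.1.subset_ground
    omega
  obtain ⟨deg, hdeg, hmul⟩ := (isRestrictionSystem M).exists_flagDegree (n := rk M) hB' hC' hr
    (fun S hS => PFlat.card_add_le hS (Nat.zero_le _) fun _ _ => Nat.zero_le _)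
    (π := Ideal.Quotient.mkₐ ℚ (augIdeal M)) (Ideal.Quotient.mkₐ_surjective _ _)
    (gens := {p | ∃ i : M.E, p = yVar M i - ∑ F : PFlat M with i.1 ∉ F.1, xVar M F} ∪
      ({p | ∃ F G : PFlat M, ¬ F.1 ⊆ G.1 ∧ ¬ G.1 ⊆ F.1 ∧ p = xVar M F * xVar M G} ∪
      {p | ∃ (i : M.E) (F : PFlat M), i.1 ∉ F.1 ∧ p = yVar M i * xVar M F}))
    (by rw [Ideal.span_union]; exact Ideal.Quotient.mkₐ_ker ℚ _)
    (w := Sum.elim (fun i F => if i.1 ∉ F.1 then 1 else 0) fun G F => if F = G then 1 else 0)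
    (by
      rintro (i | G)
      · simp only [Sum.elim_inl, ite_smul, one_smul, zero_smul, ← Finset.sum_filter]
        exact AugChow.y_eq i
      · simp only [Sum.elim_inr, ite_smul, one_smul, zero_smul]
        exact (Fintype.sum_ite_eq' G (AugChow.x M)).symm)
    (fun F => ⟨Sum.inr F, if_pos rfl, fun G hG => if_neg hG⟩)
    (by
      intro E hE1 hE2
      have hx1 (G : PFlat M) : E (xVar M G) = if rk (M ／ G.1) - 1 = 0 ∧ rk (M ↾ G.1) = 0
          then 1 else 0 := by
        refine (hE1 (Sum.inr G)).trans ?_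
        simp only [Sum.elim_inr, ite_mul, one_mul, zero_mul, Fintype.sum_ite_eq']
      have hx2 (G : PFlat M) (s) : E (xVar M G * MvPolynomial.X s) = tensorDeg (degB G) (degC G)
          (resHom G (Ideal.Quotient.mkₐ ℚ (augIdeal M) (MvPolynomial.X s))) := by
        refine (hE2 (Sum.inr G) s).trans ?_
        simp only [Sum.elim_inr, ite_mul, one_mul, zero_mul, Fintype.sum_ite_eq']
      rintro _ (⟨i, rfl⟩ | ⟨F, G, h1, h2, rfl⟩ | ⟨i, F, hi, rfl⟩)
      -- The weights of `y_i` are those of the sum it equals, so the two values agree term by term.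
      · rw [map_sub, map_sum, yVar, hE1, sub_eq_zero]
        simp only [Sum.elim_inl, hx1, Finset.sum_filter, ite_mul, one_mul, zero_mul]
      · rw [xVar, xVar, ← xVar, hx2]
        refine (congrArg _ ((resHom_x F G).trans ?_)).trans (map_zero _)
        exact F.isStar.starVar_eq_zero h1 h2
      -- The product vanishes since `y_i` restricts to zero at a flat omitting `i`.
      · rw [mul_comm, yVar, hx2]
        refine (congrArg _ ((resHom_y F i).trans ?_)).trans (map_zero _)
        exact dif_neg hi)
  have hdeg' := (isRestrictionSystem M).deg_pow_alpha hdeg hmul hC' hr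
    (fun F => (hB F).deg_pow) (T := Finset.univ) rfl (fun hn => by
      have hflat : M.IsFlat ∅ := by
        rw [Matroid.isFlat_iff_closure_eq, Matroid.closure_empty, M.loops_eq_empty]
      -- The empty set is the only flat of rank zero, hence the only term of α that contributes.
      refine ⟨⟨∅, hflat, fun h => ?_⟩, Finset.mem_univ _, ?_, fun G _ hG0 => ?_⟩
      · exact Set.not_nonempty_iff_eq_empty.2 h.symm (rk_pos_iff.1 hn)
      · rw [rk_restrict_indep M.empty_indep, Set.ncard_empty]
      · refine Subtype.ext (Set.not_nonempty_iff_eq_empty.1 fun hne => ?_)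
        have := rk_restrict_pos hne G.2.1.subset_ground
        omega)
  refine ⟨deg, degB, degC, hdeg, (isRestrictionSystem M).isPushforwardSystem hdeg' hmul
    (fun F => (hB F).nondegenerate) (fun F => (hC F).nondegenerate) (fun F => ?_)
    alpha_pow_eq_zero (fun F j hj => apply_eq_zero_of_mem_J (hC' F) hj)
    (fun F k hk => alpha_pow_mem_J (by omega)) (fun F => J_le)⟩
  exact alpha_sub_pow_eq_zero F.2.1.subset_ground

theorem exists_isPoincareDegree (M : Matroid α) [M.Loopless] :
    ∃ deg : AugChow M →ₗ[ℚ] ℚ,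
      IsPoincareDegree (AugChow.x M) (AugChow.alpha M) (rk M) deg := by
  induction hn : rk M using Nat.strong_induction_on generalizing M with
  | _ n ih =>
    subst hn
    obtain ⟨deg, degB, degC, hdeg, h⟩ := exists_isPushforwardSystem (M := M)
      (fun F => by
        have := loopless_restrict F.2.1.subset_ground
        exact ih _ (rk_restrict_lt_rk F.2.1 F.2.2) _ rfl)
    exact ⟨deg, hdeg, h.deg_alpha, h.nondegenerate⟩

theorem exists_isPushforwardSystem_of_loopless (M : Matroid α) [M.Loopless] :
    ∃ (deg : AugChow M →ₗ[ℚ] ℚ) (degB : ∀ F : PFlat M, Chow (M ／ F.1) →ₗ[ℚ] ℚ)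
      (degC : ∀ F : PFlat M, AugChow (M ↾ F.1) →ₗ[ℚ] ℚ),
      IsFlagDegree (AugChow.x M) (rk M) deg ∧
      IsPushforwardSystem (AugChow.x M) (AugChow.alpha M) (rk M) (fun F => rk (M ↾ F.1) + 1) deg
        degB degC (fun F => AugChow.alpha (M ↾ F.1)) (fun F => AugChow.J (M ↾ F.1)) resHom
        push :=
  exists_isPushforwardSystem fun F =>
    have := loopless_restrict F.2.1.subset_ground
    exists_isPoincareDegree _

end AugChow

/-! ### Degree maps compared with functionals prescribed on flags. -/

namespace Chow

/-- Positive rank is needed for `rk M - 1` to be the true top degree. In rank zero a degree map is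
zero. -/
theorem isDegreeMap_iff [M.Loopless] (hM : 1 ≤ rk M) {deg : Chow M →ₗ[ℚ] ℚ} :
    IsDegreeMap M deg ↔ IsFlagDegree (Chow.x M) (rk M - 1) deg := by
  refine ⟨fun h => ⟨fun S hS => ?_, fun S hS => ?_⟩, fun h => ⟨fun k hk a ha => ?_, fun S hS hc => ?_⟩⟩
  · have := NPFlat.card_lt hM hS
    omega
  · split_ifs with hc
    · exact h.flag S hS (by omega)
    · exact h.eq_zero _ (by omega) _ (prod_x_mem_gr S)
  · exact apply_eq_zero_of_mem_gr h (by omega) ha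
  · rw [h.apply_prod S hS, if_pos (by omega)]

end Chow

namespace AugChow

/-- Induction on the independent set, replacing one `y_i` by the sum of the `x_G` with `i` outside
`G`. A nonzero term needs `G` to contain the other elements of `I` and to lie below all of `S`. The
closure of the other elements qualifies and lengthens the flag by one, and any larger `G` would make
the flag too long for the rank. -/
theorem deg_prod_y_mul_prod_x {deg : AugChow M →ₗ[ℚ] ℚ} (h : IsFlagDegree (AugChow.x M) (rk M) deg)
    (I : Finset M.E) (S : Finset (PFlat M)) (hI : M.Indep (Subtype.val '' (I : Set M.E)))
    (hS : IsChain (· ≤ ·) (S : Set (PFlat M))) (hIS : ∀ F ∈ S, ∀ i ∈ I, i.1 ∈ F.1)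
    (hc : I.card + S.card = rk M) :
    deg ((∏ i ∈ I, AugChow.y M i) * ∏ F ∈ S, AugChow.x M F) = 1 := by
  classical
  induction I using Finset.induction_on generalizing S with
  | empty =>
    rw [Finset.card_empty, zero_add] at hc
    rw [Finset.prod_empty, one_mul, h.apply_prod S hS, if_pos hc]
  | insert i I hi ih =>
    rw [Finset.card_insert_of_notMem hi] at hc
    rw [Finset.coe_insert, Set.image_insert_eq] at hI
    set X : Set α := Subtype.val '' (I : Set M.E) with hX
    have hiX : i.1 ∉ X := by
      rintro ⟨j, hj, hji⟩
      exact hi (Subtype.ext hji ▸ hj)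
    have hXi := hI.subset (Set.subset_insert _ _)
    have hicl : i.1 ∉ M.closure X := ((hXi.insert_indep_iff_of_notMem hiX).1 hI).2
    have hrX : rk (M ↾ M.closure X) = I.card := by
      rw [rk_restrict_closure, rk_restrict_indep hXi, hX,
        Set.ncard_image_of_injective _ Subtype.val_injective, Set.ncard_coe_finset]
    let G₀ : PFlat M := ⟨M.closure X, M.isFlat_closure X, fun he => hicl (he.symm.subset i.2)⟩
    have hle (F : PFlat M) (hF : F ∈ S) : G₀ < F := by
      refine lt_of_le_not_ge ?_ fun hle => hicl (hle (hIS F hF i (Finset.mem_insert_self i I)))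
      change M.closure X ⊆ F.1
      rw [← F.2.1.closure]
      refine M.closure_subset_closure ?_
      rintro _ ⟨j, hj, rfl⟩
      exact hIS F hF j (Finset.mem_insert_of_mem hj)
    rw [Finset.prod_insert hi, AugChow.y_eq, Finset.sum_mul, Finset.sum_mul, map_sum,
      Finset.sum_eq_single G₀]
    · have hG₀ : G₀ ∉ S := fun hmem => lt_irrefl _ (hle G₀ hmem)
      rw [mul_comm (AugChow.x M G₀), mul_assoc, ← Finset.prod_insert hG₀]
      refine ih _ hXi ?_ ?_ ?_
      · rw [Finset.coe_insert]
        exact hS.insert fun F hF _ => Or.inl (hle F hF).le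
      · intro F hF j hj
        rcases Finset.mem_insert.1 hF with rfl | hF
        · exact M.subset_closure X hXi.subset_ground ⟨j, hj, rfl⟩
        · exact hIS F hF j (Finset.mem_insert_of_mem hj)
      · rw [Finset.card_insert_of_notMem hG₀]
        omega
    · intro G hG hne
      replace hG : i.1 ∉ G.1 := (Finset.mem_filter.1 hG).2
      suffices h0 : AugChow.x M G * (∏ i ∈ I, AugChow.y M i) * ∏ F ∈ S, AugChow.x M F = 0 by
        rw [h0, map_zero]
      by_cases hXG : ∀ j ∈ I, j.1 ∈ G.1
      · by_cases hGS : ∀ F ∈ S, G ≤ F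
        · exfalso
          have hsub : M.closure X ⊆ G.1 := by
            rw [← G.2.1.closure]
            refine M.closure_subset_closure ?_
            rintro _ ⟨j, hj, rfl⟩
            exact hXG j hj
          have hlt : G₀ < G := lt_of_le_of_ne hsub (Ne.symm hne)
          have hrG : I.card + 1 ≤ rk (M ↾ G.1) := hrX ▸ PFlat.rk_lt_rk hlt
          have hGS' : G ∉ S := fun hmem => hG (hIS G hmem i (Finset.mem_insert_self i I))
          -- Together with `G` the flag would have `rk M - I.card` members, all of rank at least
          -- `I.card + 1`.
          have hcard := PFlat.card_add_le (S := insert G S) (k := I.card + 1) ?_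
            (hrG.trans (rk_restrict_le M G.1)) ?_
          · rw [Finset.card_insert_of_notMem hGS'] at hcard
            omega
          · rw [Finset.coe_insert]
            exact hS.insert fun F hF _ => Or.inl (hGS F hF)
          · intro F hF
            rcases Finset.mem_insert.1 hF with rfl | hF
            · exact hrG
            · exact hrG.trans (rk_restrict_mono (hGS F hF))
        · push Not at hGS
          obtain ⟨F, hF, hGF⟩ := hGS
          rw [← Finset.mul_prod_erase S _ hF, mul_right_comm, ← mul_assoc, AugChow.x_mul_x hGF,
            zero_mul, zero_mul]
          exact fun hFG => hG (hFG (hIS F hF i (Finset.mem_insert_self i I)))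
      · push Not at hXG
        obtain ⟨j, hj, hjG⟩ := hXG
        rw [← Finset.mul_prod_erase I _ hj, ← mul_assoc, mul_comm (AugChow.x M G),
          AugChow.y_mul_x hjG, zero_mul, zero_mul]
    · exact fun hmem => absurd (Finset.mem_filter.2 ⟨Finset.mem_univ G₀, hicl⟩) hmem

theorem isDegreeMap_iff {deg : AugChow M →ₗ[ℚ] ℚ} :
    IsDegreeMap M deg ↔ IsFlagDegree (AugChow.x M) (rk M) deg := by
  refine ⟨fun h => ⟨fun S hS => ?_, fun S hS => ?_⟩, fun h => ⟨fun k hk a ha => ?_, ?_⟩⟩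
  · exact PFlat.card_add_le hS (Nat.zero_le _) fun _ _ => Nat.zero_le _
  · split_ifs with hc
    · have h1 := h.flag ∅ S (by simp) hS (by simp) (by simpa using hc)
      rwa [Finset.prod_empty, one_mul] at h1
    · exact h.eq_zero _ hc _ (prod_x_mem_gr S)
  · exact apply_eq_zero_of_mem_gr h hk ha
  · exact deg_prod_y_mul_prod_x h

end AugChow

/-! ### The decompositions -/

theorem IsOrthogonalDecomposition.of_subsingleton {A ι : Type*} [CommRing A] [Algebra ℚ A]
    {H : Subalgebra ℚ A} {deg : A →ₗ[ℚ] ℚ} [Subsingleton ι] {S : ι → Submodule ℚ A} {i : ι}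
    (hi : S i = ⊤) : IsOrthogonalDecomposition H deg S where
  mul_mem j a _ s _ := by
    rw [Subsingleton.elim j i, hi]
    exact Submodule.mem_top
  isInternal := by
    convert (DirectSum.isInternal_submodule_iff_iSupIndep_and_iSup_eq_top S).2
      ⟨fun j => by
        rw [iSup₂_eq_bot.2 fun k hk => absurd (Subsingleton.elim k j) hk]
        exact disjoint_bot_right, eq_top_iff.2 (hi.symm.le.trans (le_iSup S i))⟩
    rfl
  orthogonal j k hjk := absurd (Subsingleton.elim j k) hjk

theorem Chow.exists_decomposition (M : Matroid α) [M.Loopless] :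
    (∃! deg : Chow M →ₗ[ℚ] ℚ, Chow.IsDegreeMap M deg) ∧
      (∀ F : Chow.Index M, Function.Injective (Chow.push F.1)) ∧
      ∀ deg : Chow M →ₗ[ℚ] ℚ, Chow.IsDegreeMap M deg →
        IsOrthogonalDecomposition (Chow.H M) deg (Chow.summand M) := by
  by_cases hM : 1 ≤ rk M
  · obtain ⟨deg, degB, degC, hdeg, h⟩ := exists_isPushforwardSystem_of_loopless M hM
    have huniq (deg' : Chow M →ₗ[ℚ] ℚ) (h' : Chow.IsDegreeMap M deg') : deg' = deg :=
      (isRestrictionSystem M).flagDegree_unique ((isDegreeMap_iff hM).1 h') hdeg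
    refine ⟨⟨deg, (isDegreeMap_iff hM).2 hdeg, huniq⟩, fun F => h.push_injective F.1,
      fun deg' h' => ?_⟩
    rw [huniq deg' h']
    -- Here `e F` is the rank of `F`, so the indices are the flats of rank at least two.
    refine (h.isOrthogonalDecomposition (f := fun F : Chow.Index M => F.1)
      Subtype.val_injective (fun F hF => ⟨⟨F, ?_⟩, rfl⟩) rfl fun _ => rfl).2
    rw [← coe_rk_restrict]
    exact_mod_cast hF
  -- Rank zero: the ground set is empty, there are no variables, the subalgebra generated by α is
  -- everything, and no degree `k` satisfies `k + 1 = rk M`, so the only degree map is zero.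
  · have hE : ¬ M.E.Nonempty := fun h => hM (rk_pos_iff.2 h)
    have hP : IsEmpty (NPFlat M) :=
      ⟨fun F => hE (F.2.2.1.mono F.2.1.subset_ground)⟩
    have hH : Chow.H M = ⊤ := by
      have h := Chow.adjoin_x (M := M)
      rw [Set.range_eq_empty, Algebra.adjoin_empty] at h
      rw [eq_top_iff, ← h]
      exact bot_le
    have hzero (deg : Chow M →ₗ[ℚ] ℚ) (h : Chow.IsDegreeMap M deg) : deg = 0 := by
      refine LinearMap.ext fun a => ?_
      obtain ⟨p, rfl⟩ := Ideal.Quotient.mkₐ_surjective ℚ (chowIdeal M) a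
      rw [← p.sum_homogeneousComponent, map_sum, map_sum, LinearMap.zero_apply]
      refine Finset.sum_eq_zero fun k _ => ?_
      have hk : k + 1 ≠ rk M := by omega
      exact h.eq_zero k hk _ (Submodule.mem_map_of_mem (p.homogeneousComponent_mem k))
    refine ⟨⟨0, ⟨fun _ _ _ _ => LinearMap.zero_apply _, fun S _ hS => by omega⟩, hzero⟩,
      fun F => hP.elim F.1, fun deg h => ?_⟩
    have hI : IsEmpty (Chow.Index M) := ⟨fun F => hP.elim F.1⟩
    refine IsOrthogonalDecomposition.of_subsingleton (i := none) ?_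
    change Subalgebra.toSubmodule (Chow.H M) = ⊤
    rw [hH, Algebra.top_toSubmodule]

theorem AugChow.exists_decomposition (M : Matroid α) [M.Loopless] :
    (∃! deg : AugChow M →ₗ[ℚ] ℚ, AugChow.IsDegreeMap M deg) ∧
      (∀ F : NPFlat M, Function.Injective (AugChow.push F.toPFlat)) ∧
      ∀ deg : AugChow M →ₗ[ℚ] ℚ, AugChow.IsDegreeMap M deg →
        IsOrthogonalDecomposition (AugChow.H M) deg (AugChow.summand M) := by
  obtain ⟨deg, degB, degC, hdeg, h⟩ := exists_isPushforwardSystem_of_loopless M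
  have huniq (deg' : AugChow M →ₗ[ℚ] ℚ) (h' : AugChow.IsDegreeMap M deg') : deg' = deg :=
    (isRestrictionSystem M).flagDegree_unique (isDegreeMap_iff.1 h') hdeg
  refine ⟨⟨deg, isDegreeMap_iff.2 hdeg, huniq⟩, fun F => h.push_injective F.toPFlat,
    fun deg' h' => ?_⟩
  rw [huniq deg' h']
  -- Here `e F` is the rank of `F` plus one, so `1 < e F` excludes exactly the empty flat.
  refine (h.isOrthogonalDecomposition (f := NPFlat.toPFlat) (fun F G hFG => ?_)
    (fun F hF => ⟨⟨F.1, F.2.1, ?_, F.2.2⟩, rfl⟩) rfl fun _ => rfl).2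
  · exact Subtype.ext (congrArg (fun K : PFlat M => K.1) hFG)
  · rw [Set.nonempty_iff_ne_empty]
    intro h0
    rw [h0, rk_restrict_indep M.empty_indep, Set.ncard_empty] at hF
    omega

end MatroidChow

open MatroidChow in
theorem theorem1p4 {α : Type*} [Finite α] (M : Matroid α) [M.Loopless] :
    ((∃! deg : Chow M →ₗ[ℚ] ℚ, Chow.IsDegreeMap M deg) ∧
      (∀ F : Chow.Index M, Function.Injective (Chow.push F.1)) ∧
      ∀ deg : Chow M →ₗ[ℚ] ℚ, Chow.IsDegreeMap M deg →
        IsOrthogonalDecomposition (Chow.H M) deg (Chow.summand M)) ∧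
    ((∃! deg : AugChow M →ₗ[ℚ] ℚ, AugChow.IsDegreeMap M deg) ∧
      (∀ F : NPFlat M, Function.Injective (AugChow.push F.toPFlat)) ∧
      ∀ deg : AugChow M →ₗ[ℚ] ℚ, AugChow.IsDegreeMap M deg →
        IsOrthogonalDecomposition (AugChow.H M) deg (AugChow.summand M)) :=
  ⟨Chow.exists_decomposition M, AugChow.exists_decomposition M⟩
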